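/- **Theorem.** Let $p\in\mathbb C\setminus\mathbb Q$; write $q^x=e^{\pi i x/p}$, $q=q^1$, $s(x)=\sin(\pi x/p)$ (so $q$ is not a root of unity). *The algebra.* $U_q\widehat{gl(2)}$ is the unital associative $\mathbb C$-algebra with generators $L_{ij}^{(+0)},L_{ji}^{(-0)}$ ($1\le j\le i\le 2$) and $L_{ij}^{(s)}$ ($i,j=1,2$, $s=\pm1,\pm2,\dots$) and relations, for $L^\pm_{ij}(\xi)=L_{ij}^{(\pm0)}+\sum_{s\ge1}L_{ij}^{(\pm s)}\xi^{\pm s}$ (with $L^{(+0)}_{12}=L^{(-0)}_{21}=0$), $L_{(1)}=L\otimes1$, $L_{(2)}=1\otimes L$, $$R(\xi/\zeta)L^{\epsilon}_{(1)}(\xi)L^{\epsilon'}_{(2)}(\zeta)=L^{\epsilon'}_{(2)}(\zeta)L^{\epsilon}_{(1)}(\xi)R(\xi/\zeta),\qquad (\epsilon,\epsilon')\in\{(+,+),(-,-),(+,-)\},$$ $L_{11}^{(\pm0)}L_{22}^{(\pm0)}=L_{22}^{(\pm0)}L_{11}^{(\pm0)}=1$, $L_{ii}^{(\pm0)}L_{ii}^{(\mp0)}=1$,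 where $$R(\xi)=(\xi q-q^{-1})(e_{11}\otimes e_{11}+e_{22}\otimes e_{22})+(\xi-1)(e_{11}\otimes e_{22}+e_{22}\otimes e_{11})+\xi(q-q^{-1})e_{12}\otimes e_{21}+(q-q^{-1})e_{21}\otimes e_{12}.$$ *The space.* For $n\ge1$ and $z,\lambda\in\mathbb C^n$ let $\mathfrak F^q(z,\lambda)=\bigoplus_{l\ge0}\mathfrak F^q_l(z,\lambda)$, where $\mathfrak F^q_l(z,\lambda)$ is the space of functions $$P(q^{2t_1},\dots,q^{2t_l})\prod_{a=1}^n\prod_{b=1}^l\frac{q^{z_a-t_b}}{s(t_b-z_a-\lambda_a)}\prod_{1\le a<b\le l}\frac{s(t_a-t_b)}{s(t_a-t_b+1)}$$ with $P$ a symmetric complex polynomial of degree less than $n$ in each variable. *The action.* Permutations act on functions of $t_1,\dots,t_l$ by $$[f]_{(i,i+1)}(t)=f(\dots,t_{i+1},t_i,\dots)\,\frac{s(t_i-t_{i+1}-1)}{s(t_i-t_{i+1}+1)}.$$ Put $G(x)=\prod_{a=1}^n\frac{s(x-z_a+\lambda_a)}{s(x-z_a-\lambda_a)}$, $\xi=q^{2u}$,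 and $\widetilde L^\pm_{ij}(\xi)=L^\pm_{ij}(\xi)\prod_{a=1}^n\frac{\pm i\,q^{\pm(z_a-u)}}{2\,s(u-z_a-\lambda_a)}$. For $f\in\mathfrak F^q_l(z,\lambda)$ set $$\widetilde L^\pm_{11}(\xi)f=f\,G(u)\prod_{a=1}^l\frac{s(u-t_a-1)}{s(u-t_a)}+s(1)\prod_{a=1}^l\frac{s(u-t_a-1)}{s(u-t_a)}\sum_{a=1}^l\Big[\frac{f(t_1,\dots,t_{l-1},u)\,q^{u-t_l}}{s(u-t_l-1)}G(t_l)\Big]_{(a,l)},$$ $$\widetilde L^\pm_{22}(\xi)f=f\prod_{a=1}^l\frac{s(u-t_a+1)}{s(u-t_a)}-s(1)\prod_{a=1}^l\frac{s(u-t_a+1)}{s(u-t_a)}\sum_{a=1}^l\Big[\frac{f(u,t_2,\dots,t_l)\,q^{u-t_1}}{s(u-t_1+1)}\Big]_{(1,a)},$$ $$\widetilde L^\pm_{12}(\xi)f=s(1)\sum_{a=1}^{l+1}\Big[\frac{f(t_2,\dots,t_{l+1})\,q^{u-t_1}}{s(u-t_1)}\Big(G(t_1)\prod_{c=2}^{l+1}\frac{s(u-t_c+1)}{s(u-t_c)}\frac{s(t_1-t_c-1)}{s(t_1-t_c+1)}-G(u)\prod_{c=2}^{l+1}\frac{s(u-t_c-1)}{s(u-t_c)}\Big)\Big]_{(1,a)}$$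 $$\qquad-s(1)^2\prod_{a=1}^{l+1}\frac{s(u-t_a+1)}{s(u-t_a)}\sum_{a\ne b}\Big[\frac{f(u,t_2,\dots,t_l)\,q^{2u-t_1-t_{l+1}}}{s(u-t_1+1)\,s(u-t_{l+1}+1)}G(t_{l+1})\Big]_{\sigma_{a,b}},$$ where $\sigma_{a,b}$ is a permutation of $\{1,\dots,l+1\}$ with $1\mapsto a$, $l+1\mapsto b$ (which one is immaterial), acting so that $[g]_{\sigma}(t)$ is $g(t_{\sigma(1)},\dots,t_{\sigma(l+1)})$ times a product of factors as above, and $$(\widetilde L^\pm_{21}(\xi)f)(t_1,\dots,t_{l-1})=f(t_1,\dots,t_{l-1},u)\prod_{a=1}^{l-1}\frac{s(u-t_a-1)}{s(u-t_a)}\ (l>0),\qquad \widetilde L^\pm_{21}(\xi)f=0\ (l=0);$$ these are expanded in powers of $\xi$ at $\xi=0$ for the sign $+$ and of $\xi^{-1}$ at $\xi=\infty$ for the sign $-$. *The evaluation map.* Let $2\lambda_1=k\in\mathbb Z_{\ge0}$, and assume $z_a+\lambda_a\notin z_1+\lambda_1-j+p\mathbb Z$ for $a=2,\dots,n$, $j=0,\dots,k$.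 Set $\lambda'=(-\lambda_1-1,\lambda_2,\dots,\lambda_n)$. For $f\in\mathfrak F^q_l(z,\lambda)$ set $\tilde f=0$ if $l\le k$, and $$\tilde f(t_1,\dots,t_l)=f(t_1,\dots,t_l)\,s(t_1-z_1-\lambda_1)\prod_{a=1}^{k+1}\prod_{b=k+2}^{l}\frac{s(t_a-t_b+1)}{s(t_a-t_b-1)}\quad\text{if } l>k,$$ $$(\iota_q^*f)(t_1,\dots,t_{l-k-1})=\tilde f(z_1+\lambda_1,\,z_1+\lambda_1-1,\dots,z_1-\lambda_1,\,t_1,\dots,t_{l-k-1})$$ (the pole of $f$ at $t_1=z_1+\lambda_1$ is cancelled; $\iota_q^*f=0$ if $l\le k$). Then the formulas above define $U_q\widehat{gl(2)}$-module structures on $\mathfrak F^q(z,\lambda)$ and $\mathfrak F^q(z,\lambda')$, the map $\iota_q^*$ is a well defined linear map $\mathfrak F^q(z,\lambda)\to\mathfrak F^q(z,\lambda')$, and it is a surjective homomorphism of $U_q\widehat{gl(2)}$-modules. -/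

import Mathlib

open scoped BigOperators Topology DirectSum Kronecker

noncomputable section

namespace TrigHyp

/-! ### Trigonometric notation: `q ^ x = exp (π i x / p)` and `sin (π x / p)` -/

/-- `q ^ x := exp (π i x / p)`; in particular `q = qpow p 1`. -/
def qpow (p x : ℂ) : ℂ := Complex.exp (Real.pi * Complex.I * x / p)

/-- `sin (π x / p)`. -/
def sn (p x : ℂ) : ℂ := Complex.sin (Real.pi * x / p)

/-! ### The quantum affine algebra -/

/-- Index set of the symbols `L_{ij}^{(ε s)}`: a sign `ε = ±1`, a natural number `s`, and
`i, j` (the indices `1, 2` are written `0, 1`). The symbols with `s = 0` are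
`L_{ij}^{(+0)}` and `L_{ij}^{(-0)}`. -/
abbrev Gen : Type := ℤˣ × ℕ × Fin 2 × Fin 2

/-- The symbol `L_{ij}^{(ε s)}` in the free algebra. -/
def genL (ε : ℤˣ) (s : ℕ) (i j : Fin 2) : FreeAlgebra ℂ Gen :=
  FreeAlgebra.ι ℂ (ε, s, i, j)

/-- The matrix whose entries are the coefficients at `ξ ^ a`, `a ∈ ℤ`, of the generating series
`L^ε_{ij}(ξ) = ∑_{s ≥ 0} L_{ij}^{(ε s)} ξ ^ (ε s)`. -/
def coeffL (ε : ℤˣ) (a : ℤ) : Matrix (Fin 2) (Fin 2) (FreeAlgebra ℂ Gen) :=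
  Matrix.of fun i j => if 0 ≤ (ε : ℤ) * a then genL ε ((ε : ℤ) * a).toNat i j else 0

/-- `L_(1) = L ⊗ 1`: coefficient at `ξ ^ a`. -/
def coeffL1 (ε : ℤˣ) (a : ℤ) :
    Matrix (Fin 2 × Fin 2) (Fin 2 × Fin 2) (FreeAlgebra ℂ Gen) :=
  coeffL ε a ⊗ₖ (1 : Matrix (Fin 2) (Fin 2) (FreeAlgebra ℂ Gen))

/-- `L_(2) = 1 ⊗ L`: coefficient at `ζ ^ b`. -/
def coeffL2 (ε : ℤˣ) (b : ℤ) :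
    Matrix (Fin 2 × Fin 2) (Fin 2 × Fin 2) (FreeAlgebra ℂ Gen) :=
  (1 : Matrix (Fin 2) (Fin 2) (FreeAlgebra ℂ Gen)) ⊗ₖ coeffL ε b

/-- `e_{ij} ⊗ e_{kl}`. -/
def ee (i j k l : Fin 2) : Matrix (Fin 2 × Fin 2) (Fin 2 × Fin 2) ℂ :=
  Matrix.single i j 1 ⊗ₖ Matrix.single k l 1

/-- The trigonometric `R`-matrix
`R(ξ) = (ξ q - q⁻¹)(e₁₁⊗e₁₁ + e₂₂⊗e₂₂) + (ξ - 1)(e₁₁⊗e₂₂ + e₂₂⊗e₁₁)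
  + ξ (q - q⁻¹) e₁₂⊗e₂₁ + (q - q⁻¹) e₂₁⊗e₁₂` is `ξ • RTop q + RBot q`. Here is the part
proportional to `ξ`. -/
def RTop (q : ℂ) : Matrix (Fin 2 × Fin 2) (Fin 2 × Fin 2) ℂ :=
  q • (ee 0 0 0 0 + ee 1 1 1 1) + (ee 0 0 1 1 + ee 1 1 0 0) + (q - q⁻¹) • ee 0 1 1 0

/-- The part of the `R`-matrix that is constant in `ξ`. -/
def RBot (q : ℂ) : Matrix (Fin 2 × Fin 2) (Fin 2 × Fin 2) ℂ :=
  (-q⁻¹) • (ee 0 0 0 0 + ee 1 1 1 1) - (ee 0 0 1 1 + ee 1 1 0 0) + (q - q⁻¹) • ee 1 0 0 1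

/-- A complex matrix as a matrix over the free algebra. -/
def scalarMat (M : Matrix (Fin 2 × Fin 2) (Fin 2 × Fin 2) ℂ) :
    Matrix (Fin 2 × Fin 2) (Fin 2 × Fin 2) (FreeAlgebra ℂ Gen) :=
  M.map (algebraMap ℂ (FreeAlgebra ℂ Gen))

/-- The defining relations of `U_q gl̂(2)`. The relation
`R(ξ/ζ) L^ε_(1)(ξ) L^ε'_(2)(ζ) = L^ε'_(2)(ζ) L^ε_(1)(ξ) R(ξ/ζ)` is multiplied by `ζ`, and its
coefficients at `ξ ^ a ζ ^ b` are compared entry by entry. -/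
inductive Rel (q : ℂ) : FreeAlgebra ℂ Gen → FreeAlgebra ℂ Gen → Prop
  | rll (ε ε' : ℤˣ) (h : ε = ε' ∨ (ε = 1 ∧ ε' = -1)) (a b : ℤ) (x y : Fin 2 × Fin 2) :
      Rel q
        ((scalarMat (RTop q) * (coeffL1 ε (a - 1) * coeffL2 ε' b) +
          scalarMat (RBot q) * (coeffL1 ε a * coeffL2 ε' (b - 1))) x y)
        ((coeffL2 ε' b * coeffL1 ε (a - 1) * scalarMat (RTop q) +
          coeffL2 ε' (b - 1) * coeffL1 ε a * scalarMat (RBot q)) x y)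
  | upper : Rel q (genL 1 0 0 1) 0
  | lower : Rel q (genL (-1) 0 1 0) 0
  | inv12 (ε : ℤˣ) : Rel q (genL ε 0 0 0 * genL ε 0 1 1) 1
  | inv21 (ε : ℤˣ) : Rel q (genL ε 0 1 1 * genL ε 0 0 0) 1
  | inv (ε : ℤˣ) (i : Fin 2) : Rel q (genL ε 0 i i * genL (-ε) 0 i i) 1

/-- The quantum affine algebra `U_q gl̂(2)`. -/
abbrev Uq (q : ℂ) : Type := RingQuot (Rel q)

/-- The generator `L_{ij}^{(ε s)}` of `U_q gl̂(2)`. -/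
def uqL (q : ℂ) (ε : ℤˣ) (s : ℕ) (i j : Fin 2) : Uq q :=
  RingQuot.mkAlgHom ℂ (Rel q) (genL ε s i j)

/-! ### The trigonometric hypergeometric space

A meromorphic function of `t₁, …, t_l` is represented by the explicit formula that defines it
(with Lean's value `0` for a quotient with denominator `0`), and two such functions
are compared only at points in general position, where no denominator vanishes. -/

/-- The factor
`∏_{a,b} q^(z_a - t_b) / sin(π(t_b - z_a - λ_a)/p) *
  ∏_{a<b} sin(π(t_a - t_b)/p) / sin(π(t_a - t_b + 1)/p)`. -/
def weight (p : ℂ) {n : ℕ} (z lam : Fin n → ℂ) (l : ℕ) (t : Fin l → ℂ) : ℂ :=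
  (∏ a : Fin n, ∏ b : Fin l, qpow p (z a - t b) / sn p (t b - z a - lam a)) *
    ∏ a : Fin l, ∏ b : Fin l, if a < b then sn p (t a - t b) / sn p (t a - t b + 1) else 1

/-- The space `𝔉^q_l(z, λ)`. -/
def space (p : ℂ) {n : ℕ} (z lam : Fin n → ℂ) (l : ℕ) : Submodule ℂ ((Fin l → ℂ) → ℂ) where
  carrier := {f | ∃ P : MvPolynomial (Fin l) ℂ, P.IsSymmetric ∧
    (∀ m ∈ P.support, ∀ i, m i < n) ∧
    f = fun t => MvPolynomial.eval (fun i => qpow p (2 * t i)) P * weight p z lam l t}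
  zero_mem' := ⟨0, MvPolynomial.IsSymmetric.zero, by simp, by ext t; simp⟩
  add_mem' := by
    rintro f g ⟨P, hP, hP', rfl⟩ ⟨Q, hQ, hQ', rfl⟩
    refine ⟨P + Q, hP.add hQ, fun m hm i => ?_, ?_⟩
    · rcases Finset.mem_union.1 (MvPolynomial.support_add hm) with h | h
      · exact hP' m h i
      · exact hQ' m h i
    · ext t
      simp [add_mul]
  smul_mem' := by
    rintro c f ⟨P, hP, hP', rfl⟩
    refine ⟨c • P, hP.smul c, fun m hm i => hP' m (MvPolynomial.support_smul hm) i, ?_⟩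
    ext t
    simp [MvPolynomial.smul_eval, mul_assoc]

/-- The trigonometric hypergeometric space `𝔉^q(z, λ) = ⨁_l 𝔉^q_l(z, λ)`. -/
abbrev Space (p : ℂ) {n : ℕ} (z lam : Fin n → ℂ) : Type :=
  ⨁ l : ℕ, space p z lam l

/-- An element of `𝔉^q_l(z, λ)` as an element of `𝔉^q(z, λ)`. -/
def incl (p : ℂ) {n : ℕ} (z lam : Fin n → ℂ) (l : ℕ) (f : space p z lam l) : Space p z lam :=
  DirectSum.lof ℂ ℕ (fun l => space p z lam l) l f

/-- Points in general position: no `t_a - t_b` with `a ≠ b` and no `t_a - z_b - λ_b` lies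
in `ℤ + pℤ`. These points are dense, so an element of `𝔉^q_l(z, λ)` is determined by
its values at them. -/
def Generic (p : ℂ) {n : ℕ} (z lam : Fin n → ℂ) {l : ℕ} (t : Fin l → ℂ) : Prop :=
  (∀ a b : Fin l, a ≠ b → ∀ j : ℤ, sn p (t a - t b + j) ≠ 0) ∧
    ∀ (a : Fin l) (b : Fin n) (j : ℤ), sn p (t a - z b - lam b + j) ≠ 0

/-! ### The action of `U_q gl̂(2)` -/

/-- `[f]_σ`: the action of permutations for which the transposition of `i, i + 1` sends `f` to
`f(…, t_{i+1}, t_i, …) sin(π(t_i - t_{i+1} - 1)/p) / sin(π(t_i - t_{i+1} + 1)/p)`.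
A general `σ` contributes one such factor for each of its inversions. -/
def bracket (p : ℂ) {l : ℕ} (σ : Equiv.Perm (Fin l)) (f : (Fin l → ℂ) → ℂ)
    (t : Fin l → ℂ) : ℂ :=
  f (fun i => t (σ i)) *
    ∏ i : Fin l, ∏ j : Fin l,
      if i < j ∧ σ j < σ i then
        sn p (t (σ j) - t (σ i) - 1) / sn p (t (σ j) - t (σ i) + 1) else 1

/-- `∏_a sin(π(x - z_a + λ_a)/p) / sin(π(x - z_a - λ_a)/p)`. -/
def ratio (p : ℂ) {n : ℕ} (z lam : Fin n → ℂ) (x : ℂ) : ℂ :=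
  ∏ a : Fin n, sn p (x - z a + lam a) / sn p (x - z a - lam a)

/-- The first index of a non-empty `Fin l`. -/
def fstIdx {l : ℕ} (a : Fin l) : Fin l := ⟨0, a.pos⟩

/-- The last index of a non-empty `Fin l`. -/
def lstIdx {l : ℕ} (a : Fin l) : Fin l := ⟨l - 1, Nat.sub_lt a.pos one_pos⟩

/-- The function `(L̃^±₁₁(ξ) f)(t₁, …, t_l)`, `ξ = q^(2u)`. -/
def act11 (p : ℂ) {n : ℕ} (z lam : Fin n → ℂ) {l : ℕ} (f : (Fin l → ℂ) → ℂ) (u : ℂ)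
    (t : Fin l → ℂ) : ℂ :=
  f t * ratio p z lam u * (∏ a : Fin l, sn p (u - t a - 1) / sn p (u - t a)) +
    sn p 1 * (∏ a : Fin l, sn p (u - t a - 1) / sn p (u - t a)) *
      ∑ a : Fin l, bracket p (Equiv.swap a (lstIdx a))
        (fun s => f (Function.update s (lstIdx a) u) * qpow p (u - s (lstIdx a)) /
          sn p (u - s (lstIdx a) - 1) * ratio p z lam (s (lstIdx a))) t

/-- The function `(L̃^±₂₂(ξ) f)(t₁, …, t_l)`, `ξ = q^(2u)`. -/
def act22 (p : ℂ) {l : ℕ} (f : (Fin l → ℂ) → ℂ) (u : ℂ) (t : Fin l → ℂ) : ℂ :=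
  f t * (∏ a : Fin l, sn p (u - t a + 1) / sn p (u - t a)) -
    sn p 1 * (∏ a : Fin l, sn p (u - t a + 1) / sn p (u - t a)) *
      ∑ a : Fin l, bracket p (Equiv.swap (fstIdx a) a)
        (fun s => f (Function.update s (fstIdx a) u) * qpow p (u - s (fstIdx a)) /
          sn p (u - s (fstIdx a) + 1)) t

/-- A permutation that sends the first index to `a` and the last one to `b`, for `a ≠ b`
(it is the product of transpositions `(1,a)(b,l+1)` when `b` is not the first index). -/
def pairPerm {l : ℕ} (a b : Fin (l + 1)) : Equiv.Perm (Fin (l + 1)) :=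
  Equiv.swap 0 a * Equiv.swap (Equiv.swap 0 a b) (Fin.last l)

/-- The function `(L̃^±₁₂(ξ) f)(t₁, …, t_{l+1})`, `ξ = q^(2u)`. -/
def act12 (p : ℂ) {n : ℕ} (z lam : Fin n → ℂ) {l : ℕ} (f : (Fin l → ℂ) → ℂ) (u : ℂ)
    (t : Fin (l + 1) → ℂ) : ℂ :=
  sn p 1 * (∑ a : Fin (l + 1), bracket p (Equiv.swap 0 a)
      (fun s => f (Fin.tail s) * qpow p (u - s 0) / sn p (u - s 0) *
        (ratio p z lam (s 0) *
            (∏ c : Fin l, sn p (u - s c.succ + 1) / sn p (u - s c.succ) *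
              (sn p (s 0 - s c.succ - 1) / sn p (s 0 - s c.succ + 1))) -
          ratio p z lam u * ∏ c : Fin l, sn p (u - s c.succ - 1) / sn p (u - s c.succ))) t) -
    sn p 1 ^ 2 * (∏ a : Fin (l + 1), sn p (u - t a + 1) / sn p (u - t a)) *
      ∑ a : Fin (l + 1), ∑ b : Fin (l + 1), if a ≠ b then
        bracket p (pairPerm a b)
          (fun s => f (fun i : Fin l => if (i : ℕ) = 0 then u else s i.castSucc) *
            (qpow p (2 * u - s 0 - s (Fin.last l)) /
              (sn p (u - s 0 + 1) * sn p (u - s (Fin.last l) + 1))) *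
            ratio p z lam (s (Fin.last l))) t
        else 0

/-- The function `(L̃^±₂₁(ξ) f)(t₁, …, t_l)`, `ξ = q^(2u)`, for `f` in `l + 1` variables. -/
def act21 (p : ℂ) {l : ℕ} (f : (Fin (l + 1) → ℂ) → ℂ) (u : ℂ) (t : Fin l → ℂ) : ℂ :=
  f (Fin.snoc t u) * ∏ a : Fin l, sn p (u - t a - 1) / sn p (u - t a)

/-- The factor `∏_a (±i) q^(±(z_a - u)) / (2 sin(π(u - z_a - λ_a)/p))` by which
`L̃^±_{ij}(ξ)` differs from `L^±_{ij}(ξ)`. -/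
def prefactor (p : ℂ) {n : ℕ} (z lam : Fin n → ℂ) (ε : ℤˣ) (u : ℂ) : ℂ :=
  ∏ a : Fin n, ((ε : ℤ) : ℂ) * Complex.I * qpow p (((ε : ℤ) : ℂ) * (z a - u)) /
    (2 * sn p (u - z a - lam a))

/-- `F(u, t)` is the function `(L̃^ε(ξ) f)(t)`, `ξ = q^(2u)`, whose coefficients are
obtained from the functions `g s = L^{(ε s)} f`: near `ξ ^ ε = 0`,
`F(u, t) = prefactor(u) * ∑_s (g s)(t) ξ ^ (ε s)`. -/
def Expansion (p : ℂ) {n : ℕ} (z lam : Fin n → ℂ) (ε : ℤˣ) {l : ℕ}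
    (F : ℂ → (Fin l → ℂ) → ℂ) (g : ℕ → space p z lam l) : Prop :=
  ∀ t : Fin l → ℂ, Generic p z lam t →
    ∀ᶠ u in Filter.comap (fun u => qpow p (2 * ((ε : ℤ) : ℂ) * u)) (𝓝 0),
      HasSum (fun s : ℕ => prefactor p z lam ε u *
        ((g s : (Fin l → ℂ) → ℂ) t * qpow p (2 * ((ε : ℤ) : ℂ) * u) ^ s)) (F u t)

/-- The `U_q gl̂(2)`-module structure on `𝔉^q(z, λ)`: the representation `ρ` in which the
generators act by the formulas above. -/
structure IsAction (p : ℂ) {n : ℕ} (z lam : Fin n → ℂ)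
    (ρ : Uq (qpow p 1) →ₐ[ℂ] Module.End ℂ (Space p z lam)) : Prop where
  L11 : ∀ (ε : ℤˣ) (l : ℕ) (f : space p z lam l), ∃ g : ℕ → space p z lam l,
    (∀ s, ρ (uqL _ ε s 0 0) (incl p z lam l f) = incl p z lam l (g s)) ∧
      Expansion p z lam ε (act11 p z lam f) g
  L22 : ∀ (ε : ℤˣ) (l : ℕ) (f : space p z lam l), ∃ g : ℕ → space p z lam l,
    (∀ s, ρ (uqL _ ε s 1 1) (incl p z lam l f) = incl p z lam l (g s)) ∧
      Expansion p z lam ε (act22 p f) g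
  L12 : ∀ (ε : ℤˣ) (l : ℕ) (f : space p z lam l), ∃ g : ℕ → space p z lam (l + 1),
    (∀ s, ρ (uqL _ ε s 0 1) (incl p z lam l f) = incl p z lam (l + 1) (g s)) ∧
      Expansion p z lam ε (act12 p z lam f) g
  L21 : ∀ (ε : ℤˣ) (l : ℕ) (f : space p z lam (l + 1)), ∃ g : ℕ → space p z lam l,
    (∀ s, ρ (uqL _ ε s 1 0) (incl p z lam (l + 1) f) = incl p z lam l (g s)) ∧
      Expansion p z lam ε (act21 p f) g
  L21_zero : ∀ (ε : ℤˣ) (s : ℕ) (f : space p z lam 0),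
    ρ (uqL _ ε s 1 0) (incl p z lam 0 f) = 0

/-! ### The evaluation map -/

/-- `λ' = (-λ₁ - 1, λ₂, …, λ_n)`. -/
def lamPrime {n : ℕ} [NeZero n] (lam : Fin n → ℂ) : Fin n → ℂ :=
  Function.update lam 0 (-lam 0 - 1)

/-- The function `f̃(t₁, …, t_l)`, `l = k + 1 + m`. -/
def tilde (p : ℂ) {n : ℕ} [NeZero n] (z lam : Fin n → ℂ) (k m : ℕ)
    (f : (Fin (k + 1 + m) → ℂ) → ℂ) (t : Fin (k + 1 + m) → ℂ) : ℂ :=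
  f t * sn p (t (Fin.castAdd m 0) - z 0 - lam 0) *
    ∏ a : Fin (k + 1), ∏ b : Fin m,
      sn p (t (Fin.castAdd m a) - t (Fin.natAdd (k + 1) b) + 1) /
        sn p (t (Fin.castAdd m a) - t (Fin.natAdd (k + 1) b) - 1)

/-- The point `(x, z₁ + λ₁ - 1, …, z₁ + λ₁ - k, t₁, …, t_m)`. -/
def evalPoint {n : ℕ} [NeZero n] (z lam : Fin n → ℂ) (k m : ℕ) (t : Fin m → ℂ) (x : ℂ) :
    Fin (k + 1 + m) → ℂ :=
  Fin.append (Function.update (fun a : Fin (k + 1) => z 0 + lam 0 - (a : ℕ)) 0 x) t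

/-- `ι` is the evaluation map: it vanishes on `𝔉^q_l(z, λ)` for `l ≤ k`, and
`(ι f)(t₁, …, t_m) = f̃(z₁ + λ₁, z₁ + λ₁ - 1, …, z₁ + λ₁ - k, t₁, …, t_m)` for `f` in
`𝔉^q_{k+1+m}(z, λ)`. The simple pole of `f` at `t₁ = z₁ + λ₁` cancels against the
zero of the factor `sin(π(t₁ - z₁ - λ₁)/p)`, so the value of `f̃` there is a limit. -/
structure IsEvaluation (p : ℂ) {n : ℕ} [NeZero n] (z lam : Fin n → ℂ) (k : ℕ)
    (ι : Space p z lam →ₗ[ℂ] Space p z (lamPrime lam)) : Prop where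
  low : ∀ l : ℕ, l ≤ k → ∀ f : space p z lam l, ι (incl p z lam l f) = 0
  eval : ∀ (m : ℕ) (f : space p z lam (k + 1 + m)), ∃ g : space p z (lamPrime lam) m,
    ι (incl p z lam (k + 1 + m) f) = incl p z (lamPrime lam) m g ∧
      ∀ t : Fin m → ℂ, Generic p z lam t →
        Filter.Tendsto (fun x => tilde p z lam k m f (evalPoint z lam k m t x))
          (𝓝[≠] (z 0 + lam 0)) (𝓝 ((g : (Fin m → ℂ) → ℂ) t))

end TrigHyp

end

open scoped BigOperators Topology DirectSum Kronecker

noncomputable section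

namespace TrigHyp

/-! ### Rational form of the operators on functions of multisets -/

/-! In the variables x_a = q^(2 t_a) the weight is a constant times ∏ d(x_b)⁻¹ ∏_{a<b} (x_a - x_b) /
(q x_a - q⁻¹ x_b), where d is the polynomial `alp p z (-lam)`. Dividing by the second product turns
the twisted permutation action into plain permutation of variables (`Apart.bracket_mul`). Hence
𝔉^q_l is a copy of the symmetric polynomials in l variables of degree less than n in each. The
action formulas, freed of the weight and of the common factor 1/d(ξ), become rational operators on
functions φ of finite multisets: `opA` for L₁₁, the same with q⁻¹ and d for L₂₂, `opB` for L₁₂,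
`opC` for L₂₁. They depend on q and on the polynomials α = `alp p z lam` and d. Below, A, B, C, D
stand for L₁₁, L₁₂, L₂₁, L₂₂ in this form.

Everything rests on C(w) being the insertion of w: (C(w)φ)(X) = φ(w, X). The value of A(u)φ, D(u)φ
or B(u)φ at (w, X) is thus the value of C(w)A(u)φ, C(w)D(u)φ or C(w)B(u)φ at X, and `opA_cons` and
`opB_cons` express it through operators evaluated at X. These recursions do two things. By induction
on the number of variables they show that the apparent poles cancel, so that the operators produce
polynomials of degree at most n in u and less than n in each variable. They also are the RLL
relations of C with A, D and B. The other RLL relations follow by applying C(w) to both sides,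
moving it to the right and using induction (`BetheData.ext_of_induction`); on the empty multiset A
and D are scalars and B is zero.

L⁺(ξ) is one polynomial family in ξ of degree at most n, and L⁻(ξ) is a constant times ξ⁻ⁿ times the
same family. A single polynomial RLL relation therefore covers all choices of signs, and the
relations for the zero modes concern only the lowest and the highest coefficients. These are
triangular, with diagonal entries that are scalars on each graded component.

On polynomials the evaluation map is a nonzero constant times the product of the operators C(s) over
the string of points s = q^(2(z₁+λ₁-j)), 0 ≤ j ≤ k. In the action at a multiset containing the
string, the terms that remove a string point vanish. In the surviving terms the factors coming from
the string telescope and replace λ₁ by -λ₁-1. Specialization is therefore an intertwiner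
(`isString_stringPt`, `OperatorData.spec_rep`). It is surjective because each C(s) is, by
inclusion–exclusion (`exists_evAt_cons_eq`). -/

/-- `(q x - q⁻¹ y) / (x - y)`. -/
def hh (q x y : ℂ) : ℂ := (q * x - q⁻¹ * y) / (x - y)

/-- `(q - q⁻¹) x / (x - y)`. -/
def gg (q x y : ℂ) : ℂ := (q - q⁻¹) * x / (x - y)

/-- Together with `gg_inv` this lets every statement about L₁₁ be reused for L₂₂, with q⁻¹ for q and
d for α. -/
theorem hh_inv (q x y : ℂ) : hh q⁻¹ x y = hh q y x := by
  unfold hh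
  rw [inv_inv, ← neg_div_neg_eq]
  congr 1 <;> ring

theorem gg_inv (q x y : ℂ) : gg q⁻¹ x y = -gg q x y := by
  unfold gg
  rw [inv_inv]
  ring

/-- The rational form of the operators `L₁₁(u)`; with `q⁻¹` in place of `q`, of `L₂₂(u)`. -/
def opA (q : ℂ) (α : ℂ → ℂ) (u : ℂ) (φ : Multiset ℂ → ℂ) (X : Multiset ℂ) : ℂ :=
  α u * (X.map fun c => hh q c u).prod * φ X +
    (X.map fun a => gg q u a * α a * ((X.erase a).map fun c => hh q c a).prod *
      φ (u ::ₘ X.erase a)).sum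

/-- The rational form of the operators `L₁₂(u)`. -/
def opB (q : ℂ) (α d : ℂ → ℂ) (u : ℂ) (φ : Multiset ℂ → ℂ) (X : Multiset ℂ) : ℂ :=
  (X.map fun a => gg q u a * φ (X.erase a) *
    (d u * α a * ((X.erase a).map fun c => hh q u c * hh q c a).prod -
      α u * d a * ((X.erase a).map fun c => hh q a c * hh q c u).prod)).sum -
  (X.map fun a => ((X.erase a).map fun b => gg q u a * gg q u b * d a * α b * hh q a b *
    (((X.erase a).erase b).map fun c => hh q a c * hh q c b).prod *
      φ (u ::ₘ (X.erase a).erase b)).sum).sum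

/-- The rational form of the operators `L₂₁(u)`. -/
def opC (u : ℂ) (φ : Multiset ℂ → ℂ) (X : Multiset ℂ) : ℂ := φ (u ::ₘ X)

theorem erase_cons_of_ne {a w : ℂ} {X : Multiset ℂ} (h : a ≠ w) :
    (w ::ₘ X).erase a = w ::ₘ X.erase a :=
  Multiset.erase_cons_tail X h.symm

theorem sum_map_congr {X : Multiset ℂ} {f g : ℂ → ℂ} (h : ∀ a ∈ X, f a = g a) :
    (X.map f).sum = (X.map g).sum := by
  rw [Multiset.map_congr rfl h]

theorem prod_map_erase {X : Multiset ℂ} {a : ℂ} (h : a ∈ X) (f : ℂ → ℂ) :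
    (X.map f).prod = f a * ((X.erase a).map f).prod := by
  conv_lhs => rw [← Multiset.cons_erase h]
  simp

theorem opA_apply (q : ℂ) (α : ℂ → ℂ) (u : ℂ) (φ : Multiset ℂ → ℂ) (X : Multiset ℂ) :
    opA q α u φ X = α u * (X.map fun c => hh q c u).prod * φ X +
      (X.map fun a => gg q u a * α a * ((X.erase a).map fun c => hh q c a).prod *
        φ (u ::ₘ X.erase a)).sum := rfl

theorem opA_zero (q : ℂ) (α : ℂ → ℂ) (u : ℂ) (φ : Multiset ℂ → ℂ) :
    opA q α u φ 0 = α u * φ 0 := by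
  simp [opA]

theorem opB_zero (q : ℂ) (α d : ℂ → ℂ) (u : ℂ) (φ : Multiset ℂ → ℂ) :
    opB q α d u φ 0 = 0 := by
  simp [opB]

/-- The summand that removes w is the diagonal term of A(w)C(u)φ. A summand that removes a point a
of X splits by the three-term identity gg(u,a) hh(w,a) = hh(w,u) gg(u,a) + gg(u,w) gg(w,a). Since
inserting w is C(w), this is the exchange relation of A with C. -/
theorem opA_cons (q : ℂ) (α : ℂ → ℂ) {u w : ℂ} (φ : Multiset ℂ → ℂ) {X : Multiset ℂ}
    (hw : w ∉ X) (hu : u ∉ X) (h : u ≠ w) :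
    opA q α u φ (w ::ₘ X) =
      hh q w u * opA q α u (opC w φ) X + gg q u w * opA q α w (opC u φ) X := by
  have key : ∀ a ∈ X, gg q u a * α a * (((w ::ₘ X).erase a).map fun c => hh q c a).prod *
      φ (u ::ₘ (w ::ₘ X).erase a) =
      hh q w u * (gg q u a * α a * ((X.erase a).map fun c => hh q c a).prod *
        φ (w ::ₘ u ::ₘ X.erase a)) +
      gg q u w * (gg q w a * α a * ((X.erase a).map fun c => hh q c a).prod *
        φ (u ::ₘ w ::ₘ X.erase a)) := by
    intro a ha
    have haw : a ≠ w := fun e => hw (e ▸ ha)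
    have hau : a ≠ u := fun e => hu (e ▸ ha)
    have e : gg q u a * hh q w a = hh q w u * gg q u a + gg q u w * gg q w a := by
      unfold gg hh
      have h1 := sub_ne_zero.2 haw.symm
      have h2 := sub_ne_zero.2 hau.symm
      have h3 := sub_ne_zero.2 h
      have h4 := sub_ne_zero.2 h.symm
      field_simp
      ring
    rw [erase_cons_of_ne haw, Multiset.map_cons, Multiset.prod_cons,
      Multiset.cons_swap w u]
    linear_combination (α a * ((X.erase a).map fun c => hh q c a).prod *
      φ (u ::ₘ w ::ₘ X.erase a)) * e
  unfold opA opC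
  rw [Multiset.map_cons, Multiset.prod_cons, Multiset.map_cons, Multiset.sum_cons,
    Multiset.erase_cons_head, sum_map_congr key, Multiset.sum_map_add,
    Multiset.sum_map_mul_left, Multiset.sum_map_mul_left]
  ring

theorem opA_congr (q : ℂ) (α : ℂ → ℂ) {u : ℂ} {φ ψ : Multiset ℂ → ℂ} {X : Multiset ℂ}
    (h0 : φ X = ψ X) (h1 : ∀ a ∈ X, φ (u ::ₘ X.erase a) = ψ (u ::ₘ X.erase a)) :
    opA q α u φ X = opA q α u ψ X := by
  unfold opA
  rw [h0, sum_map_congr fun a ha => by rw [h1 a ha]]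

/-- The composition `L₂₂(u) L₁₁(w)`, expanded. -/
theorem opA_inv_opA (q : ℂ) (α d : ℂ → ℂ) {u w : ℂ} (φ : Multiset ℂ → ℂ) {X : Multiset ℂ}
    (hu : u ∉ X) :
    opA q⁻¹ d u (opA q α w φ) X =
      d u * α w * ((X.map fun c => hh q u c).prod * (X.map fun c => hh q c w).prod) * φ X +
      (X.map fun a => d u * hh q u a * gg q w a * α a *
        (((X.erase a).map fun c => hh q u c).prod * ((X.erase a).map fun c => hh q c a).prod) *
          φ (w ::ₘ X.erase a)).sum -
      (X.map fun a => gg q u a * d a * α w * hh q u w *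
        (((X.erase a).map fun c => hh q a c).prod * ((X.erase a).map fun c => hh q c w).prod) *
          φ (u ::ₘ X.erase a)).sum -
      (X.map fun a => gg q u a * d a * gg q w u * α u *
        (((X.erase a).map fun c => hh q a c).prod * ((X.erase a).map fun c => hh q c u).prod) *
          φ (w ::ₘ X.erase a)).sum -
      (X.map fun a => ((X.erase a).map fun b =>
        gg q u a * gg q w b * d a * α b * hh q a b * hh q u b *
        ((((X.erase a).erase b).map fun c => hh q a c).prod *
          (((X.erase a).erase b).map fun c => hh q c b).prod) *
            φ (w ::ₘ u ::ₘ (X.erase a).erase b)).sum).sum := by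
  -- The inner operator acts at u, X \ a: it removes nothing, or the freshly inserted u, or a second
  -- point b of X. These are the three families on the right.
  have k1 : ∀ a ∈ X, gg q⁻¹ u a * d a * ((X.erase a).map fun c => hh q⁻¹ c a).prod *
      opA q α w φ (u ::ₘ X.erase a) =
      -(gg q u a * d a * α w * hh q u w *
        (((X.erase a).map fun c => hh q a c).prod * ((X.erase a).map fun c => hh q c w).prod) *
          φ (u ::ₘ X.erase a) +
      gg q u a * d a * gg q w u * α u *
        (((X.erase a).map fun c => hh q a c).prod * ((X.erase a).map fun c => hh q c u).prod) *
          φ (w ::ₘ X.erase a) + ((X.erase a).map fun b =>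
        gg q u a * gg q w b * d a * α b * hh q a b * hh q u b *
        ((((X.erase a).erase b).map fun c => hh q a c).prod *
          (((X.erase a).erase b).map fun c => hh q c b).prod) *
            φ (w ::ₘ u ::ₘ (X.erase a).erase b)).sum) := by
    intro a ha
    have k2 : ∀ b ∈ X.erase a, gg q u a * gg q w b * d a * α b * hh q a b * hh q u b *
        ((((X.erase a).erase b).map fun c => hh q a c).prod *
          (((X.erase a).erase b).map fun c => hh q c b).prod) *
            φ (w ::ₘ u ::ₘ (X.erase a).erase b) =
        (gg q u a * d a * ((X.erase a).map fun c => hh q a c).prod) *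
        (gg q w b * α b * (((u ::ₘ X.erase a).erase b).map fun c => hh q c b).prod *
          φ (w ::ₘ (u ::ₘ X.erase a).erase b)) := by
      intro b hb
      have hbu : b ≠ u := fun e => hu (e ▸ Multiset.mem_of_mem_erase hb)
      rw [erase_cons_of_ne hbu, prod_map_erase hb, Multiset.map_cons, Multiset.prod_cons]
      ring
    rw [sum_map_congr k2, Multiset.sum_map_mul_left]
    unfold opA
    rw [Multiset.map_cons, Multiset.prod_cons, Multiset.map_cons, Multiset.sum_cons,
      Multiset.erase_cons_head, gg_inv]
    simp only [hh_inv]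
    ring
  have k3 : ∀ a ∈ X, d u * hh q u a * gg q w a * α a *
        (((X.erase a).map fun c => hh q u c).prod * ((X.erase a).map fun c => hh q c a).prod) *
          φ (w ::ₘ X.erase a) = d u * (X.map fun c => hh q u c).prod *
        (gg q w a * α a * ((X.erase a).map fun c => hh q c a).prod * φ (w ::ₘ X.erase a)) := by
    intro a ha
    rw [prod_map_erase ha]
    ring
  rw [sum_map_congr k3, Multiset.sum_map_mul_left]
  rw [opA_apply q⁻¹ d u, sum_map_congr k1, Multiset.sum_map_neg, Multiset.sum_map_add, Multiset.sum_map_add]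
  simp only [hh_inv]
  unfold opA
  ring

theorem sum_map_sub' (X : Multiset ℂ) (f g : ℂ → ℂ) :
    (X.map fun a => f a - g a).sum = (X.map f).sum - (X.map g).sum := by
  simp

/-- This is the exchange relation of B with C. Both sides are linear in values of φ at multisets
obtained by removing at most two points of X; comparing the coefficients of each value leaves
rational identities in u, w and the removed points. -/
theorem opB_cons {q : ℂ} (hq : q ≠ 0) (α d : ℂ → ℂ) {u w : ℂ} (φ : Multiset ℂ → ℂ) {X : Multiset ℂ}
    (hw : w ∉ X) (hu : u ∉ X) (h : u ≠ w) :
    opB q α d u φ (w ::ₘ X) = opB q α d u (opC w φ) X + gg q u w *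
      (opA q⁻¹ d u (opA q α w φ) X - opA q⁻¹ d w (opA q α u φ) X) := by
  rw [opA_inv_opA q α d φ hu, opA_inv_opA q α d φ hw]
  unfold opB opC
  rw [Multiset.map_cons, Multiset.sum_cons, Multiset.map_cons, Multiset.sum_cons,
    Multiset.erase_cons_head]
  simp only [Multiset.prod_map_mul]
  -- Single removals of a point of X, which leave the values φ(w, X \ a).
  have S1 : (X.map fun a => gg q u a * φ ((w ::ₘ X).erase a) *
      (d u * α a * ((((w ::ₘ X).erase a).map fun c => hh q u c).prod *
        (((w ::ₘ X).erase a).map fun c => hh q c a).prod) -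
      α u * d a * ((((w ::ₘ X).erase a).map fun c => hh q a c).prod *
        (((w ::ₘ X).erase a).map fun c => hh q c u).prod))).sum =
      (X.map fun a => gg q u a * φ (w ::ₘ X.erase a) *
      (d u * α a * (((X.erase a).map fun c => hh q u c).prod *
        ((X.erase a).map fun c => hh q c a).prod) -
      α u * d a * (((X.erase a).map fun c => hh q a c).prod *
        ((X.erase a).map fun c => hh q c u).prod))).sum +
      gg q u w * ((X.map fun a => d u * hh q u a * gg q w a * α a *
        (((X.erase a).map fun c => hh q u c).prod * ((X.erase a).map fun c => hh q c a).prod) *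
          φ (w ::ₘ X.erase a)).sum -
      (X.map fun a => gg q u a * d a * gg q w u * α u *
        (((X.erase a).map fun c => hh q a c).prod * ((X.erase a).map fun c => hh q c u).prod) *
          φ (w ::ₘ X.erase a)).sum +
      (X.map fun a => gg q w a * d a * α u * hh q w u *
        (((X.erase a).map fun c => hh q a c).prod * ((X.erase a).map fun c => hh q c u).prod) *
          φ (w ::ₘ X.erase a)).sum) := by
    rw [← sum_map_sub', ← Multiset.sum_map_add, ← Multiset.sum_map_mul_left,
      ← Multiset.sum_map_add]
    refine sum_map_congr fun a ha => ?_
    have haw : a ≠ w := fun e => hw (e ▸ ha)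
    have hau : a ≠ u := fun e => hu (e ▸ ha)
    have h1 := sub_ne_zero.2 haw.symm
    have h2 := sub_ne_zero.2 hau.symm
    have h3 := sub_ne_zero.2 h
    have h4 := sub_ne_zero.2 h.symm
    have h5 := sub_ne_zero.2 haw
    have e1 : gg q u a * (hh q u w * hh q w a - 1) = gg q u w * hh q u a * gg q w a := by
      unfold gg hh
      field_simp
      ring
    have e2 : -(gg q u a * (hh q a w * hh q w u - 1)) =
        gg q u w * (-(gg q u a * gg q w u) + gg q w a * hh q w u) := by
      unfold gg hh
      field_simp
      ring
    rw [erase_cons_of_ne haw]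
    simp only [Multiset.map_cons, Multiset.prod_cons]
    linear_combination (φ (w ::ₘ X.erase a) * d u * α a *
      (((X.erase a).map fun c => hh q u c).prod * ((X.erase a).map fun c => hh q c a).prod)) * e1 +
      (φ (w ::ₘ X.erase a) * d a * α u *
      (((X.erase a).map fun c => hh q a c).prod * ((X.erase a).map fun c => hh q c u).prod)) * e2
  -- Ordered pairs (a, b) whose first point lies in X; the second is w or lies in X. Pairs whose
  -- first point is w are treated in `S3`.
  have S2 : (X.map fun a => (((w ::ₘ X).erase a).map fun b =>
      gg q u a * gg q u b * d a * α b * hh q a b *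
        (((((w ::ₘ X).erase a).erase b).map fun c => hh q a c).prod *
          ((((w ::ₘ X).erase a).erase b).map fun c => hh q c b).prod) *
            φ (u ::ₘ ((w ::ₘ X).erase a).erase b)).sum).sum =
      gg q u w * ((X.map fun a => gg q u a * d a * α w * hh q u w *
        (((X.erase a).map fun c => hh q a c).prod * ((X.erase a).map fun c => hh q c w).prod) *
          φ (u ::ₘ X.erase a)).sum -
      (X.map fun a => gg q w a * d a * gg q u w * α w *
        (((X.erase a).map fun c => hh q a c).prod * ((X.erase a).map fun c => hh q c w).prod) *
          φ (u ::ₘ X.erase a)).sum) +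
      ((X.map fun a => ((X.erase a).map fun b =>
        gg q u a * gg q u b * d a * α b * hh q a b *
        ((((X.erase a).erase b).map fun c => hh q a c).prod *
          (((X.erase a).erase b).map fun c => hh q c b).prod) *
            φ (w ::ₘ u ::ₘ (X.erase a).erase b)).sum).sum + gg q u w *
      ((X.map fun a => ((X.erase a).map fun b =>
        gg q u a * gg q w b * d a * α b * hh q a b * hh q u b *
        ((((X.erase a).erase b).map fun c => hh q a c).prod *
          (((X.erase a).erase b).map fun c => hh q c b).prod) *
            φ (w ::ₘ u ::ₘ (X.erase a).erase b)).sum).sum -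
      (X.map fun a => ((X.erase a).map fun b =>
        gg q w a * gg q u b * d a * α b * hh q a b * hh q w b *
        ((((X.erase a).erase b).map fun c => hh q a c).prod *
          (((X.erase a).erase b).map fun c => hh q c b).prod) *
            φ (u ::ₘ w ::ₘ (X.erase a).erase b)).sum).sum)) := by
    rw [← sum_map_sub', ← sum_map_sub', ← Multiset.sum_map_mul_left,
      ← Multiset.sum_map_mul_left, ← Multiset.sum_map_add, ← Multiset.sum_map_add]
    refine sum_map_congr fun a ha => ?_
    have haw : a ≠ w := fun e => hw (e ▸ ha)
    have hau : a ≠ u := fun e => hu (e ▸ ha)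
    have h1 := sub_ne_zero.2 haw.symm
    have h2 := sub_ne_zero.2 hau.symm
    have h3 := sub_ne_zero.2 h
    have h4 := sub_ne_zero.2 h.symm
    have h5 := sub_ne_zero.2 haw
    rw [← sum_map_sub', ← Multiset.sum_map_mul_left, ← Multiset.sum_map_add,
      erase_cons_of_ne haw, Multiset.map_cons, Multiset.sum_cons, Multiset.erase_cons_head]
    congr 1
    · have e1 : gg q u a * hh q a w = gg q u a * hh q u w - gg q w a * gg q u w := by
        unfold gg hh
        field_simp
        ring
      linear_combination (gg q u w * d a * α w * φ (u ::ₘ X.erase a) *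
        (((X.erase a).map fun c => hh q a c).prod * ((X.erase a).map fun c => hh q c w).prod)) * e1
    · refine sum_map_congr fun b hb => ?_
      have hbw : b ≠ w := fun e => hw (e ▸ Multiset.mem_of_mem_erase hb)
      have hbu : b ≠ u := fun e => hu (e ▸ Multiset.mem_of_mem_erase hb)
      have h6 := sub_ne_zero.2 hbw.symm
      have h7 := sub_ne_zero.2 hbu.symm
      have e1 : gg q u a * gg q u b * (hh q a w * hh q w b - 1) =
          gg q u w * (gg q u a * gg q w b * hh q u b - gg q w a * gg q u b * hh q w b) := by
        unfold gg hh
        field_simp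
        ring
      rw [erase_cons_of_ne hbw]
      simp only [Multiset.map_cons, Multiset.prod_cons]
      rw [Multiset.cons_swap w u]
      linear_combination (d a * α b * hh q a b * φ (u ::ₘ w ::ₘ (X.erase a).erase b) *
        ((((X.erase a).erase b).map fun c => hh q a c).prod *
          (((X.erase a).erase b).map fun c => hh q c b).prod)) * e1
  have S3 : (X.map fun b => gg q u w * gg q u b * d w * α b * hh q w b *
      (((X.erase b).map fun c => hh q w c).prod * ((X.erase b).map fun c => hh q c b).prod) *
        φ (u ::ₘ X.erase b)).sum = gg q u w *
      (X.map fun a => d w * hh q w a * gg q u a * α a *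
        (((X.erase a).map fun c => hh q w c).prod * ((X.erase a).map fun c => hh q c a).prod) *
          φ (u ::ₘ X.erase a)).sum := by
    rw [← Multiset.sum_map_mul_left]
    exact sum_map_congr fun b _ => by ring
  rw [S1, S2, S3]
  ring

/-! ### Functions that are polynomial outside a finite set -/

/-- `f` agrees outside `E` with a polynomial of degree less than `n`. -/
def PolyOff (n : ℕ) (E : Finset ℂ) (f : ℂ → ℂ) : Prop :=
  ∃ p ∈ Polynomial.degreeLT ℂ n, ∀ w ∉ E, f w = p.eval w

namespace PolyOff

variable {n : ℕ} {E : Finset ℂ} {f g : ℂ → ℂ}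

theorem add (hf : PolyOff n E f) (hg : PolyOff n E g) : PolyOff n E (fun w => f w + g w) := by
  obtain ⟨p, hp, hp'⟩ := hf
  obtain ⟨r, hr, hr'⟩ := hg
  exact ⟨p + r, add_mem hp hr, fun w hw => by simp [hp' w hw, hr' w hw]⟩

theorem const_mul (c : ℂ) (hf : PolyOff n E f) : PolyOff n E (fun w => c * f w) := by
  obtain ⟨p, hp, hp'⟩ := hf
  exact ⟨c • p, Submodule.smul_mem _ _ hp, fun w hw => by
    simp [hp' w hw]⟩

theorem mul_const (c : ℂ) (hf : PolyOff n E f) : PolyOff n E (fun w => f w * c) := by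
  simpa only [mul_comm] using hf.const_mul c

theorem sub (hf : PolyOff n E f) (hg : PolyOff n E g) : PolyOff n E (fun w => f w - g w) := by
  simpa only [neg_one_mul, ← sub_eq_add_neg] using hf.add (hg.const_mul (-1))

theorem mono {m : ℕ} {F : Finset ℂ} (hf : PolyOff n E f) (hm : n ≤ m) (hE : E ⊆ F) :
    PolyOff m F f := by
  obtain ⟨p, hp, hp'⟩ := hf
  exact ⟨p, Polynomial.degreeLT_mono hm hp, fun w hw => hp' w fun h => hw (hE h)⟩

theorem congr (hf : PolyOff n E f) (h : ∀ w ∉ E, g w = f w) : PolyOff n E g := by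
  obtain ⟨p, hp, hp'⟩ := hf
  exact ⟨p, hp, fun w hw => by rw [h w hw, hp' w hw]⟩

theorem zero : PolyOff n E (fun _ => 0) := ⟨0, zero_mem _, fun w _ => by simp⟩

theorem const (hn : 0 < n) (c : ℂ) : PolyOff n E (fun _ => c) :=
  ⟨Polynomial.C c, Polynomial.mem_degreeLT.2
    (Polynomial.degree_C_le.trans_lt (by exact_mod_cast hn)), fun w _ => by simp⟩

theorem sum {ι : Type*} {X : Multiset ι} {F : ι → ℂ → ℂ} (h : ∀ a ∈ X, PolyOff n E (F a)) :
    PolyOff n E (fun w => (X.map fun a => F a w).sum) := by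
  induction X using Multiset.induction with
  | empty => simpa using zero
  | cons a X ih =>
    simp only [Multiset.map_cons, Multiset.sum_cons]
    exact (h a (Multiset.mem_cons_self a X)).add
      (ih fun b hb => h b (Multiset.mem_cons_of_mem hb))

theorem id_mul (hf : PolyOff n E f) : PolyOff (n + 1) E (fun w => w * f w) := by
  obtain ⟨p, hp, hp'⟩ := hf
  refine ⟨Polynomial.X * p, ?_, fun w hw => by simp [hp' w hw]⟩
  rw [Polynomial.mem_degreeLT] at hp ⊢
  rw [Polynomial.degree_mul, Polynomial.degree_X, add_comm]
  rcases eq_or_ne p 0 with rfl | h0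
  · simp
  · rw [Polynomial.degree_eq_natDegree h0] at hp ⊢
    exact_mod_cast Nat.succ_lt_succ (by exact_mod_cast hp)

/-- Division by `w - u` of a polynomial that vanishes at `u`. -/
theorem div {u : ℂ} (h : PolyOff (n + 1) E f) (hu : u ∉ E) (h0 : f u = 0)
    (hg : ∀ w ∉ E, w ≠ u → (w - u) * g w = f w) : PolyOff n (insert u E) g := by
  obtain ⟨p, hp, hp'⟩ := h
  obtain ⟨r, rfl⟩ : Polynomial.X - Polynomial.C u ∣ p :=
    Polynomial.dvd_iff_isRoot.2 (by rw [Polynomial.IsRoot, ← hp' u hu, h0])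
  refine ⟨r, ?_, fun w hw => ?_⟩
  · rw [Polynomial.mem_degreeLT] at hp ⊢
    rw [Polynomial.degree_mul, Polynomial.degree_X_sub_C, add_comm] at hp
    rcases eq_or_ne r 0 with rfl | h1
    · simp
    · rw [Polynomial.degree_eq_natDegree h1] at hp ⊢
      have : r.natDegree + 1 < n + 1 := by exact_mod_cast hp
      exact_mod_cast Nat.lt_of_succ_lt_succ this
  · rw [Finset.mem_insert, not_or] at hw
    have := hg w hw.2 hw.1
    rw [hp' w hw.2] at this
    have h2 := sub_ne_zero.2 hw.1
    apply mul_left_cancel₀ h2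
    rw [this]
    simp

end PolyOff

/-! ### Symmetric polynomials of bounded degree -/

/-- Symmetric polynomials in `l` variables of degree less than `n` in each variable. -/
def symPoly (n l : ℕ) : Submodule ℂ (MvPolynomial (Fin l) ℂ) where
  carrier := {P | P.IsSymmetric ∧ ∀ m ∈ P.support, ∀ i, m i < n}
  zero_mem' := ⟨MvPolynomial.IsSymmetric.zero, by simp⟩
  add_mem' := by
    rintro P Q ⟨hP, hP'⟩ ⟨hQ, hQ'⟩
    refine ⟨hP.add hQ, fun m hm i => ?_⟩
    rcases Finset.mem_union.1 (MvPolynomial.support_add hm) with h | h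
    · exact hP' m h i
    · exact hQ' m h i
  smul_mem' := by
    rintro c P ⟨hP, hP'⟩
    exact ⟨hP.smul c, fun m hm i => hP' m (MvPolynomial.support_smul hm) i⟩

/-- Equal multiplicities make the fibres of x and y over each value equinumerous, and matching the
fibres gives the permutation. -/
theorem exists_perm_of_ofFn_perm {l : ℕ} {x y : Fin l → ℂ}
    (h : (List.ofFn x : Multiset ℂ) = List.ofFn y) : ∃ σ : Equiv.Perm (Fin l), x = y ∘ σ := by
  classical
  have hc : ∀ (x : Fin l → ℂ) (c : ℂ), Fintype.card {i // x i = c} =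
      (List.ofFn x : Multiset ℂ).count c := by
    intro x c
    rw [← Fin.univ_val_map, Multiset.count_map, Fintype.card_subtype]
    simp [Finset.card, eq_comm]
  let e : ∀ c, {i // x i = c} ≃ {i // y i = c} := fun c =>
    Fintype.equivOfCardEq (by rw [hc, hc, h])
  refine ⟨(Equiv.sigmaFiberEquiv x).symm.trans
    ((Equiv.sigmaCongrRight e).trans (Equiv.sigmaFiberEquiv y)), funext fun i => ?_⟩
  exact ((e (x i)) ⟨i, rfl⟩).2.symm

theorem exists_ofFn (X : Multiset ℂ) : ∃ x : Fin (Multiset.card X) → ℂ,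
    X = (List.ofFn x : Multiset ℂ) := by
  induction X using Quotient.inductionOn with
  | h L => exact ⟨L.get, by simp⟩

theorem exists_ofFn' {l : ℕ} {X : Multiset ℂ} (h : Multiset.card X = l) : ∃ x : Fin l → ℂ,
    X = (List.ofFn x : Multiset ℂ) := by
  subst h
  exact exists_ofFn X

theorem nodup_ofFn {l : ℕ} {x : Fin l → ℂ} :
    (List.ofFn x : Multiset ℂ).Nodup ↔ Function.Injective x := by
  rw [Multiset.coe_nodup, List.nodup_ofFn]

/-- The value of a symmetric polynomial at a multiset (`0` if the cardinality is wrong). -/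
def evAt (n l : ℕ) (X : Multiset ℂ) : symPoly n l →ₗ[ℂ] ℂ :=
  if h : Multiset.card X = l then
    (MvPolynomial.aeval (exists_ofFn' h).choose).toLinearMap ∘ₗ (symPoly n l).subtype
  else 0

/-- Symmetry of P makes the enumeration chosen in `evAt` irrelevant. -/
theorem evAt_ofFn {n l : ℕ} (P : symPoly n l) (x : Fin l → ℂ) :
    evAt n l (List.ofFn x) P = MvPolynomial.eval x P := by
  have h : Multiset.card (List.ofFn x : Multiset ℂ) = l := by simp
  obtain ⟨σ, hσ⟩ := exists_perm_of_ofFn_perm (exists_ofFn' h).choose_spec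
  have h2 := P.2.1 σ
  rw [evAt, dif_pos h]
  conv_rhs => rw [hσ]
  simp only [LinearMap.comp_apply, Submodule.subtype_apply, AlgHom.toLinearMap_apply]
  conv_lhs => rw [← h2]
  rw [← MvPolynomial.eval_rename, MvPolynomial.aeval_eq_eval]

theorem evAt_of_ne {n l : ℕ} (P : symPoly n l) {X : Multiset ℂ} (h : Multiset.card X ≠ l) :
    evAt n l X P = 0 := by
  rw [evAt, dif_neg h, LinearMap.zero_apply]

/-- Injective points of an infinite set separate polynomials. -/
theorem mvPolynomial_eq_of_injective {l : ℕ} {P Q : MvPolynomial (Fin l) ℂ} {T : Set ℂ}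
    (hT : T.Infinite) (h : ∀ x : Fin l → ℂ, Function.Injective x → (∀ i, x i ∈ T) →
      MvPolynomial.eval x P = MvPolynomial.eval x Q) : P = Q := by
  have e := hT.natEmbedding
  have he : Function.Injective fun m => (e m : ℂ) :=
    Subtype.val_injective.comp e.injective
  -- The pairing function cuts an infinite subset of T into l disjoint infinite pieces, so every
  -- point of their product has distinct coordinates.
  refine MvPolynomial.funext_set (fun i : Fin l => Set.range fun m => (e (Nat.pair m i) : ℂ))
    (fun i => Set.infinite_range_of_injective fun a b hab => ?_) fun x hx => h x ?_ ?_
  · exact (Nat.pair_eq_pair.1 (he hab)).1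
  · intro i j hij
    obtain ⟨a, ha⟩ := hx i trivial
    obtain ⟨b, hb⟩ := hx j trivial
    have : Nat.pair a i = Nat.pair b j := he (by simp only at ha hb ⊢; rw [ha, hb, hij])
    exact Fin.ext (Nat.pair_eq_pair.1 this).2
  · intro i
    obtain ⟨a, ha⟩ := hx i trivial
    rw [← ha]
    exact (e _).2

/-- Lagrange interpolation in the first variable at n nodes w, with coefficients supplied by the
induction hypothesis for the functions ψ(w, ·). The nodes and the exceptional sets of the
coefficients must be added to E. The set Z records points that must not be lost in this way; this
freedom is used to reach every point outside E. -/
theorem exists_mvPolynomial {n : ℕ} (l : ℕ) : ∀ (E : Finset ℂ) (ψ : Multiset ℂ → ℂ)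
    (_ : ∀ X : Multiset ℂ, Multiset.card X + 1 = l → X.Nodup → (∀ x ∈ X, x ∉ E) →
      PolyOff n (E ∪ X.toFinset) fun w => ψ (w ::ₘ X)) (Z : Finset ℂ),
    ∃ P : MvPolynomial (Fin l) ℂ, (∀ m ∈ P.support, ∀ i, m i < n) ∧
      ∃ E' : Finset ℂ, E ⊆ E' ∧ (∀ z ∈ Z, z ∈ E' → z ∈ E) ∧
        ∀ x : Fin l → ℂ, Function.Injective x → (∀ i, x i ∉ E') →
          MvPolynomial.eval x P = ψ (List.ofFn x) := by
  induction l with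
  | zero =>
    intro E ψ _ Z
    exact ⟨MvPolynomial.C (ψ 0), fun m _ i => i.elim0, E, subset_rfl, fun z _ h => h,
      fun x _ _ => by simp⟩
  | succ l ih =>
    intro E ψ h Z
    obtain ⟨N, hN, hNc⟩ := ((E ∪ Z).finite_toSet.infinite_compl).exists_subset_card_eq n
    have hN' : ∀ w ∈ N, w ∉ E ∧ w ∉ Z := fun w hw => by
      have := hN hw
      simpa using this
    have ih' : ∀ w : ℂ, ∃ P : MvPolynomial (Fin l) ℂ, (∀ m ∈ P.support, ∀ i, m i < n) ∧
        ∃ E' : Finset ℂ, insert w E ⊆ E' ∧ (∀ z ∈ Z, z ∈ E' → z ∈ insert w E) ∧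
          (w ∉ E → ∀ x : Fin l → ℂ, Function.Injective x → (∀ i, x i ∉ E') →
            MvPolynomial.eval x P = ψ (w ::ₘ List.ofFn x)) := by
      intro w
      by_cases hw : w ∈ E
      · exact ⟨0, by simp, insert w E, subset_rfl, fun _ _ h => h, fun h => absurd hw h⟩
      · obtain ⟨P, hP, E', h1, h2, h3⟩ := ih (insert w E) (fun X => ψ (w ::ₘ X))
          (fun X hX hX' hX'' => by
            have hX3 : w ∉ X := fun hwX => hX'' w hwX (Finset.mem_insert_self w E)
            refine ((h (w ::ₘ X) (by simpa using hX) (Multiset.nodup_cons.2 ⟨hX3, hX'⟩)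
              (fun x hx => ?_)).mono le_rfl ?_).congr fun v _ => by rw [Multiset.cons_swap]
            · rcases Multiset.mem_cons.1 hx with rfl | hx
              · exact hw
              · exact fun hxE => hX'' x hx (Finset.mem_insert_of_mem hxE)
            · intro v hv
              simp only [Finset.mem_union, Multiset.mem_toFinset, Multiset.mem_cons,
                Finset.mem_insert] at hv ⊢
              tauto) Z
        exact ⟨P, hP, E', h1, h2, fun _ => h3⟩
    choose P hP E' hE hZ hE' using ih'
    refine ⟨(MvPolynomial.finSuccEquiv ℂ l).symm (∑ w ∈ N, Polynomial.map MvPolynomial.C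
      (Lagrange.basis N id w) * Polynomial.C (P w)), fun m hm i => ?_,
      E ∪ N ∪ N.biUnion E', ?_, ?_, ?_⟩
    · rw [← Finsupp.cons_tail m, ← MvPolynomial.mem_support_coeff_finSuccEquiv,
        AlgEquiv.apply_symm_apply, MvPolynomial.mem_support_iff, Polynomial.finsetSum_coeff,
        MvPolynomial.coeff_sum] at hm
      obtain ⟨w, hw, hmw⟩ := Finset.exists_ne_zero_of_sum_ne_zero hm
      rw [Polynomial.coeff_mul_C, Polynomial.coeff_map, MvPolynomial.coeff_C_mul] at hmw
      rcases Fin.eq_zero_or_eq_succ i with rfl | ⟨j, rfl⟩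
      · by_contra hlt
        refine left_ne_zero_of_mul hmw (Polynomial.coeff_eq_zero_of_degree_lt ?_)
        rw [Lagrange.degree_basis Function.injective_id.injOn hw, hNc]
        have : 0 < n := hNc ▸ Finset.card_pos.2 ⟨w, hw⟩
        exact_mod_cast (by omega : n - 1 < m 0)
      · exact hP w _ (MvPolynomial.mem_support_iff.2 (right_ne_zero_of_mul hmw)) j
    · intro v hv
      simp [hv]
    · intro v hv hv'
      simp only [Finset.mem_union, Finset.mem_biUnion] at hv'
      rcases hv' with (hv' | hv') | ⟨w, hw, hv'⟩
      · exact hv'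
      · exact absurd hv (hN' v hv').2
      · rcases Finset.mem_insert.1 (hZ w v hv hv') with rfl | hv'
        · exact absurd hv (hN' v hw).2
        · exact hv'
    · intro x hx hx'
      have hxE : ∀ i, x i ∉ E := fun i hi => hx' i (by simp [hi])
      have hxN : ∀ i, x i ∉ N := fun i hi => hx' i (by simp [hi])
      have hxE' : ∀ i, ∀ w ∈ N, x i ∉ E' w := fun i w hw hi => hx' i (by
        simp only [Finset.mem_union, Finset.mem_biUnion]
        exact Or.inr ⟨w, hw, hi⟩)
      have ht : Function.Injective (Fin.tail x) := hx.comp (Fin.succ_injective l)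
      obtain ⟨p, hp, hp'⟩ := h (List.ofFn (Fin.tail x)) (by simp) (nodup_ofFn.2 ht)
        (fun y hy => by
          obtain ⟨i, rfl⟩ : ∃ i, Fin.tail x i = y := by simpa using hy
          exact hxE i.succ)
      have hmem : ∀ w, w ∉ E → (∀ i, w ≠ Fin.tail x i) →
          w ∉ E ∪ (List.ofFn (Fin.tail x) : Multiset ℂ).toFinset := fun w hw hw' => by
        simp only [Finset.mem_union, Multiset.mem_toFinset, Multiset.mem_coe, List.mem_ofFn,
          not_or]
        exact ⟨hw, fun ⟨i, hi⟩ => hw' i hi.symm⟩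
      have e1 : ψ (List.ofFn x) = p.eval (x 0) := by
        rw [← hp' (x 0) (hmem _ (hxE 0) fun i hi => (Fin.succ_ne_zero i (hx hi).symm)),
          List.ofFn_succ]
        rfl
      have e2 : ∀ w ∈ N, MvPolynomial.eval (Fin.tail x) (P w) = p.eval w := fun w hw => by
        rw [hE' w (hN' w hw).1 _ ht fun i => hxE' i.succ w hw]
        exact hp' w (hmem w (hN' w hw).1 fun i hi => hxN i.succ (by rw [hi] at hw; exact hw))
      rw [e1, ← Fin.cons_self_tail x, MvPolynomial.eval_eq_eval_mv_eval', AlgEquiv.apply_symm_apply,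
        Lagrange.eq_interpolate_of_eval_eq (s := N) (v := id) (f := p) (fun w => p.eval w)
          Function.injective_id.injOn (by rw [hNc]; exact Polynomial.mem_degreeLT.1 hp)
          (fun _ _ => rfl), Lagrange.interpolate_apply]
      simp only [Polynomial.map_sum, Polynomial.eval_finsetSum, Polynomial.map_mul,
        Polynomial.map_map, Polynomial.map_C, Polynomial.eval_mul, Polynomial.eval_C, Fin.cons_zero]
      refine Finset.sum_congr rfl fun w hw => ?_
      rw [e2 w hw, mul_comm]
      congr 1
      have : (MvPolynomial.eval (Fin.tail x)).comp MvPolynomial.C = RingHom.id ℂ := by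
        ext; simp
      rw [this, Polynomial.map_id]

/-- A function of multisets that is separately polynomial comes from a symmetric polynomial. -/
theorem exists_symPoly {n l : ℕ} (E : Finset ℂ) (ψ : Multiset ℂ → ℂ)
    (h : ∀ X : Multiset ℂ, Multiset.card X + 1 = l → X.Nodup → (∀ x ∈ X, x ∉ E) →
      PolyOff n (E ∪ X.toFinset) fun w => ψ (w ::ₘ X)) :
    ∃ P : symPoly n l, ∀ X : Multiset ℂ, Multiset.card X = l → X.Nodup → (∀ x ∈ X, x ∉ E) →
      evAt n l X P = ψ X := by
  have H := exists_mvPolynomial l E ψ h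
  choose P hP E' hE hZ hE' using H
  -- All choices of Z give polynomials that agree with ψ off a finite set, hence one polynomial.
  -- Taking Z to be the coordinates of a given point then yields agreement at that point.
  have huniq : ∀ Z, P Z = P ∅ := fun Z =>
    mvPolynomial_eq_of_injective ((E' Z ∪ E' ∅).finite_toSet.infinite_compl) fun x hx hx' => by
      have hx'' : ∀ i, x i ∉ E' Z ∧ x i ∉ E' ∅ := fun i => by simpa using hx' i
      rw [hE' _ x hx fun i => (hx'' i).1, hE' _ x hx fun i => (hx'' i).2]
  have hval : ∀ x : Fin l → ℂ, Function.Injective x → (∀ i, x i ∉ E) →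
      MvPolynomial.eval x (P ∅) = ψ (List.ofFn x) := fun x hx hx' => by
    rw [← huniq (Finset.univ.image x)]
    exact hE' _ x hx fun i hi => hx' i (hZ _ _ (Finset.mem_image_of_mem x (Finset.mem_univ i)) hi)
  have hsym : (P ∅).IsSymmetric := fun σ =>
    mvPolynomial_eq_of_injective E.finite_toSet.infinite_compl fun x hx hx' => by
      have hx'' : ∀ i, x i ∉ E := fun i => by simpa using hx' i
      rw [MvPolynomial.eval_rename, hval x hx hx'',
        hval _ (hx.comp σ.injective) fun i => hx'' (σ i)]
      exact congrArg ψ (Multiset.coe_eq_coe.2 (Equiv.Perm.ofFn_comp_perm σ x))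
  refine ⟨⟨P ∅, hsym, hP ∅⟩, fun X hX hX' hX'' => ?_⟩
  obtain ⟨x, rfl⟩ := exists_ofFn' hX
  rw [evAt_ofFn]
  exact hval x (nodup_ofFn.1 hX') fun i => hX'' _ (by simp)

theorem evAt_ext {n l : ℕ} {P Q : symPoly n l} (E : Finset ℂ)
    (h : ∀ X : Multiset ℂ, Multiset.card X = l → X.Nodup → (∀ x ∈ X, x ∉ E) →
      evAt n l X P = evAt n l X Q) : P = Q := by
  refine Subtype.ext (mvPolynomial_eq_of_injective E.finite_toSet.infinite_compl
    fun x hx hx' => ?_)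
  have hx'' : ∀ i, x i ∉ E := fun i => by simpa using hx' i
  rw [← evAt_ofFn, ← evAt_ofFn]
  refine h _ (by simp) (nodup_ofFn.2 hx) fun y hy => ?_
  obtain ⟨i, rfl⟩ : ∃ i, x i = y := by simpa using hy
  exact hx'' i

theorem evAt_cons_polyOff {n l : ℕ} (P : symPoly n l) (X : Multiset ℂ) :
    PolyOff n ∅ fun w => evAt n l (w ::ₘ X) P := by
  by_cases hX : Multiset.card X + 1 = l
  · subst hX
    obtain ⟨x, hx⟩ := exists_ofFn X
    have e : ∀ w, evAt n (Multiset.card X + 1) (w ::ₘ X) P =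
        (Polynomial.map (MvPolynomial.eval x)
          (MvPolynomial.finSuccEquiv ℂ _ P.1)).eval w := fun w => by
      rw [← MvPolynomial.eval_eq_eval_mv_eval', ← evAt_ofFn, List.ofFn_succ]
      simp [← Multiset.cons_coe, ← hx]
    refine ⟨_, ?_, fun w _ => e w⟩
    rw [Polynomial.mem_degreeLT]
    refine Polynomial.degree_map_le.trans_lt ?_
    rw [Polynomial.degree_lt_iff_coeff_zero]
    intro m hm
    by_contra h0
    obtain ⟨s, hs⟩ := MvPolynomial.support_nonempty.2 h0
    rw [MvPolynomial.mem_support_coeff_finSuccEquiv] at hs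
    have := P.2.2 _ hs 0
    simp at this
    omega
  · exact PolyOff.zero.congr fun w _ => evAt_of_ne P (by simpa using hX)

/-! ### Polynomiality of the operators -/

/-- `φ` is polynomial of degree less than `n` in each of its arguments. -/
def SepPoly (n : ℕ) (φ : Multiset ℂ → ℂ) : Prop :=
  ∀ X : Multiset ℂ, PolyOff n ∅ fun w => φ (w ::ₘ X)

theorem SepPoly.opC {n : ℕ} {φ : Multiset ℂ → ℂ} (h : SepPoly n φ) (w : ℂ) :
    SepPoly n (opC w φ) := fun X =>
  (h (w ::ₘ X)).congr fun v _ => by rw [TrigHyp.opC, Multiset.cons_swap]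

/-- With u and X fixed, the operator is a finite linear combination of values of `Φ w`. -/
theorem polyOff_opA_opC {n : ℕ} {E : Finset ℂ} (q : ℂ) (α : ℂ → ℂ) (u : ℂ)
    (Φ : ℂ → Multiset ℂ → ℂ) (h : ∀ X, PolyOff n E fun w => Φ w X) (X : Multiset ℂ) :
    PolyOff n E fun w => opA q α u (Φ w) X := by
  unfold opA
  exact ((h _).const_mul _).add (PolyOff.sum fun a _ => (h _).const_mul _)

/-- The poles at the points of X are only apparent. By `opA_cons`, multiplication by u - w gives a
polynomial of degree at most n + 1 that vanishes at u = w, because the two terms of the recursion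
then have opposite coefficients. -/
theorem polyOff_opA {n : ℕ} (q : ℂ) {α : ℂ → ℂ} (hα : PolyOff (n + 1) ∅ α) {X : Multiset ℂ}
    (hX : X.Nodup) {φ : Multiset ℂ → ℂ} (hφ : SepPoly n φ) :
    PolyOff (n + 1) X.toFinset fun u => opA q α u φ X := by
  induction X using Multiset.induction generalizing φ with
  | empty =>
    simp only [opA_zero]
    exact (hα.mul_const _).mono le_rfl (by simp)
  | cons w X ih =>
    rw [Multiset.nodup_cons] at hX
    have h1 := ih hX.2 (hφ.opC w)
    have h2 : PolyOff n ∅ fun u => opA q α w (opC u φ) X :=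
      polyOff_opA_opC q α w (fun u => opC u φ) hφ X
    rw [Multiset.toFinset_cons]
    refine PolyOff.div (f := fun u => q⁻¹ * (u * opA q α u (opC w φ) X) +
      -(q * w) * opA q α u (opC w φ) X + (q - q⁻¹) * (u * opA q α w (opC u φ) X))
      (((h1.id_mul.const_mul _).add ((h1.const_mul _).mono (by omega) subset_rfl)).add
        ((h2.id_mul.const_mul _).mono (by omega) (by simp))) (by simpa using hX.1) (by ring) ?_
    intro u hu huw
    rw [opA_cons q α φ hX.1 (by simpa using hu) huw]
    unfold hh gg
    have e1 := sub_ne_zero.2 huw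
    have e2 := sub_ne_zero.2 huw.symm
    have e3 : (u - w) * ((q * w - q⁻¹ * u) / (w - u)) = -(q * w - q⁻¹ * u) := by
      rw [← neg_sub w u]
      field_simp
    have e4 : (u - w) * ((q - q⁻¹) * u / (u - w)) = (q - q⁻¹) * u := by
      field_simp
    rw [mul_add, ← mul_assoc, ← mul_assoc, e3, e4]
    ring

/-- The same recursion read as a function of w. The operator with parameter w has degree at most n
by `polyOff_opA`, and the division by w - u lowers the bound to less than n. -/
theorem polyOff_opA_cons {n : ℕ} (q : ℂ) {α : ℂ → ℂ} (hα : PolyOff (n + 1) ∅ α)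
    {X : Multiset ℂ} (hX : X.Nodup) {u : ℂ} (hu : u ∉ X) {φ : Multiset ℂ → ℂ}
    (hφ : SepPoly n φ) :
    PolyOff n (insert u X.toFinset) fun w => opA q α u φ (w ::ₘ X) := by
  have h1 := polyOff_opA q hα hX (hφ.opC u)
  have h2 : PolyOff n ∅ fun w => opA q α u (opC w φ) X :=
    polyOff_opA_opC q α u (fun u => opC u φ) hφ X
  refine PolyOff.div (f := fun w => q * (w * opA q α u (opC w φ) X) +
    -(q⁻¹ * u) * opA q α u (opC w φ) X + -((q - q⁻¹) * u) * opA q α w (opC u φ) X)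
    ((((h2.id_mul.const_mul _).add ((h2.const_mul _).mono (by omega) subset_rfl)).mono le_rfl
      (by simp)).add (h1.const_mul _)) (by simpa using hu) (by ring) ?_
  intro w hw hwu
  rw [opA_cons q α φ (by simpa using hw) hu hwu.symm]
  unfold hh gg
  have e1 := sub_ne_zero.2 hwu
  have e2 := sub_ne_zero.2 hwu.symm
  have e3 : (w - u) * ((q * w - q⁻¹ * u) / (w - u)) = q * w - q⁻¹ * u := by
    field_simp
  have e4 : (w - u) * ((q - q⁻¹) * u / (u - w)) = -((q - q⁻¹) * u) := by
    rw [← neg_sub u w]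
    field_simp
  rw [mul_add, ← mul_assoc, ← mul_assoc, e3, e4]
  ring

/-! ### Coefficients in the spectral parameter -/

theorem sum_basis_smul_coeff {V : Type*} [AddCommGroup V] [Module ℂ V] {n : ℕ} {N : Finset ℂ}
    (hN : N.card = n + 1) (R : ℂ → V) (u : ℂ) :
    ∑ s ∈ Finset.range (n + 1), u ^ s • ∑ v ∈ N, (Lagrange.basis N id v).coeff s • R v =
      ∑ v ∈ N, (Lagrange.basis N id v).eval u • R v := by
  simp only [Finset.smul_sum, smul_smul]
  rw [Finset.sum_comm]
  refine Finset.sum_congr rfl fun v hv => ?_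
  rw [← Finset.sum_smul, Polynomial.eval_eq_sum_range' (n := n + 1)]
  · simp only [mul_comm]
  · have h := Lagrange.degree_basis (v := id) Function.injective_id.injOn hv
    rw [hN] at h
    rw [Polynomial.natDegree_eq_of_degree_eq_some h]
    omega

/-- The coefficients in `u` of a family of functions that is polynomial in `u` and in the
remaining arguments. -/
theorem exists_coeff {n : ℕ} (K : ℂ → Multiset ℂ → ℂ)
    (hU : ∀ X : Multiset ℂ, X.Nodup → PolyOff (n + 1) X.toFinset fun u => K u X)
    (hW : ∀ (u : ℂ) (X : Multiset ℂ), X.Nodup → u ∉ X →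
      PolyOff n (insert u X.toFinset) fun w => K u (w ::ₘ X)) (l : ℕ) :
    ∃ R : ℕ → symPoly n l, (∀ s, n < s → R s = 0) ∧
      ∀ (u : ℂ) (X : Multiset ℂ), Multiset.card X = l → X.Nodup → u ∉ X →
        evAt n l X (∑ s ∈ Finset.range (n + 1), u ^ s • R s) = K u X := by
  have h1 : ∀ u, ∃ P : symPoly n l, ∀ X : Multiset ℂ, Multiset.card X = l → X.Nodup →
      (∀ x ∈ X, x ∉ ({u} : Finset ℂ)) → evAt n l X P = K u X := fun u =>
    exists_symPoly {u} (K u) fun X _ hX hX' => (hW u X hX fun h => hX' u h (by simp)).mono le_rfl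
      (by rw [Finset.insert_eq])
  choose P hP using h1
  have hP' : ∀ (u : ℂ) (X : Multiset ℂ), Multiset.card X = l → X.Nodup → u ∉ X →
      evAt n l X (P u) = K u X := fun u X h h' h'' =>
    hP u X h h' fun x hx hxu => h'' (by rw [Finset.mem_singleton] at hxu; exact hxu ▸ hx)
  -- The degree in u is at most n, so n + 1 nodes recover the whole family from its members `P v`.
  obtain ⟨N, hN⟩ := Infinite.exists_subset_card_eq ℂ (n + 1)
  refine ⟨fun s => ∑ v ∈ N, (Lagrange.basis N id v).coeff s • P v, fun s hs => ?_,
    fun u X hX hX' hu => ?_⟩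
  · refine Finset.sum_eq_zero fun v hv => ?_
    rw [Polynomial.coeff_eq_zero_of_degree_lt, zero_smul]
    rw [Lagrange.degree_basis Function.injective_id.injOn hv, hN]
    exact_mod_cast hs
  · rw [← hP' u X hX hX' hu]
    refine congrArg (evAt n l X) ((sum_basis_smul_coeff hN P u).trans ?_)
    refine evAt_ext (insert u N) fun Y hY hY' hYN => ?_
    have hu' : u ∉ Y := fun h => hYN u h (by simp)
    rw [hP' u Y hY hY' hu']
    obtain ⟨p, hp, hp'⟩ := hU Y hY'
    beta_reduce at hp'
    rw [hp' u (by simpa using hu'), map_sum,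
      Lagrange.eq_interpolate_of_eval_eq (s := N) (v := id) (f := p) (fun w => p.eval w)
        Function.injective_id.injOn (by rw [hN]; exact Polynomial.mem_degreeLT.1 hp)
        (fun _ _ => rfl), Lagrange.interpolate_apply, Polynomial.eval_finsetSum]
    refine Finset.sum_congr rfl fun v hv => ?_
    have hv' : v ∉ Y := fun h => hYN v h (by simp [hv])
    rw [map_smul, hP' v Y hY hY' hv', hp' v (by simpa using hv')]
    simp [mul_comm]

theorem eq_zero_of_sum_pow_smul {V : Type*} [AddCommGroup V] [Module ℂ V] {N : ℕ} {c : ℕ → V}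
    {T : Set ℂ} (hT : T.Infinite)
    (h : ∀ u ∈ T, ∑ s ∈ Finset.range N, u ^ s • c s = 0) {s : ℕ} (hs : s < N) : c s = 0 := by
  rw [← Module.forall_dual_apply_eq_zero_iff ℂ]
  intro f
  have h0 : (∑ s ∈ Finset.range N, Polynomial.monomial s (f (c s))) = 0 := by
    refine Polynomial.eq_zero_of_infinite_isRoot _ (hT.mono fun u hu => ?_)
    have := congrArg f (h u hu)
    simpa [Polynomial.eval_finsetSum, mul_comm] using this
  have := congrArg (fun p => Polynomial.coeff p s) h0
  simpa [Polynomial.finsetSum_coeff, Polynomial.coeff_monomial, hs] using this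

/-- The coefficients come from a choice; their uniqueness is what makes them linear in the
polynomial acted upon. -/
theorem coeff_unique {n l : ℕ} {R R' : ℕ → symPoly n l} (h1 : ∀ s, n < s → R s = 0)
    (h1' : ∀ s, n < s → R' s = 0)
    (h : ∀ (u : ℂ) (X : Multiset ℂ), Multiset.card X = l → X.Nodup → u ∉ X →
        evAt n l X (∑ s ∈ Finset.range (n + 1), u ^ s • R s) =
          evAt n l X (∑ s ∈ Finset.range (n + 1), u ^ s • R' s)) (s : ℕ) : R s = R' s := by
  by_cases hs : n < s
  · rw [h1 s hs, h1' s hs]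
  · rw [← sub_eq_zero]
    refine eq_zero_of_sum_pow_smul (c := fun s => R s - R' s) (N := n + 1)
      (Set.infinite_univ (α := ℂ)) (fun u _ => ?_) (by omega)
    simp only [smul_sub, Finset.sum_sub_distrib]
    rw [sub_eq_zero]
    exact evAt_ext {u} fun X hX hX' hX'' => h u X hX hX' fun hu => hX'' u hu (by simp)

/-- The coefficients in `u` of a family of linear operators. -/
theorem exists_coeff_linear {n l : ℕ} (K : symPoly n l → ℂ → Multiset ℂ → ℂ)
    (hadd : ∀ P Q u X, K (P + Q) u X = K P u X + K Q u X)
    (hsmul : ∀ (c : ℂ) P u X, K (c • P) u X = c * K P u X)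
    (hU : ∀ P, ∀ X : Multiset ℂ, X.Nodup → PolyOff (n + 1) X.toFinset fun u => K P u X)
    (hW : ∀ P, ∀ (u : ℂ) (X : Multiset ℂ), X.Nodup → u ∉ X →
      PolyOff n (insert u X.toFinset) fun w => K P u (w ::ₘ X)) (l' : ℕ) :
    ∃ T : ℕ → symPoly n l →ₗ[ℂ] symPoly n l', (∀ s, n < s → T s = 0) ∧
      ∀ (P : symPoly n l) (u : ℂ) (X : Multiset ℂ), Multiset.card X = l' → X.Nodup → u ∉ X →
        evAt n l' X (∑ s ∈ Finset.range (n + 1), u ^ s • T s P) = K P u X := by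
  choose R hR hR' using fun P => exists_coeff (K P) (hU P) (hW P) l'
  refine ⟨fun s =>
    { toFun := fun P => R P s
      map_add' := fun P Q => coeff_unique (hR (P + Q))
        (R' := fun s => R P s + R Q s) (fun s hs => by rw [hR P s hs, hR Q s hs, add_zero])
        (fun u X h h' h'' => ?_) s
      map_smul' := fun c P => coeff_unique (hR (c • P)) (R' := fun s => c • R P s)
        (fun s hs => by rw [hR P s hs, smul_zero]) (fun u X h h' h'' => ?_) s },
    fun s hs => LinearMap.ext fun P => hR P s hs, fun P u X h h' h'' => hR' P u X h h' h''⟩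
  · simp only [smul_add, Finset.sum_add_distrib]
    rw [map_add, hR' _ u X h h' h'', hR' _ u X h h' h'', hR' _ u X h h' h'', hadd]
  · simp only [smul_comm _ c]
    rw [← Finset.smul_sum, map_smul, hR' _ u X h h' h'', hR' _ u X h h' h'', hsmul, smul_eq_mul]

theorem opA_add (q : ℂ) (α : ℂ → ℂ) (u : ℂ) (φ ψ : Multiset ℂ → ℂ) (X : Multiset ℂ) :
    opA q α u (fun X => φ X + ψ X) X = opA q α u φ X + opA q α u ψ X := by
  simp only [opA, mul_add, Multiset.sum_map_add]
  ring

theorem opA_const_mul (q : ℂ) (α : ℂ → ℂ) (u c : ℂ) (φ : Multiset ℂ → ℂ) (X : Multiset ℂ) :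
    opA q α u (fun X => c * φ X) X = c * opA q α u φ X := by
  simp only [opA, mul_add, ← Multiset.sum_map_mul_left]
  congr 1
  · ring
  · exact sum_map_congr fun a _ => by ring

theorem opB_add (q : ℂ) (α d : ℂ → ℂ) (u : ℂ) (φ ψ : Multiset ℂ → ℂ) (X : Multiset ℂ) :
    opB q α d u (fun X => φ X + ψ X) X = opB q α d u φ X + opB q α d u ψ X := by
  simp only [opB, mul_add, add_mul, Multiset.sum_map_add]
  ring

theorem opB_const_mul (q : ℂ) (α d : ℂ → ℂ) (u c : ℂ) (φ : Multiset ℂ → ℂ) (X : Multiset ℂ) :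
    opB q α d u (fun X => c * φ X) X = c * opB q α d u φ X := by
  simp only [opB, mul_sub, ← Multiset.sum_map_mul_left]
  congr 1
  · exact sum_map_congr fun a _ => by ring
  · exact sum_map_congr fun a _ => sum_map_congr fun b _ => by ring

theorem sepPoly_evAt {n l : ℕ} (P : symPoly n l) : SepPoly n fun X => evAt n l X P :=
  fun X => evAt_cons_polyOff P X

/-- A family of polynomials that extends `opA q α u φ` to all `u` and all multisets. -/
theorem exists_opA_extension {n : ℕ} (q : ℂ) {α : ℂ → ℂ} (hα : PolyOff (n + 1) ∅ α)
    {φ : Multiset ℂ → ℂ} (hφ : SepPoly n φ) :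
    ∃ Φ : ℂ → Multiset ℂ → ℂ, (∀ u, SepPoly n (Φ u)) ∧
      (∀ X, PolyOff (n + 1) ∅ fun u => Φ u X) ∧
      ∀ (u : ℂ) (X : Multiset ℂ), X.Nodup → u ∉ X → opA q α u φ X = Φ u X := by
  choose R hR hR' using exists_coeff (fun u X => opA q α u φ X)
    (fun X hX => polyOff_opA q hα hX hφ) (fun u X hX hu => polyOff_opA_cons q hα hX hu hφ)
  refine ⟨fun u X => evAt n (Multiset.card X) X
    (∑ s ∈ Finset.range (n + 1), u ^ s • R (Multiset.card X) s), fun u X => ?_, fun X => ?_,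
    fun u X hX hu => (hR' _ u X rfl hX hu).symm⟩
  · have key : ∀ (w : ℂ) (k : ℕ), Multiset.card (w ::ₘ X) = k →
        evAt n (Multiset.card (w ::ₘ X)) (w ::ₘ X)
          (∑ s ∈ Finset.range (n + 1), u ^ s • R (Multiset.card (w ::ₘ X)) s) =
        evAt n k (w ::ₘ X) (∑ s ∈ Finset.range (n + 1), u ^ s • R k s) := by
      rintro w _ rfl
      rfl
    exact (evAt_cons_polyOff (∑ s ∈ Finset.range (n + 1), u ^ s • R (Multiset.card X + 1) s)
      X).congr fun w _ => key w _ (Multiset.card_cons w X)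
  · refine ⟨∑ s ∈ Finset.range (n + 1),
      Polynomial.monomial s (evAt n (Multiset.card X) X (R (Multiset.card X) s)),
      Submodule.sum_mem _ fun s hs => ?_, fun u _ => ?_⟩
    · rw [Polynomial.mem_degreeLT]
      exact (Polynomial.degree_monomial_le _ _).trans_lt
        (by exact_mod_cast Finset.mem_range.1 hs)
    · simp [Polynomial.eval_finsetSum, mul_comm]

/-- The outer operator evaluates its argument only at X and at the multisets u, X \ a. These have no
repetitions and avoid w, so the formula and its polynomial extension agree there. -/
theorem opA_extension_comp {q q' : ℂ} {α d : ℂ → ℂ} {φ : Multiset ℂ → ℂ}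
    {Φ : ℂ → Multiset ℂ → ℂ}
    (hΦ : ∀ (u : ℂ) (X : Multiset ℂ), X.Nodup → u ∉ X → opA q α u φ X = Φ u X)
    {u w : ℂ} {X : Multiset ℂ} (hX : X.Nodup) (hu : u ∉ X) (hw : w ∉ X) (h : u ≠ w) :
    opA q' d u (opA q α w φ) X = opA q' d u (Φ w) X := by
  refine opA_congr _ _ (hΦ w X hX hw) fun a ha => hΦ w _ ?_ ?_
  · exact Multiset.nodup_cons.2 ⟨fun h => hu (Multiset.mem_of_mem_erase h), hX.erase a⟩
  · rw [Multiset.mem_cons, not_or]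
    exact ⟨h.symm, fun h => hw (Multiset.mem_of_mem_erase h)⟩

theorem polyOff_opB_opC {n : ℕ} (q : ℂ) (α d : ℂ → ℂ) (u : ℂ) {φ : Multiset ℂ → ℂ}
    (hφ : SepPoly n φ) (X : Multiset ℂ) :
    PolyOff n ∅ fun w => opB q α d u (opC w φ) X := by
  unfold opB
  exact (PolyOff.sum fun a _ => ((hφ _).const_mul _).mul_const _).sub
    (PolyOff.sum fun a _ => PolyOff.sum fun b _ => (hφ _).const_mul _)

/-- As for `opA`, now with `opB_cons`: the pole of gg(u,w) at u = w is cancelled because D(u)A(w) -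
D(w)A(u) is antisymmetric in u and w. -/
theorem polyOff_opB {n : ℕ} {q : ℂ} (hq : q ≠ 0) {α d : ℂ → ℂ} (hα : PolyOff (n + 1) ∅ α)
    (hd : PolyOff (n + 1) ∅ d) {X : Multiset ℂ} (hX : X.Nodup) {φ : Multiset ℂ → ℂ}
    (hφ : SepPoly n φ) : PolyOff (n + 1) X.toFinset fun u => opB q α d u φ X := by
  induction X using Multiset.induction generalizing φ with
  | empty =>
    simp only [opB_zero]
    exact PolyOff.zero
  | cons w X ih =>
    rw [Multiset.nodup_cons] at hX
    -- The formula for A(w)φ makes sense only at multisets avoiding w, whereas the outer operator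
    -- needs an argument that is polynomial everywhere; Φ provides it.
    obtain ⟨Φ, hΦ1, hΦ2, hΦ3⟩ := exists_opA_extension q hα hφ
    have h1 := ih hX.2 (hφ.opC w)
    have h2 := polyOff_opA q⁻¹ hd hX.2 (hΦ1 w)
    have h3 := polyOff_opA_opC q⁻¹ d w Φ hΦ2 X
    rw [Multiset.toFinset_cons]
    refine PolyOff.div (f := fun u => u * opB q α d u (opC w φ) X +
      -w * opB q α d u (opC w φ) X + (q - q⁻¹) *
        (u * (opA q⁻¹ d u (Φ w) X - opA q⁻¹ d w (Φ u) X)))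
      ((h1.id_mul.add ((h1.const_mul _).mono (by omega) subset_rfl)).add
        ((h2.sub (h3.mono le_rfl (by simp))).id_mul.const_mul _))
        (by simpa using hX.1) (by ring) ?_
    intro u hu huw
    have hu' : u ∉ X := by simpa using hu
    rw [opB_cons hq α d φ hX.1 hu' huw, opA_extension_comp hΦ3 hX.2 hu' hX.1 huw,
      opA_extension_comp hΦ3 hX.2 hX.1 hu' huw.symm]
    unfold gg
    have e1 := sub_ne_zero.2 huw
    have e4 : (u - w) * ((q - q⁻¹) * u / (u - w)) = (q - q⁻¹) * u := by
      field_simp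
    rw [mul_add, ← mul_assoc (u - w) ((q - q⁻¹) * u / (u - w)), e4]
    ring

theorem polyOff_opB_cons {n : ℕ} {q : ℂ} (hq : q ≠ 0) {α d : ℂ → ℂ}
    (hα : PolyOff (n + 1) ∅ α) (hd : PolyOff (n + 1) ∅ d) {X : Multiset ℂ} (hX : X.Nodup)
    {u : ℂ} (hu : u ∉ X) {φ : Multiset ℂ → ℂ} (hφ : SepPoly n φ) :
    PolyOff n (insert u X.toFinset) fun w => opB q α d u φ (w ::ₘ X) := by
  obtain ⟨Φ, hΦ1, hΦ2, hΦ3⟩ := exists_opA_extension q hα hφ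
  have h1 := polyOff_opB_opC q α d u hφ X
  have h2 := polyOff_opA q⁻¹ hd hX (hΦ1 u)
  have h3 := polyOff_opA_opC q⁻¹ d u Φ hΦ2 X
  refine PolyOff.div (f := fun w => w * opB q α d u (opC w φ) X +
    -u * opB q α d u (opC w φ) X + -((q - q⁻¹) * u) *
      (opA q⁻¹ d u (Φ w) X - opA q⁻¹ d w (Φ u) X))
    (((h1.id_mul.add ((h1.const_mul _).mono (by omega) subset_rfl)).mono le_rfl (by simp)).add
      (((h3.mono le_rfl (by simp)).sub h2).const_mul _)) (by simpa using hu) (by ring) ?_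
  intro w hw hwu
  have hw' : w ∉ X := by simpa using hw
  rw [opB_cons hq α d φ hw' hu hwu.symm, opA_extension_comp hΦ3 hX hu hw' hwu.symm,
    opA_extension_comp hΦ3 hX hw' hu hwu]
  unfold gg
  have e2 := sub_ne_zero.2 hwu.symm
  have e4 : (w - u) * ((q - q⁻¹) * u / (u - w)) = -((q - q⁻¹) * u) := by
    rw [← neg_sub u w]
    field_simp
  rw [mul_add, ← mul_assoc (w - u) ((q - q⁻¹) * u / (u - w)), e4]
  ring

/-! ### The `RLL` relations from the commutation relations with `L₂₁` -/

/-- Operator families `A, B, C, D` whose commutation relations with `C` have the `RLL` form, on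
a space with enough functionals `ev X` for which `C` acts by insertion into `X`. -/
structure BetheData (q : ℂ) (M : Type*) [AddCommGroup M] [Module ℂ M] where
  ev : Multiset ℂ → M →ₗ[ℂ] ℂ
  A : ℂ → Module.End ℂ M
  B : ℂ → Module.End ℂ M
  C : ℂ → Module.End ℂ M
  D : ℂ → Module.End ℂ M
  α : ℂ → ℂ
  d : ℂ → ℂ
  q_ne_zero : q ≠ 0
  ev_ext : ∀ (E : Finset ℂ) (m m' : M),
    (∀ X : Multiset ℂ, X.Nodup → (∀ x ∈ X, x ∉ E) → ev X m = ev X m') → m = m'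
  ev_C : ∀ (u : ℂ) (X : Multiset ℂ) (m : M), X.Nodup → u ∉ X → ev X (C u m) = ev (u ::ₘ X) m
  ev_A : ∀ u m, ev 0 (A u m) = α u * ev 0 m
  ev_D : ∀ u m, ev 0 (D u m) = d u * ev 0 m
  ev_B : ∀ u m, ev 0 (B u m) = 0
  C_A : ∀ {u w : ℂ}, u ≠ w → ∀ m,
    C w (A u m) = hh q w u • A u (C w m) + gg q u w • A w (C u m)
  C_D : ∀ {u w : ℂ}, u ≠ w → ∀ m,
    C w (D u m) = hh q u w • D u (C w m) - gg q u w • D w (C u m)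
  C_B : ∀ {u w : ℂ}, u ≠ w → ∀ m,
    C w (B u m) = B u (C w m) + gg q u w • (D u (A w m) - D w (A u m))

namespace BetheData

variable {q : ℂ} {M : Type*} [AddCommGroup M] [Module ℂ M] (S : BetheData q M)

theorem C_C (u v : ℂ) (m : M) : S.C u (S.C v m) = S.C v (S.C u m) := by
  rcases eq_or_ne u v with rfl | h
  · rfl
  refine S.ev_ext {u, v} _ _ fun X hX hX' => ?_
  have hu : u ∉ X := fun h => hX' u h (by simp)
  have hv : v ∉ X := fun h => hX' v h (by simp)
  rw [S.ev_C u X _ hX hu, S.ev_C v X _ hX hv, S.ev_C v, S.ev_C u, Multiset.cons_swap]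
  · exact Multiset.nodup_cons.2 ⟨hv, hX⟩
  · simpa using ⟨h, hu⟩
  · exact Multiset.nodup_cons.2 ⟨hu, hX⟩
  · simpa using ⟨h.symm, hv⟩

/-- Induction on the multiset for an identity that depends on two distinct parameters. -/
theorem ext_of_induction {F G : ℂ → ℂ → M → M}
    (h0 : ∀ u v, u ≠ v → ∀ m, S.ev 0 (F u v m) = S.ev 0 (G u v m))
    (hs : ∀ (X : Multiset ℂ),
      (∀ u v, u ∉ X → v ∉ X → u ≠ v → ∀ m, S.ev X (F u v m) = S.ev X (G u v m)) →
      ∀ u v w, u ∉ X → v ∉ X → w ∉ X → u ≠ v → u ≠ w → v ≠ w → ∀ m,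
        S.ev X (S.C w (F u v m)) = S.ev X (S.C w (G u v m)))
    {u v : ℂ} (h : u ≠ v) (m : M) : F u v m = G u v m := by
  refine S.ev_ext {u, v} _ _ fun X hX hX' => ?_
  have hu : u ∉ X := fun h => hX' u h (by simp)
  have hv : v ∉ X := fun h => hX' v h (by simp)
  clear hX'
  induction X using Multiset.induction generalizing u v m with
  | empty => exact h0 u v h m
  | cons w X ih =>
    rw [Multiset.nodup_cons] at hX
    rw [Multiset.mem_cons, not_or] at hu hv
    -- Evaluation at w, X is evaluation at X after C(w): one variable fewer.
    rw [← S.ev_C w X _ hX.2 hX.1, ← S.ev_C w X _ hX.2 hX.1]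
    exact hs X (fun u v hu hv h m => ih h m hX.2 hu hv) u v w hu.2 hv.2 hX.1 h hu.1 hv.1 m

/-- Moving C(w) to the right leaves products A A C of the parameters u, v, w evaluated at X. There
the A's commute by induction, and the coefficients agree as rational functions. -/
theorem A_A {u v : ℂ} (h : u ≠ v) (m : M) : S.A u (S.A v m) = S.A v (S.A u m) := by
  refine S.ext_of_induction (F := fun u v m => S.A u (S.A v m))
    (G := fun u v m => S.A v (S.A u m)) (fun u v _ m => ?_) ?_ h m
  · rw [S.ev_A, S.ev_A, S.ev_A, S.ev_A]
    ring
  · intro X ih u v w hu hv hw huv huw hvw m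
    have e1 := sub_ne_zero.2 huv
    have e2 := sub_ne_zero.2 huw
    have e3 := sub_ne_zero.2 hvw
    have e4 := sub_ne_zero.2 huv.symm
    have e5 := sub_ne_zero.2 huw.symm
    have e6 := sub_ne_zero.2 hvw.symm
    have hq := S.q_ne_zero
    simp only [S.C_A huw, S.C_A hvw, S.C_A huv, S.C_A huv.symm, map_add, map_smul, smul_eq_mul]
    rw [ih u v hu hv huv, ih w v hw hv hvw.symm, ih w u hw hu huw.symm]
    generalize S.ev X (S.A v (S.A u (S.C w m))) = x
    generalize S.ev X (S.A v (S.A w (S.C u m))) = y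
    generalize S.ev X (S.A u (S.A w (S.C v m))) = z
    unfold hh gg
    field_simp
    ring

theorem D_D {u v : ℂ} (h : u ≠ v) (m : M) : S.D u (S.D v m) = S.D v (S.D u m) := by
  refine S.ext_of_induction (F := fun u v m => S.D u (S.D v m))
    (G := fun u v m => S.D v (S.D u m)) (fun u v _ m => ?_) ?_ h m
  · rw [S.ev_D, S.ev_D, S.ev_D, S.ev_D]
    ring
  · intro X ih u v w hu hv hw huv huw hvw m
    have e1 := sub_ne_zero.2 huv
    have e2 := sub_ne_zero.2 huw
    have e3 := sub_ne_zero.2 hvw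
    have e4 := sub_ne_zero.2 huv.symm
    have e5 := sub_ne_zero.2 huw.symm
    have e6 := sub_ne_zero.2 hvw.symm
    have hq := S.q_ne_zero
    simp only [S.C_D huw, S.C_D hvw, S.C_D huv, S.C_D huv.symm, map_sub, map_smul, smul_eq_mul]
    rw [ih u v hu hv huv, ih w v hw hv hvw.symm, ih w u hw hu huw.symm]
    generalize S.ev X (S.D v (S.D u (S.C w m))) = x
    generalize S.ev X (S.D v (S.D w (S.C u m))) = y
    generalize S.ev X (S.D u (S.D w (S.C v m))) = z
    unfold hh gg
    field_simp
    ring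

/-- The products A D that appear once C(w) has been moved to the right are rewritten, by the
induction hypothesis for pairs among u, v, w, in the order D A and B C. Commutativity of the C's
then leaves only scalar identities. -/
theorem A_D {u v : ℂ} (h : u ≠ v) (m : M) : S.A v (S.D u m) =
    S.D u (S.A v m) - gg q v u • S.B u (S.C v m) - gg q u v • S.B v (S.C u m) := by
  refine S.ext_of_induction (F := fun u v m => S.A v (S.D u m))
    (G := fun u v m => S.D u (S.A v m) - gg q v u • S.B u (S.C v m) -
      gg q u v • S.B v (S.C u m)) (fun u v _ m => ?_) ?_ h m
  · simp only [map_sub, map_smul, S.ev_A, S.ev_D, S.ev_B]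
    rw [smul_zero, smul_zero]
    ring
  · intro X ih u v w hu hv hw huv huw hvw m
    have e1 := sub_ne_zero.2 huv
    have e2 := sub_ne_zero.2 huw
    have e3 := sub_ne_zero.2 hvw
    have e4 := sub_ne_zero.2 huv.symm
    have e5 := sub_ne_zero.2 huw.symm
    have e6 := sub_ne_zero.2 hvw.symm
    have hq := S.q_ne_zero
    simp only [S.C_A hvw, S.C_A huv.symm, S.C_D huw, S.C_D huv, S.C_B huw, S.C_B hvw, map_add, map_sub, map_smul] at ih ⊢
    rw [ih u v hu hv huv, ih w v hw hv hvw.symm, ih u w hu hw huw, ih v w hv hw hvw,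
      S.C_C w v m, S.C_C w u m, S.C_C v u m]
    match_scalars <;> first | ring1 | (simp only [hh, gg]; field_simp; ring1)

/-- Moving C(w) past B creates products of D and A. Hence the relations of A with D and of A with A
are needed first; `D_B` similarly relies on `A_D` and `D_D`. -/
theorem A_B {u v : ℂ} (h : u ≠ v) (m : M) : S.A v (S.B u m) =
    hh q u v • S.B u (S.A v m) - gg q u v • S.B v (S.A u m) := by
  refine S.ext_of_induction (F := fun u v m => S.A v (S.B u m))
    (G := fun u v m => hh q u v • S.B u (S.A v m) - gg q u v • S.B v (S.A u m))
    (fun u v _ m => ?_) ?_ h m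
  · simp only [map_sub, map_smul, S.ev_A, S.ev_B]
    simp
  · intro X ih u v w hu hv hw huv huw hvw m
    have e1 := sub_ne_zero.2 huv
    have e2 := sub_ne_zero.2 huw
    have e3 := sub_ne_zero.2 hvw
    have e4 := sub_ne_zero.2 huv.symm
    have e5 := sub_ne_zero.2 huw.symm
    have e6 := sub_ne_zero.2 hvw.symm
    have hq := S.q_ne_zero
    simp only [S.C_A huw, S.C_A hvw, S.C_B huw, S.C_B hvw, S.C_B huv, S.A_D huv, S.A_D huw,
      S.A_D hvw, S.A_D hvw.symm, S.C_A huv, S.C_A huv.symm, S.C_A huw.symm, S.C_A hvw.symm,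
      map_add, map_sub, map_smul, smul_add, smul_sub] at ih ⊢
    rw [ih u v hu hv huv, ih u w hu hw huw, S.A_A huv, S.A_A hvw]
    match_scalars <;> first | ring1 | (simp only [hh, gg]; field_simp; ring1)

theorem D_B {u v : ℂ} (h : u ≠ v) (m : M) : S.D u (S.B v m) =
    hh q u v • S.B v (S.D u m) + gg q v u • S.B u (S.D v m) := by
  refine S.ext_of_induction (F := fun u v m => S.D u (S.B v m))
    (G := fun u v m => hh q u v • S.B v (S.D u m) + gg q v u • S.B u (S.D v m))
    (fun u v _ m => ?_) ?_ h m
  · simp only [map_add, map_smul, S.ev_D, S.ev_B]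
    simp
  · intro X ih u v w hu hv hw huv huw hvw m
    have e1 := sub_ne_zero.2 huv
    have e2 := sub_ne_zero.2 huw
    have e3 := sub_ne_zero.2 hvw
    have e4 := sub_ne_zero.2 huv.symm
    have e5 := sub_ne_zero.2 huw.symm
    have e6 := sub_ne_zero.2 hvw.symm
    have hq := S.q_ne_zero
    simp only [S.C_D huw, S.C_D hvw, S.C_B huw, S.C_B hvw, S.C_B huv.symm, S.A_D huv,
      S.A_D huv.symm, S.A_D huw, S.A_D hvw,
      map_add, map_sub, map_smul, smul_add, smul_sub] at ih ⊢
    rw [ih u v hu hv huv, ih w v hw hv hvw.symm, ih v u hv hu huv.symm, ih v w hv hw hvw,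
      ih w u hw hu huw.symm, ih u w hu hw huw, S.D_D huv, S.D_D huw]
    match_scalars <;> first | ring1 | (simp only [hh, gg]; field_simp; ring1)

/-- Moving C(w) through both B's creates terms with one B, one A and one D, which the exchange
relations of B with A and with D bring to a common order. -/
theorem B_B {u v : ℂ} (h : u ≠ v) (m : M) : S.B u (S.B v m) = S.B v (S.B u m) := by
  refine S.ext_of_induction (F := fun u v m => S.B u (S.B v m))
    (G := fun u v m => S.B v (S.B u m)) (fun u v _ m => ?_) ?_ h m
  · rw [S.ev_B, S.ev_B]
  · intro X ih u v w hu hv hw huv huw hvw m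
    have e1 := sub_ne_zero.2 huv
    have e2 := sub_ne_zero.2 huw
    have e3 := sub_ne_zero.2 hvw
    have e4 := sub_ne_zero.2 huv.symm
    have e5 := sub_ne_zero.2 huw.symm
    have e6 := sub_ne_zero.2 hvw.symm
    have hq := S.q_ne_zero
    simp only [S.C_B huw, S.C_B hvw, S.A_B huv, S.A_B huv.symm, S.A_B hvw, S.A_B huw,
      S.D_B huv, S.D_B huv.symm, S.D_B huw.symm, S.D_B hvw.symm, S.D_B huw, S.D_B hvw,
      map_add, map_sub, map_smul, smul_add, smul_sub] at ih ⊢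
    rw [ih u v hu hv huv]
    match_scalars <;> first | ring1 | (simp only [hh, gg]; field_simp; ring1)

end BetheData

/-! ### The `RLL` relations in matrix form and for modes -/

/-- The entry `(x, y)` of `R T₁ T₂' - T₂' T₁ R`. -/
def rttEntry {V : Type*} [Ring V] [Algebra ℂ V] (R : Matrix (Fin 2 × Fin 2) (Fin 2 × Fin 2) ℂ)
    (T T' : Fin 2 → Fin 2 → V) (x y : Fin 2 × Fin 2) : V :=
  ∑ z, R x z • (T z.1 y.1 * T' z.2 y.2) - ∑ z, R z y • (T' x.2 z.2 * T x.1 z.1)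

-- The combination u RTop + v RBot is v R(u/v). Each of the sixteen entries of the matrix relation
-- reduces to the quadratic relations just proved. The case u = v is left out because these have
-- poles there.
set_option maxHeartbeats 2000000 in
theorem BetheData.rtt {q : ℂ} {M : Type*} [AddCommGroup M] [Module ℂ M] (S : BetheData q M)
    {T : ℂ → Fin 2 → Fin 2 → Module.End ℂ M}
    (hA : ∀ u, T u 0 0 = S.A u) (hB : ∀ u, T u 0 1 = S.B u)
    (hC : ∀ u, T u 1 0 = S.C u) (hD : ∀ u, T u 1 1 = S.D u) {u v : ℂ} (h : u ≠ v)
    (x y : Fin 2 × Fin 2) :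
    u • rttEntry (RTop q) (T u) (T v) x y + v • rttEntry (RBot q) (T u) (T v) x y = 0 := by
  have e1 := sub_ne_zero.2 h
  have e2 := sub_ne_zero.2 h.symm
  have hq := S.q_ne_zero
  refine LinearMap.ext fun m => ?_
  obtain ⟨x1, x2⟩ := x
  obtain ⟨y1, y2⟩ := y
  fin_cases x1 <;> fin_cases x2 <;> fin_cases y1 <;> fin_cases y2
  all_goals
    simp [rttEntry, Fintype.sum_prod_type, RTop, RBot, ee, Matrix.single_apply, hA, hB, hC, hD]
    try simp only [S.A_A h, S.B_B h, S.C_C u v, S.D_D h, S.A_B h, S.A_B h.symm, S.D_B h,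
      S.D_B h.symm, S.C_A h, S.C_A h.symm, S.C_D h, S.C_D h.symm, S.C_B h, S.C_B h.symm,
      S.A_D h, S.A_D h.symm]
    match_scalars <;> first | ring1 | (simp only [hh, gg]; field_simp; ring1)

/-- Extraction of coefficients from a two-variable identity that holds off the diagonal. -/
theorem coeff_eq_zero_of_offDiag {V : Type*} [AddCommGroup V] [Module ℂ V] {n : ℕ}
    {X Y : ℤ → ℤ → V} (hX : ∀ a b : ℤ, ¬ (0 ≤ a ∧ a ≤ n ∧ 0 ≤ b ∧ b ≤ n) → X a b = 0)
    (hY : ∀ a b : ℤ, ¬ (0 ≤ a ∧ a ≤ n ∧ 0 ≤ b ∧ b ≤ n) → Y a b = 0)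
    (h : ∀ u v : ℂ, u ≠ v →
      u • ∑ s ∈ Finset.range (n + 1), ∑ t ∈ Finset.range (n + 1), (u ^ s * v ^ t) • X s t +
      v • ∑ s ∈ Finset.range (n + 1), ∑ t ∈ Finset.range (n + 1), (u ^ s * v ^ t) • Y s t = 0)
    (a b : ℤ) : X (a - 1) b + Y a (b - 1) = 0 := by
  -- Multiplication by u or v shifts one index by one, so the range grows to n + 2; the extra
  -- boundary terms vanish by `hX` and `hY`.
  have key : ∀ u v : ℂ, u ≠ v → ∑ i ∈ Finset.range (n + 2), u ^ i •
      ∑ j ∈ Finset.range (n + 2), v ^ j • (X ((i : ℤ) - 1) j + Y i ((j : ℤ) - 1)) = 0 := by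
    intro u v huv
    rw [← h u v huv]
    simp only [smul_add, Finset.sum_add_distrib]
    congr 1
    · have h0 : ∑ j ∈ Finset.range (n + 2), v ^ j • X (((0 : ℕ) : ℤ) - 1) j = 0 :=
        Finset.sum_eq_zero fun j _ => by rw [hX _ _ (by omega), smul_zero]
      rw [Finset.sum_range_succ', h0, smul_zero, add_zero]
      conv_rhs => rw [Finset.smul_sum]
      refine Finset.sum_congr rfl fun i _ => ?_
      rw [Finset.sum_range_succ, hX _ _ (by omega), smul_zero, add_zero, Finset.smul_sum,
        Finset.smul_sum]
      refine Finset.sum_congr rfl fun j _ => ?_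
      rw [smul_smul, smul_smul]
      congr 1
      · ring
      · congr 1
        push_cast
        ring
    · have h0 : ∑ j ∈ Finset.range (n + 2), v ^ j • Y ((n + 1 : ℕ) : ℤ) ((j : ℤ) - 1) = 0 :=
        Finset.sum_eq_zero fun j _ => by rw [hY _ _ (by omega), smul_zero]
      rw [Finset.sum_range_succ, h0, smul_zero, add_zero]
      conv_rhs => rw [Finset.smul_sum]
      refine Finset.sum_congr rfl fun i _ => ?_
      rw [Finset.sum_range_succ', hY _ (((0 : ℕ) : ℤ) - 1) (by omega), smul_zero, add_zero,
        Finset.smul_sum, Finset.smul_sum]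
      refine Finset.sum_congr rfl fun j _ => ?_
      rw [smul_smul, smul_smul]
      congr 1
      · ring
      · congr 1
        push_cast
        ring
  by_cases hab : 0 ≤ a ∧ a ≤ n + 1 ∧ 0 ≤ b ∧ b ≤ n + 1
  · obtain ⟨ha, ha', hb, hb'⟩ := hab
    lift a to ℕ using ha
    lift b to ℕ using hb
    refine eq_zero_of_sum_pow_smul (N := n + 2) Set.infinite_univ
      (c := fun j : ℕ => X ((a : ℤ) - 1) j + Y a ((j : ℤ) - 1)) (fun v _ => ?_) (by omega)
    exact eq_zero_of_sum_pow_smul (N := n + 2) (Set.finite_singleton v).infinite_compl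
      (c := fun i : ℕ => ∑ j ∈ Finset.range (n + 2), v ^ j •
        (X ((i : ℤ) - 1) j + Y i ((j : ℤ) - 1))) (fun u hu => key u v hu) (by omega)
  · rw [hX _ _ (by omega), hY _ _ (by omega), add_zero]

/-- Modes indexed by natural numbers, extended by zero to all integers. -/
def extendModes {V : Type*} [Zero V] (T : ℕ → Fin 2 → Fin 2 → V) (a : ℤ) (i j : Fin 2) : V :=
  if 0 ≤ a then T a.toNat i j else 0

theorem rttEntry_sum {V : Type*} [Ring V] [Algebra ℂ V]
    (R : Matrix (Fin 2 × Fin 2) (Fin 2 × Fin 2) ℂ) (T : ℕ → Fin 2 → Fin 2 → V) (N : ℕ) (u v : ℂ)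
    (x y : Fin 2 × Fin 2) :
    rttEntry R (fun i j => ∑ s ∈ Finset.range N, u ^ s • T s i j)
      (fun i j => ∑ s ∈ Finset.range N, v ^ s • T s i j) x y =
    ∑ s ∈ Finset.range N, ∑ t ∈ Finset.range N, (u ^ s * v ^ t) •
      rttEntry R (extendModes T s) (extendModes T t) x y := by
  have e : ∀ s : ℕ, extendModes T (s : ℤ) = T s := fun s => by
    ext i j
    simp [extendModes]
  simp only [rttEntry, e, smul_sub, Finset.sum_sub_distrib]
  congr 1
  · simp only [Finset.sum_mul_sum, smul_mul_smul_comm, Finset.smul_sum]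
    rw [Finset.sum_comm]
    refine Finset.sum_congr rfl fun s _ => ?_
    rw [Finset.sum_comm]
    exact Finset.sum_congr rfl fun t _ => Finset.sum_congr rfl fun z _ => smul_comm _ _ _
  · simp only [Finset.sum_mul_sum, smul_mul_smul_comm, Finset.smul_sum]
    rw [Finset.sum_comm]
    simp_rw [Finset.sum_comm (s := Finset.univ)]
    rw [Finset.sum_comm]
    refine Finset.sum_congr rfl fun s _ => Finset.sum_congr rfl fun t _ =>
      Finset.sum_congr rfl fun z _ => ?_
    rw [smul_comm, mul_comm (v ^ t)]

theorem rtt_modes {V : Type*} [Ring V] [Algebra ℂ V] {q : ℂ} {n : ℕ}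
    {T : ℕ → Fin 2 → Fin 2 → V} (hT : ∀ s, n < s → T s = 0)
    (h : ∀ u v : ℂ, u ≠ v → ∀ x y,
      u • rttEntry (RTop q) (fun i j => ∑ s ∈ Finset.range (n + 1), u ^ s • T s i j)
        (fun i j => ∑ s ∈ Finset.range (n + 1), v ^ s • T s i j) x y +
      v • rttEntry (RBot q) (fun i j => ∑ s ∈ Finset.range (n + 1), u ^ s • T s i j)
        (fun i j => ∑ s ∈ Finset.range (n + 1), v ^ s • T s i j) x y = 0)
    (a b : ℤ) (x y : Fin 2 × Fin 2) :
    rttEntry (RTop q) (extendModes T (a - 1)) (extendModes T b) x y +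
      rttEntry (RBot q) (extendModes T a) (extendModes T (b - 1)) x y = 0 := by
  have hz : ∀ a : ℤ, ¬ (0 ≤ a ∧ a ≤ n) → extendModes T a = 0 := fun a ha => by
    ext i j
    unfold extendModes
    split_ifs with h0
    · rw [hT _ (by omega)]
    · rfl
  have hzero : ∀ (R : Matrix (Fin 2 × Fin 2) (Fin 2 × Fin 2) ℂ) (a b : ℤ),
      ¬ (0 ≤ a ∧ a ≤ n ∧ 0 ≤ b ∧ b ≤ n) →
      rttEntry R (extendModes T a) (extendModes T b) x y = 0 := fun R a b hab => by
    by_cases ha : 0 ≤ a ∧ a ≤ n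
    · rw [hz b (by omega)]
      simp [rttEntry]
    · rw [hz a ha]
      simp [rttEntry]
  refine coeff_eq_zero_of_offDiag (n := n)
    (X := fun a b => rttEntry (RTop q) (extendModes T a) (extendModes T b) x y)
    (Y := fun a b => rttEntry (RBot q) (extendModes T a) (extendModes T b) x y)
    (hzero _) (hzero _) (fun u v huv => ?_) a b
  rw [← rttEntry_sum, ← rttEntry_sum]
  exact h u v huv x y

/-! ### The operators on the space of symmetric polynomials -/

/-- The graded space of symmetric polynomials of degree less than `n` in each variable. -/
abbrev PolySpace (n : ℕ) : Type := ⨁ l : ℕ, symPoly n l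

instance (n : ℕ) : Ring (Module.End ℂ (PolySpace n)) :=
  Module.End.instRing (N₁ := PolySpace n)

/-- The value at a multiset of an element of the graded space. -/
def evM (n : ℕ) (X : Multiset ℂ) : PolySpace n →ₗ[ℂ] ℂ :=
  DirectSum.toModule ℂ ℕ ℂ fun l => evAt n l X

/-- The inclusion of a graded component. -/
abbrev ofPoly (n l : ℕ) : symPoly n l →ₗ[ℂ] PolySpace n :=
  DirectSum.lof ℂ ℕ (fun l => symPoly n l) l

theorem evM_ofPoly {n l : ℕ} (X : Multiset ℂ) (P : symPoly n l) :
    evM n X (ofPoly n l P) = evAt n l X P :=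
  DirectSum.toModule_lof ..

theorem evM_eq {n : ℕ} (X : Multiset ℂ) (m : PolySpace n) :
    evM n X m = evAt n (Multiset.card X) X (m (Multiset.card X)) := by
  induction m using DirectSum.induction_on with
  | zero => simp
  | of l P =>
    refine (evM_ofPoly X P).trans ?_
    by_cases h : Multiset.card X = l
    · subst h
      rw [DirectSum.of_eq_same]
    · rw [evAt_of_ne P h, DirectSum.of_eq_of_ne _ _ _ h, map_zero]
  | add m m' h h' => rw [map_add, h, h', DirectSum.add_apply, map_add]

theorem polySpace_ext {n : ℕ} (E : Finset ℂ) {m m' : PolySpace n}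
    (h : ∀ X : Multiset ℂ, X.Nodup → (∀ x ∈ X, x ∉ E) → evM n X m = evM n X m') : m = m' := by
  refine DFinsupp.ext fun l => evAt_ext E fun X hX hX' hX'' => ?_
  have := h X hX' hX''
  rw [evM_eq, evM_eq] at this
  subst hX
  exact this

theorem end_ext {n : ℕ} {N : Type*} [AddCommMonoid N] [Module ℂ N]
    {f g : PolySpace n →ₗ[ℂ] N}
    (h : ∀ l (P : symPoly n l), f (ofPoly n l P) = g (ofPoly n l P)) : f = g :=
  DirectSum.linearMap_ext _ fun l => LinearMap.ext fun P => h l P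

/-- Coefficients in `u` of a family of operators given on functions of multisets by `K`, which
takes the component of degree `l` to that of degree `k l`. -/
structure Modes (n : ℕ) (K : (Multiset ℂ → ℂ) → ℂ → Multiset ℂ → ℂ) (k : ℕ → ℕ) where
  comp : ℕ → ∀ l, symPoly n l →ₗ[ℂ] symPoly n (k l)
  comp_eq_zero : ∀ s, n < s → comp s = 0
  evAt_comp : ∀ (l : ℕ) (P : symPoly n l) (u : ℂ) (X : Multiset ℂ), Multiset.card X = k l →
    X.Nodup → u ∉ X → evAt n (k l) X (∑ s ∈ Finset.range (n + 1), u ^ s • comp s l P) =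
      K (fun Y => evAt n l Y P) u X

/-- The properties of a family of operators that make it polynomial. -/
structure IsPolyFamily (n : ℕ) (K : (Multiset ℂ → ℂ) → ℂ → Multiset ℂ → ℂ) (k : ℕ → ℕ) :
    Prop where
  add : ∀ φ ψ u X, K (fun Y => φ Y + ψ Y) u X = K φ u X + K ψ u X
  const_mul : ∀ (c : ℂ) φ u X, K (fun Y => c * φ Y) u X = c * K φ u X
  polyOff : ∀ φ, SepPoly n φ → ∀ X : Multiset ℂ, X.Nodup →
    PolyOff (n + 1) X.toFinset fun u => K φ u X
  polyOff_cons : ∀ φ, SepPoly n φ → ∀ (u : ℂ) (X : Multiset ℂ), X.Nodup → u ∉ X →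
    PolyOff n (insert u X.toFinset) fun w => K φ u (w ::ₘ X)
  degree : ∀ (l : ℕ) φ, (∀ Y, Multiset.card Y ≠ l → φ Y = 0) → ∀ u X,
    Multiset.card X ≠ k l → K φ u X = 0

namespace IsPolyFamily

variable {n : ℕ} {K : (Multiset ℂ → ℂ) → ℂ → Multiset ℂ → ℂ} {k : ℕ → ℕ}

theorem nonempty_modes (h : IsPolyFamily n K k) : Nonempty (Modes n K k) := by
  have H := fun l => exists_coeff_linear (n := n) (l := l) (fun P => K fun Y => evAt n l Y P)
    (fun P Q u X => by simp only [map_add]; exact h.add _ _ u X)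
    (fun c P u X => by simp only [map_smul, smul_eq_mul]; exact h.const_mul c _ u X)
    (fun P => h.polyOff _ (sepPoly_evAt P)) (fun P => h.polyOff_cons _ (sepPoly_evAt P)) (k l)
  choose T hT hT' using H
  exact ⟨⟨fun s l => T l s, fun s hs => funext fun l => hT l s hs, hT'⟩⟩

/-- A choice of modes. -/
def modes (h : IsPolyFamily n K k) : Modes n K k := h.nonempty_modes.some

end IsPolyFamily

namespace Modes

variable {n : ℕ} {K : (Multiset ℂ → ℂ) → ℂ → Multiset ℂ → ℂ} {k : ℕ → ℕ} (T : Modes n K k)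

/-- The mode as an operator on the graded space. -/
def op (s : ℕ) : Module.End ℂ (PolySpace n) :=
  DirectSum.toModule ℂ ℕ (PolySpace n) fun l => (ofPoly n (k l)) ∘ₗ (T.comp s l)

theorem op_ofPoly (s l : ℕ) (P : symPoly n l) :
    T.op s (ofPoly n l P) = ofPoly n (k l) (T.comp s l P) :=
  DirectSum.toModule_lof ..

theorem op_eq_zero {s : ℕ} (hs : n < s) : T.op s = 0 := by
  refine end_ext (N := PolySpace n) fun l P => ?_
  rw [op_ofPoly, T.comp_eq_zero s hs]
  simp

/-- The generating function of the modes. -/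
def gen (u : ℂ) : Module.End ℂ (PolySpace n) :=
  ∑ s ∈ Finset.range (n + 1), u ^ s • T.op s

theorem gen_ofPoly (u : ℂ) (l : ℕ) (P : symPoly n l) : T.gen u (ofPoly n l P) =
    ofPoly n (k l) (∑ s ∈ Finset.range (n + 1), u ^ s • T.comp s l P) := by
  simp only [gen, LinearMap.sum_apply, LinearMap.smul_apply, op_ofPoly, map_sum, map_smul]

theorem evM_gen (h : IsPolyFamily n K k) (u : ℂ) (m : PolySpace n) {X : Multiset ℂ}
    (hX : X.Nodup) (hu : u ∉ X) : evM n X (T.gen u m) = K (fun Y => evM n Y m) u X := by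
  induction m using DirectSum.induction_on with
  | zero =>
    have := h.const_mul 0 (fun _ => 0) u X
    simp only [map_zero, zero_mul] at this ⊢
    rw [this]
  | of l P =>
    change evM n X (T.gen u (ofPoly n l P)) = K (fun Y => evM n Y (ofPoly n l P)) u X
    simp only [gen_ofPoly, evM_ofPoly]
    by_cases hc : Multiset.card X = k l
    · exact T.evAt_comp l P u X hc hX hu
    · rw [evAt_of_ne _ hc, h.degree l _ (fun Y hY => evAt_of_ne P hY) u X hc]
  | add m m' h1 h2 => simp only [map_add, h1, h2, h.add]

end Modes

theorem isPolyFamily_opA {n : ℕ} (q : ℂ) {α : ℂ → ℂ} (hα : PolyOff (n + 1) ∅ α) :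
    IsPolyFamily n (fun φ u X => opA q α u φ X) id where
  add φ ψ u X := opA_add q α u φ ψ X
  const_mul c φ u X := opA_const_mul q α u c φ X
  polyOff φ hφ X hX := polyOff_opA q hα hX hφ
  polyOff_cons φ hφ u X hX hu := polyOff_opA_cons q hα hX hu hφ
  degree l φ hφ u X hX := by
    have h1 : ∀ a ∈ X, gg q u a * α a * ((X.erase a).map fun c => hh q c a).prod *
        φ (u ::ₘ X.erase a) = 0 := fun a ha => by
      rw [hφ, mul_zero]
      rw [Multiset.card_cons, Multiset.card_erase_add_one ha]
      exact hX
    unfold opA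
    rw [hφ X hX, sum_map_congr h1]
    simp

theorem isPolyFamily_opB {n : ℕ} {q : ℂ} (hq : q ≠ 0) {α d : ℂ → ℂ}
    (hα : PolyOff (n + 1) ∅ α) (hd : PolyOff (n + 1) ∅ d) :
    IsPolyFamily n (fun φ u X => opB q α d u φ X) (· + 1) where
  add φ ψ u X := opB_add q α d u φ ψ X
  const_mul c φ u X := opB_const_mul q α d u c φ X
  polyOff φ hφ X hX := polyOff_opB hq hα hd hX hφ
  polyOff_cons φ hφ u X hX hu := polyOff_opB_cons hq hα hd hX hu hφ
  degree l φ hφ u X hX := by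
    have h0 : ∀ a ∈ X, φ (X.erase a) = 0 := fun a ha => hφ _ (by
      have := Multiset.card_erase_add_one ha
      omega)
    have h1 : ∀ a ∈ X, ∀ b ∈ X.erase a, φ (u ::ₘ (X.erase a).erase b) = 0 := fun a ha b hb =>
      hφ _ (by
        have := Multiset.card_erase_add_one ha
        rw [Multiset.card_cons, Multiset.card_erase_add_one hb]
        omega)
    have h2 : ∀ a ∈ X, gg q u a * φ (X.erase a) *
        (d u * α a * ((X.erase a).map fun c => hh q u c * hh q c a).prod -
          α u * d a * ((X.erase a).map fun c => hh q a c * hh q c u).prod) = 0 := fun a ha => by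
      rw [h0 a ha]
      ring
    have h3 : ∀ a ∈ X, ((X.erase a).map fun b => gg q u a * gg q u b * d a * α b * hh q a b *
        (((X.erase a).erase b).map fun c => hh q a c * hh q c b).prod *
          φ (u ::ₘ (X.erase a).erase b)).sum = 0 := fun a ha => by
      have h4 : ∀ b ∈ X.erase a, gg q u a * gg q u b * d a * α b * hh q a b *
        (((X.erase a).erase b).map fun c => hh q a c * hh q c b).prod *
          φ (u ::ₘ (X.erase a).erase b) = 0 := fun b hb => by rw [h1 a ha b hb, mul_zero]
      rw [sum_map_congr h4]
      simp
    unfold opB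
    rw [sum_map_congr h2, sum_map_congr h3]
    simp

/-- `Nat.pred` formally sends degree 0 to degree 0. This does no harm: a function supported on the
empty multiset vanishes after an insertion. -/
theorem isPolyFamily_opC (n : ℕ) : IsPolyFamily n (fun φ u X => opC u φ X) Nat.pred where
  add φ ψ u X := rfl
  const_mul c φ u X := rfl
  polyOff φ hφ X hX := (hφ X).mono (by omega) (by simp)
  polyOff_cons φ hφ u X hX hu := (hφ.opC u X).mono le_rfl (by simp)
  degree l φ hφ u X hX := hφ _ (by
    rw [Multiset.card_cons]
    rintro rfl
    exact hX rfl)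

/-- The operators `L₁₁(u), L₁₂(u), L₂₁(u), L₂₂(u)` on the graded space of polynomials. -/
structure OperatorData (n : ℕ) (q : ℂ) (α d : ℂ → ℂ) where
  A : Modes n (fun φ u X => opA q α u φ X) id
  B : Modes n (fun φ u X => opB q α d u φ X) (· + 1)
  C : Modes n (fun φ u X => opC u φ X) Nat.pred
  D : Modes n (fun φ u X => opA q⁻¹ d u φ X) id
  q_ne_zero : q ≠ 0
  hα : PolyOff (n + 1) ∅ α
  hd : PolyOff (n + 1) ∅ d

namespace OperatorData

variable {n : ℕ} {q : ℂ} {α d : ℂ → ℂ} (S : OperatorData n q α d)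

theorem evM_A (u : ℂ) (m : PolySpace n) {X : Multiset ℂ} (hX : X.Nodup) (hu : u ∉ X) :
    evM n X (S.A.gen u m) = opA q α u (fun Y => evM n Y m) X :=
  S.A.evM_gen (isPolyFamily_opA q S.hα) u m hX hu

theorem evM_D (u : ℂ) (m : PolySpace n) {X : Multiset ℂ} (hX : X.Nodup) (hu : u ∉ X) :
    evM n X (S.D.gen u m) = opA q⁻¹ d u (fun Y => evM n Y m) X :=
  S.D.evM_gen (isPolyFamily_opA q⁻¹ S.hd) u m hX hu

theorem evM_B (u : ℂ) (m : PolySpace n) {X : Multiset ℂ} (hX : X.Nodup) (hu : u ∉ X) :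
    evM n X (S.B.gen u m) = opB q α d u (fun Y => evM n Y m) X :=
  S.B.evM_gen (isPolyFamily_opB S.q_ne_zero S.hα S.hd) u m hX hu

theorem evM_C (u : ℂ) (m : PolySpace n) {X : Multiset ℂ} (hX : X.Nodup) (hu : u ∉ X) :
    evM n X (S.C.gen u m) = evM n (u ::ₘ X) m :=
  S.C.evM_gen (isPolyFamily_opC n) u m hX hu

/-- The operator looks at its argument only at multisets without repetitions that avoid w, and there
`S.C.gen w` is insertion of w. -/
theorem opA_evM_C (q' : ℂ) (β : ℂ → ℂ) {u w : ℂ} (m : PolySpace n) {X : Multiset ℂ}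
    (hX : X.Nodup) (hu : u ∉ X) (hw : w ∉ X) (h : u ≠ w) :
    opA q' β u (fun Y => evM n Y (S.C.gen w m)) X =
      opA q' β u (opC w fun Y => evM n Y m) X := by
  refine opA_congr _ _ (S.evM_C w m hX hw) fun a ha => S.evM_C w m ?_ ?_
  · exact Multiset.nodup_cons.2 ⟨fun h => hu (Multiset.mem_of_mem_erase h), hX.erase a⟩
  · rw [Multiset.mem_cons, not_or]
    exact ⟨h.symm, fun h => hw (Multiset.mem_of_mem_erase h)⟩

theorem opB_evM_C {u w : ℂ} (m : PolySpace n) {X : Multiset ℂ}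
    (hX : X.Nodup) (hu : u ∉ X) (hw : w ∉ X) (h : u ≠ w) :
    opB q α d u (fun Y => evM n Y (S.C.gen w m)) X =
      opB q α d u (opC w fun Y => evM n Y m) X := by
  unfold opB
  congr 1
  · refine sum_map_congr fun a ha => ?_
    beta_reduce
    rw [S.evM_C w m (hX.erase a) fun h => hw (Multiset.mem_of_mem_erase h)]
    rfl
  · refine sum_map_congr fun a ha => sum_map_congr fun b hb => ?_
    beta_reduce
    rw [S.evM_C w m]
    · rfl
    · exact Multiset.nodup_cons.2 ⟨fun h => hu (Multiset.mem_of_mem_erase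
        (Multiset.mem_of_mem_erase h)), (hX.erase a).erase b⟩
    · rw [Multiset.mem_cons, not_or]
      exact ⟨h.symm, fun h => hw (Multiset.mem_of_mem_erase (Multiset.mem_of_mem_erase h))⟩

/-- Polynomials are determined by their values off {u, w}, where all operators are given by the
rational formulas; there the relation is `opA_cons`. The relations with D and B follow likewise, the
latter from `opB_cons`. -/
theorem C_A {u w : ℂ} (h : u ≠ w) (m : PolySpace n) : S.C.gen w (S.A.gen u m) =
    hh q w u • S.A.gen u (S.C.gen w m) + gg q u w • S.A.gen w (S.C.gen u m) := by
  refine polySpace_ext {u, w} fun X hX hX' => ?_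
  have hu : u ∉ X := fun h => hX' u h (by simp)
  have hw : w ∉ X := fun h => hX' w h (by simp)
  rw [map_add, map_smul, map_smul, S.evM_C w _ hX hw,
    S.evM_A u _ (Multiset.nodup_cons.2 ⟨hw, hX⟩) (by simpa using ⟨h, hu⟩), S.evM_A u _ hX hu,
    S.evM_A w _ hX hw, opA_cons q α _ hw hu h, S.opA_evM_C q α m hX hu hw h,
    S.opA_evM_C q α m hX hw hu h.symm, smul_eq_mul, smul_eq_mul]

theorem C_D {u w : ℂ} (h : u ≠ w) (m : PolySpace n) : S.C.gen w (S.D.gen u m) =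
    hh q u w • S.D.gen u (S.C.gen w m) - gg q u w • S.D.gen w (S.C.gen u m) := by
  refine polySpace_ext {u, w} fun X hX hX' => ?_
  have hu : u ∉ X := fun h => hX' u h (by simp)
  have hw : w ∉ X := fun h => hX' w h (by simp)
  rw [map_sub, map_smul, map_smul, S.evM_C w _ hX hw,
    S.evM_D u _ (Multiset.nodup_cons.2 ⟨hw, hX⟩) (by simpa using ⟨h, hu⟩), S.evM_D u _ hX hu,
    S.evM_D w _ hX hw, opA_cons q⁻¹ d _ hw hu h, S.opA_evM_C q⁻¹ d m hX hu hw h,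
    S.opA_evM_C q⁻¹ d m hX hw hu h.symm, hh_inv, gg_inv, smul_eq_mul, smul_eq_mul]
  ring

theorem opA_evM_A {u w : ℂ} (m : PolySpace n) {X : Multiset ℂ}
    (hX : X.Nodup) (hu : u ∉ X) (hw : w ∉ X) (h : u ≠ w) :
    opA q⁻¹ d u (fun Y => evM n Y (S.A.gen w m)) X =
      opA q⁻¹ d u (opA q α w fun Y => evM n Y m) X := by
  refine opA_congr _ _ (S.evM_A w m hX hw) fun a ha => S.evM_A w m ?_ ?_
  · exact Multiset.nodup_cons.2 ⟨fun h => hu (Multiset.mem_of_mem_erase h), hX.erase a⟩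
  · rw [Multiset.mem_cons, not_or]
    exact ⟨h.symm, fun h => hw (Multiset.mem_of_mem_erase h)⟩

theorem C_B {u w : ℂ} (h : u ≠ w) (m : PolySpace n) : S.C.gen w (S.B.gen u m) =
    S.B.gen u (S.C.gen w m) +
      gg q u w • (S.D.gen u (S.A.gen w m) - S.D.gen w (S.A.gen u m)) := by
  refine polySpace_ext {u, w} fun X hX hX' => ?_
  have hu : u ∉ X := fun h => hX' u h (by simp)
  have hw : w ∉ X := fun h => hX' w h (by simp)
  rw [map_add, map_smul, map_sub, S.evM_C w _ hX hw,
    S.evM_B u _ (Multiset.nodup_cons.2 ⟨hw, hX⟩) (by simpa using ⟨h, hu⟩), S.evM_B u _ hX hu,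
    S.evM_D u _ hX hu, S.evM_D w _ hX hw, opB_cons S.q_ne_zero α d _ hw hu h,
    S.opB_evM_C m hX hu hw h, S.opA_evM_A m hX hu hw h, S.opA_evM_A m hX hw hu h.symm,
    smul_eq_mul]

/-- The commutation relations with `C`, bundled. -/
def betheData : BetheData q (PolySpace n) where
  ev X := evM n X
  A := S.A.gen
  B := S.B.gen
  C := S.C.gen
  D := S.D.gen
  α := α
  d := d
  q_ne_zero := S.q_ne_zero
  ev_ext E m m' h := polySpace_ext E h
  ev_C u X m hX hu := S.evM_C u m hX hu
  ev_A u m := by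
    rw [S.evM_A u m Multiset.nodup_zero (Multiset.notMem_zero u), opA_zero]
  ev_D u m := by
    rw [S.evM_D u m Multiset.nodup_zero (Multiset.notMem_zero u), opA_zero]
  ev_B u m := by
    rw [S.evM_B u m Multiset.nodup_zero (Multiset.notMem_zero u), opB_zero]
  C_A h m := S.C_A h m
  C_D h m := S.C_D h m
  C_B h m := S.C_B h m

/-- The modes as a matrix. -/
def mode (s : ℕ) (i j : Fin 2) : Module.End ℂ (PolySpace n) :=
  if i = 0 then (if j = 0 then S.A.op s else S.B.op s)
  else (if j = 0 then S.C.op s else S.D.op s)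

theorem mode_eq_zero {s : ℕ} (hs : n < s) : S.mode s = 0 := by
  ext i j : 2
  simp [mode, Modes.op_eq_zero _ hs]

theorem rtt_mode (a b : ℤ) (x y : Fin 2 × Fin 2) :
    rttEntry (RTop q) (extendModes S.mode (a - 1)) (extendModes S.mode b) x y +
      rttEntry (RBot q) (extendModes S.mode a) (extendModes S.mode (b - 1)) x y = 0 :=
  rtt_modes (fun _ hs => S.mode_eq_zero hs) (fun _ _ h x y => S.betheData.rtt
    (T := fun u i j => ∑ s ∈ Finset.range (n + 1), u ^ s • S.mode s i j)
    (fun _ => rfl) (fun _ => rfl) (fun _ => rfl) (fun _ => rfl) h x y) a b x y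

end OperatorData

theorem nonempty_operatorData {n : ℕ} {q : ℂ} (hq : q ≠ 0) {α d : ℂ → ℂ}
    (hα : PolyOff (n + 1) ∅ α) (hd : PolyOff (n + 1) ∅ d) :
    Nonempty (OperatorData n q α d) :=
  ⟨⟨(isPolyFamily_opA q hα).modes, (isPolyFamily_opB hq hα hd).modes, (isPolyFamily_opC n).modes,
    (isPolyFamily_opA q⁻¹ hd).modes, hq, hα, hd⟩⟩

/-! ### Trigonometric functions in exponential form -/

theorem qpow_add (p x y : ℂ) : qpow p (x + y) = qpow p x * qpow p y := by
  rw [qpow, qpow, qpow, ← Complex.exp_add]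
  congr 1
  ring

theorem qpow_zero (p : ℂ) : qpow p 0 = 1 := by simp [qpow]

theorem qpow_ne_zero (p x : ℂ) : qpow p x ≠ 0 := Complex.exp_ne_zero _

theorem qpow_neg (p x : ℂ) : qpow p (-x) = (qpow p x)⁻¹ := by
  rw [qpow, qpow, ← Complex.exp_neg]
  congr 1
  ring

theorem qpow_sub (p x y : ℂ) : qpow p (x - y) = qpow p x * (qpow p y)⁻¹ := by
  rw [sub_eq_add_neg, qpow_add, qpow_neg]

theorem qpow_two_mul (p x : ℂ) : qpow p (2 * x) = qpow p x * qpow p x := by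
  rw [two_mul, qpow_add]

theorem qpow_sum {ι : Type*} (p : ℂ) (s : Finset ι) (f : ι → ℂ) :
    qpow p (∑ i ∈ s, f i) = ∏ i ∈ s, qpow p (f i) := by
  classical
  induction s using Finset.induction_on with
  | empty => simp [qpow_zero]
  | insert i s h ih => rw [Finset.sum_insert h, Finset.prod_insert h, qpow_add, ih]

theorem qpow_nat_mul (p x : ℂ) (m : ℕ) : qpow p (m * x) = qpow p x ^ m := by
  rw [qpow, qpow, ← Complex.exp_nat_mul]
  congr 1
  ring

theorem sn_eq (p x : ℂ) : sn p x = (qpow p x - (qpow p x)⁻¹) / (2 * Complex.I) := by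
  rw [← qpow_neg, sn, Complex.sin, qpow, qpow]
  have e1 : -(Real.pi * x / p) * Complex.I = Real.pi * Complex.I * (-x) / p := by ring
  have e2 : (Real.pi * x / p) * Complex.I = Real.pi * Complex.I * x / p := by ring
  rw [e1, e2]
  field_simp
  rw [Complex.I_sq]
  ring

theorem sn_neg (p x : ℂ) : sn p (-x) = -sn p x := by
  rw [sn, sn, ← Complex.sin_neg]
  congr 1
  ring

theorem sn_sub_comm (p x y : ℂ) : sn p (x - y) = -sn p (y - x) := by
  rw [← sn_neg, neg_sub]

theorem qpow_two_sub (p x y : ℂ) : qpow p (2 * x) - qpow p (2 * y) =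
    2 * Complex.I * qpow p (x + y) * sn p (x - y) := by
  have h1 := qpow_ne_zero p x
  have h2 := qpow_ne_zero p y
  rw [sn_eq, qpow_two_mul, qpow_two_mul, qpow_add, qpow_sub]
  field_simp

theorem sn_sub_eq_zero_iff (p x y : ℂ) :
    sn p (x - y) = 0 ↔ qpow p (2 * x) = qpow p (2 * y) := by
  rw [← sub_eq_zero (a := qpow p (2 * x)), qpow_two_sub]
  simp [qpow_ne_zero]

theorem sn_eq_zero_iff {p : ℂ} (hp : p ≠ 0) (x : ℂ) : sn p x = 0 ↔ ∃ m : ℤ, x = p * m := by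
  rw [sn, Complex.sin_eq_zero_iff]
  have hpi : (Real.pi : ℂ) ≠ 0 := by exact_mod_cast Real.pi_ne_zero
  refine exists_congr fun m => ?_
  rw [div_eq_iff hp]
  constructor
  · intro h
    refine mul_left_cancel₀ hpi ?_
    linear_combination h
  · rintro rfl
    ring

/-- A zero would give j = p m with an integer m ≠ 0, making p rational. -/
theorem sn_int_ne_zero {p : ℂ} (hp : ∀ r : ℚ, p ≠ (r : ℂ)) {j : ℤ} (hj : j ≠ 0) :
    sn p j ≠ 0 := by
  have hp0 : p ≠ 0 := by simpa using hp 0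
  rw [Ne, sn_eq_zero_iff hp0]
  rintro ⟨m, hm⟩
  have hm0 : (m : ℂ) ≠ 0 := by
    rintro h
    rw [h, mul_zero] at hm
    exact hj (by exact_mod_cast hm)
  refine hp (j / m) ?_
  push_cast
  rw [eq_div_iff hm0, hm]

theorem exists_qpow_two_mul {p : ℂ} (hp : p ≠ 0) {w : ℂ} (hw : w ≠ 0) :
    ∃ t, qpow p (2 * t) = w := by
  have hpi : (Real.pi : ℂ) ≠ 0 := by exact_mod_cast Real.pi_ne_zero
  refine ⟨p * Complex.log w / (2 * Real.pi * Complex.I), ?_⟩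
  conv_rhs => rw [← Complex.exp_log hw]
  rw [qpow]
  congr 1
  field_simp [Complex.I_ne_zero]

/-- Numerator and denominator share the factor 2i q^(u+t). With `hh_qpow'` and `gg_qpow` this is the
dictionary between the trigonometric and the rational formulas. -/
theorem hh_qpow (p u t : ℂ) : hh (qpow p 1) (qpow p (2 * u)) (qpow p (2 * t)) =
    sn p (u - t + 1) / sn p (u - t) := by
  have h : qpow p 1 * qpow p (2 * u) - (qpow p 1)⁻¹ * qpow p (2 * t) =
      2 * Complex.I * qpow p (u + t) * sn p (u - t + 1) := by
    have h1 := qpow_ne_zero p u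
    have h2 := qpow_ne_zero p t
    have h3 := qpow_ne_zero p 1
    rw [sn_eq, qpow_two_mul, qpow_two_mul, qpow_add, qpow_add, qpow_sub]
    field_simp
  rw [hh, h, qpow_two_sub, mul_div_mul_left]
  simp [qpow_ne_zero]

theorem hh_qpow' (p u t : ℂ) : hh (qpow p 1) (qpow p (2 * t)) (qpow p (2 * u)) =
    sn p (u - t - 1) / sn p (u - t) := by
  rw [hh_qpow, sn_sub_comm p t u, show t - u + 1 = -(u - t - 1) by ring, sn_neg, neg_div_neg_eq]

theorem gg_qpow (p u t : ℂ) : gg (qpow p 1) (qpow p (2 * u)) (qpow p (2 * t)) =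
    sn p 1 * qpow p (u - t) / sn p (u - t) := by
  have h : (qpow p 1 - (qpow p 1)⁻¹) * qpow p (2 * u) =
      2 * Complex.I * qpow p (u + t) * (sn p 1 * qpow p (u - t)) := by
    have h1 := qpow_ne_zero p u
    have h2 := qpow_ne_zero p t
    have h3 := qpow_ne_zero p 1
    rw [sn_eq, qpow_two_mul, qpow_add, qpow_sub]
    field_simp
  rw [gg, h, qpow_two_sub, mul_div_mul_left]
  simp [qpow_ne_zero]

/-- The polynomial `∏_a (q^(-λ_a) - q^(λ_a - 2 z_a) x)`. -/
def alp (p : ℂ) {n : ℕ} (z lam : Fin n → ℂ) (x : ℂ) : ℂ :=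
  ∏ a, (qpow p (-lam a) - qpow p (lam a - 2 * z a) * x)

theorem alp_qpow (p : ℂ) {n : ℕ} (z lam : Fin n → ℂ) (x : ℂ) : alp p z lam (qpow p (2 * x)) =
    ∏ a, (-2 * Complex.I * qpow p (x - z a) * sn p (x - z a + lam a)) := by
  refine Finset.prod_congr rfl fun a _ => ?_
  have h1 := qpow_ne_zero p x
  have h2 := qpow_ne_zero p (z a)
  have h3 := qpow_ne_zero p (lam a)
  rw [sn_eq, qpow_two_mul, qpow_add, qpow_sub, qpow_neg, qpow_sub, qpow_two_mul]
  field_simp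
  ring

theorem alp_neg_qpow (p : ℂ) {n : ℕ} (z lam : Fin n → ℂ) (x : ℂ) :
    alp p z (-lam) (qpow p (2 * x)) =
      ∏ a, (-2 * Complex.I * qpow p (x - z a) * sn p (x - z a - lam a)) := by
  simp only [alp_qpow, Pi.neg_apply, ← sub_eq_add_neg]

theorem ratio_eq (p : ℂ) {n : ℕ} (z lam : Fin n → ℂ) (x : ℂ) :
    ratio p z lam x = alp p z lam (qpow p (2 * x)) / alp p z (-lam) (qpow p (2 * x)) := by
  rw [alp_qpow, alp_neg_qpow, ← Finset.prod_div_distrib]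
  refine Finset.prod_congr rfl fun a _ => ?_
  rw [mul_div_mul_left]
  simp [qpow_ne_zero]

theorem prefactor_one (p : ℂ) {n : ℕ} (z lam : Fin n → ℂ) (u : ℂ) :
    prefactor p z lam 1 u = (alp p z (-lam) (qpow p (2 * u)))⁻¹ := by
  rw [alp_neg_qpow, prefactor, ← Finset.prod_inv_distrib]
  refine Finset.prod_congr rfl fun a _ => ?_
  rw [Units.val_one, Int.cast_one, one_mul, one_mul, ← neg_sub u, qpow_neg]
  by_cases h : sn p (u - z a - lam a) = 0
  · simp [h]
  · have h1 := qpow_ne_zero p (u - z a)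
    field_simp
    rw [Complex.I_sq]

/-- The two prefactors differ by a monomial of degree n in ξ. Therefore L⁻ is a constant times ξ⁻ⁿ
times the polynomial family that gives L⁺. -/
theorem prefactor_neg_one (p : ℂ) {n : ℕ} (z lam : Fin n → ℂ) (u : ℂ) :
    prefactor p z lam (-1) u = (alp p z (-lam) (qpow p (2 * u)))⁻¹ *
      ((-1) ^ n * qpow p (-2 * ∑ a, z a) * qpow p (2 * u) ^ n) := by
  rw [← prefactor_one, prefactor, prefactor, Finset.mul_sum, qpow_sum]
  have e : ((-1 : ℂ)) ^ n * (∏ a, qpow p (-2 * z a)) * qpow p (2 * u) ^ n =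
      ∏ a : Fin n, (-1 * qpow p (-2 * z a) * qpow p (2 * u)) := by
    rw [Finset.prod_mul_distrib, Finset.prod_mul_distrib]
    simp only [Finset.prod_const, Finset.card_univ, Fintype.card_fin]
  rw [e, ← Finset.prod_mul_distrib]
  refine Finset.prod_congr rfl fun a _ => ?_
  have h1 := qpow_ne_zero p u
  have h2 := qpow_ne_zero p (z a)
  simp only [Units.val_neg, Units.val_one, Int.cast_neg, Int.cast_one, neg_mul, one_mul, neg_sub,
    qpow_sub, qpow_neg, qpow_two_mul]
  field_simp

theorem weight_eq (p : ℂ) {n : ℕ} (z lam : Fin n → ℂ) (l : ℕ) (t : Fin l → ℂ) :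
    weight p z lam l t = ((-2 * Complex.I) ^ n) ^ l *
      ((∏ b, (alp p z (-lam) (qpow p (2 * t b)))⁻¹) *
      ∏ a : Fin l, ∏ b : Fin l, if a < b then
        (hh (qpow p 1) (qpow p (2 * t a)) (qpow p (2 * t b)))⁻¹ else 1) := by
  simp only [hh_qpow, inv_div]
  rw [weight, ← mul_assoc, Finset.prod_comm]
  congr 1
  have e : ((-2 * Complex.I) ^ n) ^ l = ∏ b : Fin l, ∏ a : Fin n, (-2 * Complex.I) := by
    simp [Finset.prod_const]
  rw [e, ← Finset.prod_mul_distrib]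
  refine Finset.prod_congr rfl fun b _ => ?_
  rw [alp_neg_qpow, ← Finset.prod_inv_distrib, ← Finset.prod_mul_distrib]
  refine Finset.prod_congr rfl fun a _ => ?_
  by_cases h : sn p (t b - z a - lam a) = 0
  · simp [h]
  · have h1 := qpow_ne_zero p (t b)
    have h2 := qpow_ne_zero p (z a)
    rw [qpow_sub, qpow_sub]
    field_simp

/-! ### The weight function and the action formulas in rational form -/

/-- `∏_{a<b} (x_a - x_b) / (q x_a - q⁻¹ x_b)`. -/
def om (q : ℂ) {l : ℕ} (x : Fin l → ℂ) : ℂ :=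
  ∏ a : Fin l, ∏ b : Fin l, if a < b then (hh q (x a) (x b))⁻¹ else 1

theorem om_cons (q : ℂ) {l : ℕ} (v : ℂ) (x : Fin l → ℂ) :
    om q (Fin.cons v x : Fin (l + 1) → ℂ) = (∏ c, hh q v (x c))⁻¹ * om q x := by
  rw [om, Fin.prod_univ_succ, Fin.prod_univ_succ, om, ← Finset.prod_inv_distrib]
  simp [Fin.prod_univ_succ]

theorem om_snoc (q : ℂ) {l : ℕ} (v : ℂ) (x : Fin l → ℂ) :
    om q (Fin.snoc x v : Fin (l + 1) → ℂ) = om q x * (∏ c, hh q (x c) v)⁻¹ := by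
  rw [om, Fin.prod_univ_castSucc, om, ← Finset.prod_inv_distrib, ← Finset.prod_mul_distrib]
  simp only [Fin.prod_univ_castSucc, Fin.snoc_castSucc, Fin.snoc_last, Fin.castSucc_lt_castSucc_iff,
    Fin.castSucc_lt_last, if_true, lt_irrefl, if_false]
  simp [not_lt_of_gt (Fin.castSucc_lt_last _)]

/-- Grouping the factors by unordered pairs allows `om` to be compared with its reindexing by a
permutation, pair by pair. -/
theorem prod_prod_eq_prod_lt {l : ℕ} (F : Fin l → Fin l → ℂ) (hF : ∀ i, F i i = 1) :
    ∏ i, ∏ j, F i j = ∏ i, ∏ j, if i < j then F i j * F j i else 1 := by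
  have e : ∏ i : Fin l, ∏ j : Fin l, (if i < j then F i j * F j i else 1) =
      (∏ i, ∏ j, if i < j then F i j else 1) * ∏ i, ∏ j, if j < i then F i j else 1 := by
    rw [Finset.prod_comm (f := fun i j => if j < i then F i j else 1)]
    simp only [← Finset.prod_mul_distrib]
    refine Finset.prod_congr rfl fun i _ => Finset.prod_congr rfl fun j _ => ?_
    split_ifs <;> simp
  rw [e]
  simp only [← Finset.prod_mul_distrib]
  refine Finset.prod_congr rfl fun i _ => Finset.prod_congr rfl fun j _ => ?_
  rcases lt_trichotomy i j with h | h | h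
  · simp [h, h.not_gt]
  · subst h
    simp [hF]
  · simp [h, h.not_gt]

/-- The points `q ^ (2 t_a)`. -/
def pts (p : ℂ) {l : ℕ} (t : Fin l → ℂ) : Fin l → ℂ := fun a => qpow p (2 * t a)

/-- No difference `t_a - t_b`, `a ≠ b`, lies in `ℤ + pℤ`. -/
def Apart (p : ℂ) {l : ℕ} (t : Fin l → ℂ) : Prop :=
  ∀ a b : Fin l, a ≠ b → ∀ j : ℤ, sn p (t a - t b + j) ≠ 0

namespace Apart

variable {p : ℂ} {l : ℕ} {t : Fin l → ℂ}

theorem sn_ne_zero (h : Apart p t) {a b : Fin l} (hab : a ≠ b) : sn p (t a - t b) ≠ 0 := by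
  simpa using h a b hab 0

theorem hh_ne_zero (h : Apart p t) {a b : Fin l} (hab : a ≠ b) :
    hh (qpow p 1) (pts p t a) (pts p t b) ≠ 0 := by
  rw [pts, pts, hh_qpow]
  exact div_ne_zero (by simpa using h a b hab 1) (h.sn_ne_zero hab)

theorem om_ne_zero (h : Apart p t) : om (qpow p 1) (pts p t) ≠ 0 := by
  refine Finset.prod_ne_zero_iff.2 fun a _ => Finset.prod_ne_zero_iff.2 fun b _ => ?_
  split_ifs with hab
  · exact inv_ne_zero (h.hh_ne_zero hab.ne)
  · exact one_ne_zero

theorem comp (h : Apart p t) {m : ℕ} {σ : Fin m → Fin l} (hσ : Function.Injective σ) :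
    Apart p (t ∘ σ) := fun _ _ hab j => h _ _ (hσ.ne hab) j

theorem injective (h : Apart p t) : Function.Injective (pts p t) := fun a b hab => by
  by_contra hne
  exact h.sn_ne_zero hne ((sn_sub_eq_zero_iff p _ _).2 hab)

/-- The factor attached to an inversion is the quotient of the corresponding factors of `om` at t
and at t ∘ σ; pairs that are not inverted contribute equally to both. So the twisted action is plain
permutation conjugated by `om`. -/
theorem bracket_mul (h : Apart p t) (σ : Equiv.Perm (Fin l)) (f : (Fin l → ℂ) → ℂ) :
    bracket p σ f t * om (qpow p 1) (pts p (t ∘ σ)) =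
      f (t ∘ σ) * om (qpow p 1) (pts p t) := by
  have e1 : om (qpow p 1) (pts p t) = ∏ i : Fin l, ∏ j : Fin l, if σ i < σ j then
      (hh (qpow p 1) (pts p t (σ i)) (pts p t (σ j)))⁻¹ else 1 := by
    rw [om, ← Equiv.prod_comp σ]
    exact Finset.prod_congr rfl fun i _ => (Equiv.prod_comp σ _).symm
  rw [prod_prod_eq_prod_lt _ (by simp)] at e1
  rw [bracket, mul_assoc, e1, om, ← Finset.prod_mul_distrib]
  change f (t ∘ σ) * _ = _
  congr 1
  refine Finset.prod_congr rfl fun i _ => ?_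
  rw [← Finset.prod_mul_distrib]
  refine Finset.prod_congr rfl fun j _ => ?_
  by_cases hij : i < j
  · have hne : σ i ≠ σ j := σ.injective.ne hij.ne
    rcases hne.lt_or_gt with hlt | hgt
    · simp [hij, hlt, hlt.not_gt, pts]
    · simp only [hij, hgt, hgt.not_gt, if_true, if_false, pts, Function.comp, and_self]
      have h1 := h.sn_ne_zero hne
      have h2 := h.sn_ne_zero hne.symm
      have h3 := h _ _ hne 1
      have h4 := h _ _ hne.symm 1
      have h5 := h _ _ hne.symm (-1)
      push_cast at h3 h4 h5
      rw [← sub_eq_add_neg] at h5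
      rw [one_mul, hh_qpow' p (t (σ j)), hh_qpow p (t (σ j)), inv_div, inv_div]
      field_simp
  · simp [hij]

/-- The bracket multiplies the weight by the permuted function. -/
theorem bracket_eq (h : Apart p t) (σ : Equiv.Perm (Fin l)) {f : (Fin l → ℂ) → ℂ} {c : ℂ}
    (hf : f (t ∘ σ) = c * om (qpow p 1) (pts p (t ∘ σ))) :
    bracket p σ f t = c * om (qpow p 1) (pts p t) := by
  refine mul_right_cancel₀ (h.comp σ.injective).om_ne_zero ?_
  rw [h.bracket_mul, hf]
  ring

end Apart

theorem coe_ofFn_cons {l : ℕ} (v : ℂ) (x : Fin l → ℂ) :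
    (List.ofFn (Fin.cons v x : Fin (l + 1) → ℂ) : Multiset ℂ) = v ::ₘ (List.ofFn x : Multiset ℂ) := by
  rw [List.ofFn_cons]
  rfl

theorem coe_ofFn_comp {l : ℕ} (x : Fin l → ℂ) (σ : Equiv.Perm (Fin l)) :
    (List.ofFn (x ∘ σ) : Multiset ℂ) = List.ofFn x :=
  Multiset.coe_eq_coe.2 (Equiv.Perm.ofFn_comp_perm σ x)

theorem coe_ofFn_snoc {l : ℕ} (v : ℂ) (x : Fin l → ℂ) :
    (List.ofFn (Fin.snoc x v : Fin (l + 1) → ℂ) : Multiset ℂ) =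
      v ::ₘ (List.ofFn x : Multiset ℂ) := by
  rw [List.ofFn_succ']
  simp [List.concat_eq_append, ← Multiset.coe_add, add_comm, ← Multiset.singleton_add]

theorem sum_map_ofFn {l : ℕ} (x : Fin l → ℂ) (F : ℂ → ℂ) :
    ((List.ofFn x : Multiset ℂ).map F).sum = ∑ a, F (x a) := by
  rw [Multiset.map_coe, Multiset.sum_coe, List.map_ofFn, List.sum_ofFn]
  rfl

theorem prod_map_ofFn {l : ℕ} (x : Fin l → ℂ) (F : ℂ → ℂ) :
    ((List.ofFn x : Multiset ℂ).map F).prod = ∏ a, F (x a) := by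
  rw [Multiset.map_coe, Multiset.prod_coe, List.map_ofFn, List.prod_ofFn]
  rfl

/-- A symmetric function, multiplied by the weight. -/
def wtd (q : ℂ) (d : ℂ → ℂ) (φ : Multiset ℂ → ℂ) {l : ℕ} (x : Fin l → ℂ) : ℂ :=
  φ (List.ofFn x) * ((((List.ofFn x : Multiset ℂ).map d).prod)⁻¹ * om q x)

theorem wtd_cons (q : ℂ) (d : ℂ → ℂ) (φ : Multiset ℂ → ℂ) {l : ℕ} (v : ℂ) (x : Fin l → ℂ) :
    wtd q d φ (Fin.cons v x : Fin (l + 1) → ℂ) =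
      φ (v ::ₘ (List.ofFn x : Multiset ℂ)) * ((d v)⁻¹ *
        (((List.ofFn x : Multiset ℂ).map d).prod)⁻¹ *
          (((List.ofFn x : Multiset ℂ).map fun c => hh q v c).prod)⁻¹ * om q x) := by
  rw [wtd, coe_ofFn_cons, om_cons, Multiset.map_cons, Multiset.prod_cons, mul_inv, prod_map_ofFn,
    prod_map_ofFn]
  ring

theorem wtd_snoc (q : ℂ) (d : ℂ → ℂ) (φ : Multiset ℂ → ℂ) {l : ℕ} (v : ℂ) (x : Fin l → ℂ) :
    wtd q d φ (Fin.snoc x v : Fin (l + 1) → ℂ) =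
      φ (v ::ₘ (List.ofFn x : Multiset ℂ)) * ((d v)⁻¹ *
        (((List.ofFn x : Multiset ℂ).map d).prod)⁻¹ *
          (((List.ofFn x : Multiset ℂ).map fun c => hh q c v).prod)⁻¹ * om q x) := by
  rw [wtd, coe_ofFn_snoc, om_snoc, Multiset.map_cons, Multiset.prod_cons, mul_inv, prod_map_ofFn,
    prod_map_ofFn]
  ring

/-- The point `u` keeps a distance from the coordinates of `t`. -/
def Away (p : ℂ) {l : ℕ} (t : Fin l → ℂ) (u : ℂ) : Prop :=
  ∀ a, sn p (u - t a) ≠ 0 ∧ sn p (u - t a - 1) ≠ 0 ∧ sn p (u - t a + 1) ≠ 0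

theorem pts_cons (p : ℂ) {l : ℕ} (v : ℂ) (s : Fin l → ℂ) :
    pts p (Fin.cons v s : Fin (l + 1) → ℂ) = Fin.cons (qpow p (2 * v)) (pts p s) := by
  funext a
  refine Fin.cases ?_ (fun a => ?_) a <;> simp [pts]

theorem pts_snoc (p : ℂ) {l : ℕ} (v : ℂ) (s : Fin l → ℂ) :
    pts p (Fin.snoc s v : Fin (l + 1) → ℂ) = Fin.snoc (pts p s) (qpow p (2 * v)) := by
  funext a
  refine Fin.lastCases ?_ (fun a => ?_) a <;> simp [pts]

theorem Away.comp {p : ℂ} {l m : ℕ} {t : Fin l → ℂ} {u : ℂ} (h : Away p t u) (σ : Fin m → Fin l) :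
    Away p (t ∘ σ) u := fun a => h (σ a)

theorem Away.prod_hh_ne_zero {p : ℂ} {l : ℕ} {t : Fin l → ℂ} {u : ℂ} (h : Away p t u) :
    ((List.ofFn (pts p t) : Multiset ℂ).map fun c => hh (qpow p 1) (qpow p (2 * u)) c).prod ≠ 0 ∧
    ((List.ofFn (pts p t) : Multiset ℂ).map fun c => hh (qpow p 1) c (qpow p (2 * u))).prod ≠ 0 := by
  rw [prod_map_ofFn, prod_map_ofFn]
  refine ⟨Finset.prod_ne_zero_iff.2 fun a _ => ?_, Finset.prod_ne_zero_iff.2 fun a _ => ?_⟩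
  · rw [pts, hh_qpow]
    exact div_ne_zero (h a).2.2 (h a).1
  · rw [pts, hh_qpow']
    exact div_ne_zero (h a).2.1 (h a).1

theorem Apart.away_of_snoc {p : ℂ} {l : ℕ} {t : Fin l → ℂ} {v : ℂ}
    (h : Apart p (Fin.snoc t v : Fin (l + 1) → ℂ)) : Away p t v := fun a => by
  have := h (Fin.last l) a.castSucc a.castSucc_lt_last.ne'
  simp only [Fin.snoc_last, Fin.snoc_castSucc] at this
  exact ⟨by simpa using this 0, by simpa [sub_eq_add_neg] using this (-1), by simpa using this 1⟩

theorem Apart.away_of_cons {p : ℂ} {l : ℕ} {t : Fin l → ℂ} {v : ℂ}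
    (h : Apart p (Fin.cons v t : Fin (l + 1) → ℂ)) : Away p t v := fun a => by
  have := h 0 a.succ a.succ_ne_zero.symm
  simp only [Fin.cons_zero, Fin.cons_succ] at this
  exact ⟨by simpa using this 0, by simpa [sub_eq_add_neg] using this (-1), by simpa using this 1⟩

/-- Splits t_a off as the last variable, as needed for L₁₁; `exists_cons` does the same at the front
for L₂₂ and L₁₂. -/
theorem Apart.exists_snoc {p : ℂ} {l : ℕ} {t : Fin (l + 1) → ℂ} (h : Apart p t)
    (σ : Equiv.Perm (Fin (l + 1))) {a : Fin (l + 1)} (hσ : σ (Fin.last l) = a) :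
    ∃ s : Fin l → ℂ, t ∘ σ = Fin.snoc s (t a) ∧ Apart p s ∧ Away p s (t a) ∧
      (List.ofFn (pts p t) : Multiset ℂ) = qpow p (2 * t a) ::ₘ (List.ofFn (pts p s) : Multiset ℂ) ∧
      ∀ u, Away p t u → Away p s u := by
  have e : t ∘ σ = Fin.snoc (t ∘ σ ∘ Fin.castSucc) (t a) := by
    funext i
    refine Fin.lastCases ?_ (fun i => ?_) i <;> simp [hσ]
  have h' := h.comp σ.injective
  refine ⟨t ∘ σ ∘ Fin.castSucc, e, h.comp (σ.injective.comp (Fin.castSucc_injective l)), ?_, ?_,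
    fun u hu => hu.comp _⟩
  · rw [e] at h'
    exact h'.away_of_snoc
  · rw [← coe_ofFn_comp (pts p t) σ]
    change (List.ofFn (pts p (t ∘ σ)) : Multiset ℂ) = _
    rw [e, pts_snoc, coe_ofFn_snoc]

theorem Apart.exists_cons {p : ℂ} {l : ℕ} {t : Fin (l + 1) → ℂ} (h : Apart p t)
    (σ : Equiv.Perm (Fin (l + 1))) {a : Fin (l + 1)} (hσ : σ 0 = a) :
    ∃ s : Fin l → ℂ, t ∘ σ = Fin.cons (t a) s ∧ Apart p s ∧ Away p s (t a) ∧
      (List.ofFn (pts p t) : Multiset ℂ) = qpow p (2 * t a) ::ₘ (List.ofFn (pts p s) : Multiset ℂ) ∧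
      ∀ u, Away p t u → Away p s u := by
  have e : t ∘ σ = Fin.cons (t a) (t ∘ σ ∘ Fin.succ) := by
    funext i
    refine Fin.cases ?_ (fun i => ?_) i <;> simp [hσ]
  have h' := h.comp σ.injective
  refine ⟨t ∘ σ ∘ Fin.succ, e, h.comp (σ.injective.comp (Fin.succ_injective l)), ?_, ?_,
    fun u hu => hu.comp _⟩
  · rw [e] at h'
    exact h'.away_of_cons
  · rw [← coe_ofFn_comp (pts p t) σ]
    change (List.ofFn (pts p (t ∘ σ)) : Multiset ℂ) = _
    rw [e, pts_cons, coe_ofFn_cons]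

section Action

variable {p : ℂ} {n : ℕ} {z lam : Fin n → ℂ} {φ : Multiset ℂ → ℂ} {u : ℂ}

/-- Removing the bracket turns the summand of index a into the one that exchanges the point t_a with
u. Splitting t_a off the weight supplies d(t_a) and the product of hh(c, t_a) in `opA`; d(t_a)
cancels the denominator of `ratio`. -/
theorem act11_eq {l : ℕ} {f : (Fin l → ℂ) → ℂ}
    (hf : ∀ s, f s = wtd (qpow p 1) (alp p z (-lam)) φ (pts p s)) {t : Fin l → ℂ}
    (h : Apart p t) (hu : Away p t u) (hd : ∀ a, alp p z (-lam) (pts p t a) ≠ 0) :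
    act11 p z lam f u t = (alp p z (-lam) (qpow p (2 * u)))⁻¹ *
      wtd (qpow p 1) (alp p z (-lam))
        (opA (qpow p 1) (alp p z lam) (qpow p (2 * u)) φ) (pts p t) := by
  have hS : (∏ a, sn p (u - t a - 1) / sn p (u - t a)) = ((List.ofFn (pts p t) : Multiset ℂ).map
      fun c => hh (qpow p 1) c (qpow p (2 * u))).prod := by
    rw [prod_map_ofFn]
    exact Finset.prod_congr rfl fun a _ => (hh_qpow' p u (t a)).symm
  rw [act11, hS, hf, ratio_eq, wtd, wtd, opA, add_mul, mul_add]
  congr 1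
  · ring
  · rw [sum_map_ofFn, Finset.sum_mul, Finset.mul_sum, Finset.mul_sum]
    refine Finset.sum_congr rfl fun a _ => ?_
    rcases l with _ | l
    · exact a.elim0
    change _ * _ * bracket p (Equiv.swap a (Fin.last l)) _ t = _
    obtain ⟨s, hs, hs1, hs2, hs3, hs4⟩ := h.exists_snoc (Equiv.swap a (Fin.last l))
      (Equiv.swap_apply_right a _)
    have hda := hd a
    have hua := hu a
    rw [pts] at hda
    have e0 : qpow p (2 * t a) = pts p t a := rfl
    have hl : lstIdx a = Fin.last l := rfl
    -- The constant is the bracketed function at the permuted point divided by `om` there; its last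
    -- product accounts for passing from `om` of s to `om` of s with t_a appended.
    rw [h.bracket_eq (c := φ (qpow p (2 * u) ::ₘ (List.ofFn (pts p s) : Multiset ℂ)) *
      ((alp p z (-lam) (qpow p (2 * u)))⁻¹ *
        (((List.ofFn (pts p s) : Multiset ℂ).map (alp p z (-lam))).prod)⁻¹ *
        (((List.ofFn (pts p s) : Multiset ℂ).map fun c => hh (qpow p 1) c (qpow p (2 * u))).prod)⁻¹) *
      qpow p (u - t a) / sn p (u - t a - 1) *
        (alp p z lam (qpow p (2 * t a)) / alp p z (-lam) (qpow p (2 * t a))) *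
      (((List.ofFn (pts p s) : Multiset ℂ).map fun c => hh (qpow p 1) c (qpow p (2 * t a))).prod))]
    · rw [← e0, hs3, Multiset.erase_cons_head, Multiset.map_cons, Multiset.map_cons,
        Multiset.prod_cons, Multiset.prod_cons, hh_qpow' p u, gg_qpow]
      have h1 := (hs4 u hu).prod_hh_ne_zero.2
      have h2 := hs2.prod_hh_ne_zero.2
      obtain ⟨h3, h4, h5⟩ := hua
      generalize qpow p (2 * u) = ξ at h1 ⊢
      generalize qpow p (2 * t a) = x at h2 hda ⊢
      field_simp
    · rw [hs, hl, Fin.snoc_last, Fin.update_snoc_last, hf, pts_snoc, pts_snoc, wtd_snoc, om_snoc,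
        ← prod_map_ofFn (F := fun c => hh (qpow p 1) c (qpow p (2 * t a))), ratio_eq]
      have h2 := hs2.prod_hh_ne_zero.2
      generalize qpow p (2 * u) = ξ
      generalize qpow p (2 * t a) = x at h2 ⊢
      generalize ((List.ofFn (pts p s) : Multiset ℂ).map fun c => hh (qpow p 1) c x).prod = H
        at h2 ⊢
      field_simp

theorem act22_eq {l : ℕ} {f : (Fin l → ℂ) → ℂ}
    (hf : ∀ s, f s = wtd (qpow p 1) (alp p z (-lam)) φ (pts p s)) {t : Fin l → ℂ}
    (h : Apart p t) (hu : Away p t u) (hd : ∀ a, alp p z (-lam) (pts p t a) ≠ 0)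
    (hdu : alp p z (-lam) (qpow p (2 * u)) ≠ 0) :
    act22 p f u t = (alp p z (-lam) (qpow p (2 * u)))⁻¹ *
      wtd (qpow p 1) (alp p z (-lam))
        (opA (qpow p 1)⁻¹ (alp p z (-lam)) (qpow p (2 * u)) φ) (pts p t) := by
  have hS : (∏ a, sn p (u - t a + 1) / sn p (u - t a)) = ((List.ofFn (pts p t) : Multiset ℂ).map
      fun c => hh (qpow p 1) (qpow p (2 * u)) c).prod := by
    rw [prod_map_ofFn]
    exact Finset.prod_congr rfl fun a _ => (hh_qpow p u (t a)).symm
  rw [act22, hS, hf, wtd, wtd, opA, add_mul, mul_add, sub_eq_add_neg]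
  simp only [hh_inv, gg_inv]
  congr 1
  · field_simp
  · rw [sum_map_ofFn, Finset.sum_mul, Finset.mul_sum, Finset.mul_sum, ← Finset.sum_neg_distrib]
    refine Finset.sum_congr rfl fun a _ => ?_
    rcases l with _ | l
    · exact a.elim0
    change -(_ * _ * bracket p (Equiv.swap 0 a) _ t) = _
    obtain ⟨s, hs, hs1, hs2, hs3, hs4⟩ := h.exists_cons (Equiv.swap 0 a)
      (Equiv.swap_apply_left 0 a)
    have hda := hd a
    have hua := hu a
    rw [pts] at hda
    have e0 : qpow p (2 * t a) = pts p t a := rfl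
    have hl : fstIdx a = 0 := rfl
    rw [h.bracket_eq (c := φ (qpow p (2 * u) ::ₘ (List.ofFn (pts p s) : Multiset ℂ)) *
      ((alp p z (-lam) (qpow p (2 * u)))⁻¹ *
        (((List.ofFn (pts p s) : Multiset ℂ).map (alp p z (-lam))).prod)⁻¹ *
        (((List.ofFn (pts p s) : Multiset ℂ).map fun c => hh (qpow p 1) (qpow p (2 * u)) c).prod)⁻¹) *
      qpow p (u - t a) / sn p (u - t a + 1) *
      (((List.ofFn (pts p s) : Multiset ℂ).map fun c => hh (qpow p 1) (qpow p (2 * t a)) c).prod))]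
    · rw [← e0, hs3, Multiset.erase_cons_head, Multiset.map_cons, Multiset.map_cons,
        Multiset.prod_cons, Multiset.prod_cons, hh_qpow p u, gg_qpow]
      have h1 := (hs4 u hu).prod_hh_ne_zero.1
      have h2 := hs2.prod_hh_ne_zero.1
      obtain ⟨h3, h4, h5⟩ := hua
      generalize qpow p (2 * u) = ξ at h1 ⊢
      generalize qpow p (2 * t a) = x at h2 hda ⊢
      field_simp
    · rw [hs, hl, Fin.cons_zero, Fin.update_cons_zero, hf, pts_cons, pts_cons, wtd_cons, om_cons,
        ← prod_map_ofFn (F := fun c => hh (qpow p 1) (qpow p (2 * t a)) c)]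
      have h2 := hs2.prod_hh_ne_zero.1
      generalize qpow p (2 * u) = ξ
      generalize qpow p (2 * t a) = x at h2 ⊢
      generalize ((List.ofFn (pts p s) : Multiset ℂ).map fun c => hh (qpow p 1) x c).prod = H
        at h2 ⊢
      field_simp

theorem act21_eq {l : ℕ} {f : (Fin (l + 1) → ℂ) → ℂ}
    (hf : ∀ s, f s = wtd (qpow p 1) (alp p z (-lam)) φ (pts p s)) {t : Fin l → ℂ}
    (hu : Away p t u) :
    act21 p f u t = (alp p z (-lam) (qpow p (2 * u)))⁻¹ *
      wtd (qpow p 1) (alp p z (-lam)) (opC (qpow p (2 * u)) φ) (pts p t) := by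
  have hS : (∏ a, sn p (u - t a - 1) / sn p (u - t a)) = ((List.ofFn (pts p t) : Multiset ℂ).map
      fun c => hh (qpow p 1) c (qpow p (2 * u))).prod := by
    rw [prod_map_ofFn]
    exact Finset.prod_congr rfl fun a _ => (hh_qpow' p u (t a)).symm
  have h1 := hu.prod_hh_ne_zero.2
  rw [act21, hS, hf, pts_snoc, wtd_snoc, wtd, opC]
  field_simp

end Action

/-! ### The formula for L₁₂ in rational form -/

theorem sum_map_erase_ofFn {l : ℕ} (x : Fin l → ℂ) (F : ℂ → ℂ) (a : Fin l) :
    (((List.ofFn x : Multiset ℂ).erase (x a)).map F).sum =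
      ∑ b, if a ≠ b then F (x b) else 0 := by
  have h : x a ∈ (List.ofFn x : Multiset ℂ) := by simp
  have e1 := sum_map_ofFn x F
  rw [← Multiset.cons_erase h, Multiset.map_cons, Multiset.sum_cons] at e1
  have e2 : ∑ b, F (x b) = F (x a) + ∑ b, if a ≠ b then F (x b) else 0 := by
    rw [← Fintype.sum_ite_eq a fun b => F (x b), ← Finset.sum_add_distrib]
    refine Finset.sum_congr rfl fun b _ => ?_
    by_cases hab : a = b <;> simp [hab]
  exact add_left_cancel (e1.trans e2)

theorem pairPerm_zero {l : ℕ} {a b : Fin (l + 2)} (h : a ≠ b) :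
    (pairPerm a b : Equiv.Perm (Fin (l + 1 + 1))) 0 = a := by
  have e : Equiv.swap (Equiv.swap 0 a b) (Fin.last (l + 1)) 0 = 0 := by
    refine Equiv.swap_apply_of_ne_of_ne (fun h0 => ?_) Fin.last_pos.ne
    have := congrArg (Equiv.swap 0 a) h0
    rw [Equiv.swap_apply_self, Equiv.swap_apply_left] at this
    exact h this
  rw [pairPerm, Equiv.Perm.mul_apply, e, Equiv.swap_apply_left]

theorem pairPerm_last {l : ℕ} (a b : Fin (l + 1)) : pairPerm a b (Fin.last l) = b := by
  rw [pairPerm, Equiv.Perm.mul_apply, Equiv.swap_apply_right, Equiv.swap_apply_self]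

section

variable {p : ℂ} {n : ℕ} {z lam : Fin n → ℂ} {φ : Multiset ℂ → ℂ} {u : ℂ}

/-- The quotient sn(t_a - t_c - 1) / sn(t_a - t_c + 1) equals hh(t_c, t_a) / hh(t_a, t_c); its
denominator cancels the factor gained when t_a is split off the weight as first variable. -/
theorem act12_single {l : ℕ} {f : (Fin l → ℂ) → ℂ}
    (hf : ∀ s, f s = wtd (qpow p 1) (alp p z (-lam)) φ (pts p s)) {t : Fin (l + 1) → ℂ}
    (h : Apart p t) (hu : Away p t u) (hd : ∀ a, alp p z (-lam) (pts p t a) ≠ 0)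
    (hdu : alp p z (-lam) (qpow p (2 * u)) ≠ 0) (a : Fin (l + 1)) :
    sn p 1 * bracket p (Equiv.swap 0 a)
      (fun s => f (Fin.tail s) * qpow p (u - s 0) / sn p (u - s 0) *
        (ratio p z lam (s 0) *
            (∏ c : Fin l, sn p (u - s c.succ + 1) / sn p (u - s c.succ) *
              (sn p (s 0 - s c.succ - 1) / sn p (s 0 - s c.succ + 1))) -
          ratio p z lam u * ∏ c : Fin l, sn p (u - s c.succ - 1) / sn p (u - s c.succ))) t =
    (alp p z (-lam) (qpow p (2 * u)))⁻¹ *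
      (gg (qpow p 1) (qpow p (2 * u)) (pts p t a) *
        φ ((List.ofFn (pts p t) : Multiset ℂ).erase (pts p t a)) *
        (alp p z (-lam) (qpow p (2 * u)) * alp p z lam (pts p t a) *
          (((List.ofFn (pts p t) : Multiset ℂ).erase (pts p t a)).map fun c =>
            hh (qpow p 1) (qpow p (2 * u)) c * hh (qpow p 1) c (pts p t a)).prod -
          alp p z lam (qpow p (2 * u)) * alp p z (-lam) (pts p t a) *
          (((List.ofFn (pts p t) : Multiset ℂ).erase (pts p t a)).map fun c =>
            hh (qpow p 1) (pts p t a) c * hh (qpow p 1) c (qpow p (2 * u))).prod) *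
      ((((List.ofFn (pts p t) : Multiset ℂ).map (alp p z (-lam))).prod)⁻¹ *
        om (qpow p 1) (pts p t))) := by
  obtain ⟨s, hs, hs1, hs2, hs3, hs4⟩ := h.exists_cons (Equiv.swap 0 a)
    (Equiv.swap_apply_left 0 a)
  have hda := hd a
  obtain ⟨hua, -, -⟩ := hu a
  rw [pts] at hda
  have e0 : pts p t a = qpow p (2 * t a) := rfl
  have hp1 := hs2.prod_hh_ne_zero.1
  have e1 : ∏ c, sn p (u - s c + 1) / sn p (u - s c) *
      (sn p (t a - s c - 1) / sn p (t a - s c + 1)) =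
      ((List.ofFn (pts p s) : Multiset ℂ).map fun c => hh (qpow p 1) (qpow p (2 * u)) c).prod *
      ((List.ofFn (pts p s) : Multiset ℂ).map fun c => hh (qpow p 1) c (qpow p (2 * t a))).prod *
      (((List.ofFn (pts p s) : Multiset ℂ).map fun c =>
        hh (qpow p 1) (qpow p (2 * t a)) c).prod)⁻¹ := by
    rw [prod_map_ofFn, prod_map_ofFn, prod_map_ofFn, ← Finset.prod_inv_distrib,
      ← Finset.prod_mul_distrib, ← Finset.prod_mul_distrib]
    refine Finset.prod_congr rfl fun c _ => ?_
    obtain ⟨h1, h2, h3⟩ := hs2 c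
    rw [pts, hh_qpow, hh_qpow', hh_qpow, mul_assoc]
    congr 1
    field_simp
  have e2 : ∏ c, sn p (u - s c - 1) / sn p (u - s c) =
      ((List.ofFn (pts p s) : Multiset ℂ).map fun c => hh (qpow p 1) c (qpow p (2 * u))).prod := by
    rw [prod_map_ofFn]
    exact Finset.prod_congr rfl fun c _ => (hh_qpow' p u (s c)).symm
  rw [e0, hs3, Multiset.erase_cons_head, Multiset.map_cons, Multiset.prod_cons,
    Multiset.prod_map_mul, Multiset.prod_map_mul]
  rw [h.bracket_eq (c := φ (List.ofFn (pts p s) : Multiset ℂ) *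
    (((List.ofFn (pts p s) : Multiset ℂ).map (alp p z (-lam))).prod)⁻¹ *
    (((List.ofFn (pts p s) : Multiset ℂ).map fun c => hh (qpow p 1) (qpow p (2 * t a)) c).prod) *
    (qpow p (u - t a) / sn p (u - t a) *
    (alp p z lam (qpow p (2 * t a)) / alp p z (-lam) (qpow p (2 * t a)) *
      (((List.ofFn (pts p s) : Multiset ℂ).map fun c => hh (qpow p 1) (qpow p (2 * u)) c).prod *
      ((List.ofFn (pts p s) : Multiset ℂ).map fun c => hh (qpow p 1) c (qpow p (2 * t a))).prod *
      (((List.ofFn (pts p s) : Multiset ℂ).map fun c =>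
        hh (qpow p 1) (qpow p (2 * t a)) c).prod)⁻¹) -
    alp p z lam (qpow p (2 * u)) / alp p z (-lam) (qpow p (2 * u)) *
      ((List.ofFn (pts p s) : Multiset ℂ).map fun c => hh (qpow p 1) c (qpow p (2 * u))).prod)))]
  · rw [gg_qpow]
    generalize qpow p (2 * u) = ξ at hdu ⊢
    generalize qpow p (2 * t a) = x at hda hp1 ⊢
    field_simp
  · rw [hs]
    simp only [Fin.cons_zero, Fin.tail_cons, Fin.cons_succ]
    rw [e1, e2, hf, pts_cons, om_cons, wtd, ratio_eq, ratio_eq,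
      ← prod_map_ofFn (F := fun c => hh (qpow p 1) (qpow p (2 * t a)) c)]
    generalize qpow p (2 * u) = ξ at hdu ⊢
    generalize qpow p (2 * t a) = x at hda hp1 ⊢
    field_simp

/-- With t_a in first and t_b in last place, splitting both off the weight produces hh(a,b) and the
products of hh(a,c) hh(c,b), while f is evaluated at u and the remaining points. -/
theorem act12_pair {l : ℕ} {f : (Fin l → ℂ) → ℂ}
    (hf : ∀ s, f s = wtd (qpow p 1) (alp p z (-lam)) φ (pts p s)) {t : Fin (l + 1) → ℂ}
    (h : Apart p t) (hu : Away p t u) (hd : ∀ a, alp p z (-lam) (pts p t a) ≠ 0)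
    {a b : Fin (l + 1)} (hab : a ≠ b) :
    sn p 1 ^ 2 * (∏ a : Fin (l + 1), sn p (u - t a + 1) / sn p (u - t a)) *
        bracket p (pairPerm a b)
          (fun s => f (fun i : Fin l => if (i : ℕ) = 0 then u else s i.castSucc) *
            (qpow p (2 * u - s 0 - s (Fin.last l)) /
              (sn p (u - s 0 + 1) * sn p (u - s (Fin.last l) + 1))) *
            ratio p z lam (s (Fin.last l))) t =
    (alp p z (-lam) (qpow p (2 * u)))⁻¹ *
      (gg (qpow p 1) (qpow p (2 * u)) (pts p t a) * gg (qpow p 1) (qpow p (2 * u)) (pts p t b) *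
        alp p z (-lam) (pts p t a) * alp p z lam (pts p t b) *
        hh (qpow p 1) (pts p t a) (pts p t b) *
        ((((List.ofFn (pts p t) : Multiset ℂ).erase (pts p t a)).erase (pts p t b)).map fun c =>
          hh (qpow p 1) (pts p t a) c * hh (qpow p 1) c (pts p t b)).prod *
        φ (qpow p (2 * u) ::ₘ
          ((List.ofFn (pts p t) : Multiset ℂ).erase (pts p t a)).erase (pts p t b)) *
      ((((List.ofFn (pts p t) : Multiset ℂ).map (alp p z (-lam))).prod)⁻¹ *
        om (qpow p 1) (pts p t))) := by
  -- A single variable admits no pair of distinct indices.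
  rcases l with _ | l
  · exact absurd (Subsingleton.elim (α := Fin 1) a b) hab
  obtain ⟨s', hs', hs1', hs2', hs3', hs4'⟩ := h.exists_cons (pairPerm a b) (pairPerm_zero hab)
  have hb : s' (Fin.last l) = t b := by
    have := congrFun hs' (Fin.last l).succ
    rw [Fin.cons_succ, Function.comp, Fin.succ_last, pairPerm_last] at this
    exact this.symm
  obtain ⟨s, hs, hs1, hs2, hs3, hs4⟩ := hs1'.exists_snoc 1 (a := Fin.last l) rfl
  rw [hb] at hs hs2 hs3
  have hs5 : s' = Fin.snoc s (t b) := hs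
  have hS : (∏ a, sn p (u - t a + 1) / sn p (u - t a)) = ((List.ofFn (pts p t) : Multiset ℂ).map
      fun c => hh (qpow p 1) (qpow p (2 * u)) c).prod := by
    rw [prod_map_ofFn]
    exact Finset.prod_congr rfl fun a _ => (hh_qpow p u (t a)).symm
  have hda := hd a
  have hdb := hd b
  obtain ⟨hua, -, hua'⟩ := hu a
  obtain ⟨hub, -, hub'⟩ := hu b
  have hhab := h.hh_ne_zero hab
  have e0 : ∀ a, pts p t a = qpow p (2 * t a) := fun _ => rfl
  have hp1 := (hs4 _ hs2').prod_hh_ne_zero.1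
  have hp2 := hs2.prod_hh_ne_zero.2
  have hp3 := (hs4 _ (hs4' _ hu)).prod_hh_ne_zero.1
  have hfun : (fun i : Fin (l + 1) => if (i : ℕ) = 0 then u else
      (Fin.cons (t a) (Fin.snoc s (t b) : Fin (l + 1) → ℂ) : Fin (l + 2) → ℂ) i.castSucc) =
      Fin.cons u s := by
    funext i
    refine Fin.cases ?_ (fun i => ?_) i
    · simp
    · simp
  rw [e0] at hda hdb hhab
  rw [e0] at hhab
  rw [hS, e0, e0, hs3', hs3]
  simp only [Multiset.erase_cons_head, Multiset.map_cons, Multiset.prod_cons,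
    Multiset.prod_map_mul]
  rw [h.bracket_eq (c := φ (qpow p (2 * u) ::ₘ (List.ofFn (pts p s) : Multiset ℂ)) *
    ((alp p z (-lam) (qpow p (2 * u)))⁻¹ *
    (((List.ofFn (pts p s) : Multiset ℂ).map (alp p z (-lam))).prod)⁻¹ *
    (((List.ofFn (pts p s) : Multiset ℂ).map fun c => hh (qpow p 1) (qpow p (2 * u)) c).prod)⁻¹) *
    (hh (qpow p 1) (qpow p (2 * t a)) (qpow p (2 * t b)) *
    (((List.ofFn (pts p s) : Multiset ℂ).map fun c => hh (qpow p 1) (qpow p (2 * t a)) c).prod *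
     ((List.ofFn (pts p s) : Multiset ℂ).map fun c => hh (qpow p 1) c (qpow p (2 * t b))).prod)) *
    (qpow p (u - t a) * qpow p (u - t b) / (sn p (u - t a + 1) * sn p (u - t b + 1)) *
    (alp p z lam (qpow p (2 * t b)) / alp p z (-lam) (qpow p (2 * t b)))))]
  · rw [gg_qpow, gg_qpow, hh_qpow p u (t a), hh_qpow p u (t b)]
    generalize qpow p (2 * u) = ξ at hp3 ⊢
    generalize qpow p (2 * t a) = x at hda hp1 hhab ⊢
    generalize qpow p (2 * t b) = y at hdb hp2 hhab ⊢
    field_simp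
  · rw [hs', hs5, hfun, ← Fin.succ_last, Fin.cons_succ, Fin.cons_zero, Fin.snoc_last, hf,
      pts_cons, pts_cons, pts_snoc, wtd_cons, om_cons, om_snoc, ratio_eq,
      Fin.prod_univ_castSucc, ← prod_map_ofFn (F := fun c => hh (qpow p 1) c (qpow p (2 * t b))),
      Fin.snoc_last, show 2 * u - t a - t b = (u - t a) + (u - t b) by ring, qpow_add]
    simp only [Fin.snoc_castSucc]
    rw [← prod_map_ofFn (F := fun c => hh (qpow p 1) (qpow p (2 * t a)) c)]
    generalize qpow p (2 * u) = ξ at hp3 ⊢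
    generalize qpow p (2 * t a) = x at hda hp1 hhab ⊢
    generalize qpow p (2 * t b) = y at hdb hp2 hhab ⊢
    generalize ((List.ofFn (pts p s) : Multiset ℂ).map fun c => hh (qpow p 1) x c).prod = H1
      at hp1 ⊢
    generalize ((List.ofFn (pts p s) : Multiset ℂ).map fun c => hh (qpow p 1) c y).prod = H2
      at hp2 ⊢
    generalize ((List.ofFn (pts p s) : Multiset ℂ).map fun c => hh (qpow p 1) ξ c).prod = H3
      at hp3 ⊢
    generalize hh (qpow p 1) x y = H4 at hhab ⊢
    field_simp

theorem act12_eq {l : ℕ} {f : (Fin l → ℂ) → ℂ}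
    (hf : ∀ s, f s = wtd (qpow p 1) (alp p z (-lam)) φ (pts p s)) {t : Fin (l + 1) → ℂ}
    (h : Apart p t) (hu : Away p t u) (hd : ∀ a, alp p z (-lam) (pts p t a) ≠ 0)
    (hdu : alp p z (-lam) (qpow p (2 * u)) ≠ 0) :
    act12 p z lam f u t = (alp p z (-lam) (qpow p (2 * u)))⁻¹ *
      wtd (qpow p 1) (alp p z (-lam))
        (opB (qpow p 1) (alp p z lam) (alp p z (-lam)) (qpow p (2 * u)) φ) (pts p t) := by
  rw [act12, wtd, opB, sum_map_ofFn, sum_map_ofFn, sub_mul, mul_sub]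
  congr 1
  · rw [Finset.mul_sum, Finset.sum_mul, Finset.mul_sum]
    exact Finset.sum_congr rfl fun a _ => act12_single hf h hu hd hdu a
  · simp only [sum_map_erase_ofFn]
    rw [Finset.mul_sum, Finset.sum_mul, Finset.mul_sum]
    refine Finset.sum_congr rfl fun a _ => ?_
    rw [Finset.mul_sum, Finset.sum_mul, Finset.mul_sum]
    refine Finset.sum_congr rfl fun b _ => ?_
    by_cases hab : a = b
    · simp [hab]
    · rw [if_pos hab, if_pos hab]
      exact act12_pair hf h hu hd hab

end

/-! ### Lowest and highest modes -/

/-- The function `f` grows like `κ u ^ n` at infinity. -/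
def Lead (n : ℕ) (f : ℂ → ℂ) (κ : ℂ) : Prop :=
  Filter.Tendsto (fun w => w ^ n * f w⁻¹) (𝓝[≠] 0) (𝓝 κ)

namespace Lead

variable {n : ℕ} {f g : ℂ → ℂ} {a b : ℂ}

theorem unique (h : Lead n f a) (h' : Lead n f b) : a = b := tendsto_nhds_unique h h'

theorem add (h : Lead n f a) (h' : Lead n g b) : Lead n (fun u => f u + g u) (a + b) := by
  simpa only [Lead, mul_add] using Filter.Tendsto.add h h'

theorem mul (h : Lead n f a) (h' : Lead 0 g b) : Lead n (fun u => f u * g u) (a * b) := by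
  have := Filter.Tendsto.mul h h'
  simpa only [Lead, pow_zero, one_mul, mul_assoc] using this

theorem mul' (h : Lead 0 f a) (h' : Lead n g b) : Lead n (fun u => f u * g u) (a * b) := by
  simpa only [mul_comm] using h'.mul h

theorem const (c : ℂ) : Lead 0 (fun _ => c) c := by
  simpa only [Lead, pow_zero, one_mul] using tendsto_const_nhds

theorem of_eventually {F : ℂ → ℂ} (hF : ContinuousAt F 0)
    (h : ∀ᶠ w in 𝓝[≠] 0, w ^ n * f w⁻¹ = F w) : Lead n f (F 0) :=
  Filter.Tendsto.congr' (h.mono fun _ h => h.symm) (hF.tendsto.mono_left nhdsWithin_le_nhds)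

theorem congr_off (E : Finset ℂ) (h : Lead n f a) (hfg : ∀ u ∉ E, g u = f u) : Lead n g a := by
  refine Filter.Tendsto.congr' ?_ h
  have h1 : ∀ᶠ w : ℂ in 𝓝[≠] 0, ∀ c ∈ E, w⁻¹ ≠ c := by
    rw [Filter.eventually_all_finset]
    intro c _
    by_cases hc : c = 0
    · filter_upwards [self_mem_nhdsWithin] with w hw
      rw [hc]
      exact inv_ne_zero hw
    · filter_upwards [nhdsWithin_le_nhds (isOpen_ne.mem_nhds (inv_ne_zero hc).symm)] with w hw hw'
      exact hw (by rw [← hw', inv_inv])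
  filter_upwards [h1] with w hw
  rw [hfg _ fun hmem => hw _ hmem rfl]

theorem sum_map {X : Multiset ℂ} {F : ℂ → ℂ → ℂ} (h : ∀ c ∈ X, Lead n (F c) 0) :
    Lead n (fun u => (X.map fun c => F c u).sum) 0 := by
  induction X using Multiset.induction with
  | empty => simp [Lead]
  | cons c X ih =>
    simp only [Multiset.map_cons, Multiset.sum_cons]
    simpa using (h c (Multiset.mem_cons_self c X)).add
      (ih fun c hc => h c (Multiset.mem_cons_of_mem hc))

theorem sum_pow (c : ℕ → ℂ) :
    Lead n (fun u => ∑ s ∈ Finset.range (n + 1), u ^ s * c s) (c n) := by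
  have h := of_eventually (n := n) (f := fun u => ∑ s ∈ Finset.range (n + 1), u ^ s * c s)
    (F := fun w => ∑ s ∈ Finset.range (n + 1), w ^ (n - s) * c s) (by fun_prop) (by
      filter_upwards [self_mem_nhdsWithin] with w hw
      rw [Finset.mul_sum]
      refine Finset.sum_congr rfl fun s hs => ?_
      have hs' : s ≤ n := by simpa [Nat.lt_succ_iff] using hs
      rw [← mul_assoc, inv_pow, pow_sub₀ w hw hs'])
  convert h using 1
  rw [Finset.sum_range_succ, Finset.sum_eq_zero]
  · simp
  · intro s hs
    rw [zero_pow (by have := Finset.mem_range.1 hs; omega), zero_mul]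

theorem of_polyOff {E : Finset ℂ} (h : PolyOff n E f) : Lead n f 0 := by
  obtain ⟨p, hp, hp'⟩ := h
  have e : ∀ u, p.eval u = ∑ s ∈ Finset.range (n + 1), u ^ s * p.coeff s := fun u => by
    rcases eq_or_ne p 0 with rfl | h0
    · simp
    rw [Polynomial.eval_eq_sum_range' (n := n + 1)]
    · exact Finset.sum_congr rfl fun _ _ => mul_comm _ _
    · rw [Polynomial.mem_degreeLT] at hp
      exact ((Polynomial.natDegree_lt_iff_degree_lt h0).2 hp).trans (Nat.lt_succ_self n)
  have := (sum_pow (n := n) p.coeff).congr_off (g := f) E fun u hu => by rw [hp' u hu, e]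
  rwa [Polynomial.coeff_eq_zero_of_degree_lt (Polynomial.mem_degreeLT.1 hp)] at this

theorem hh_right (q c : ℂ) : Lead 0 (fun u => hh q c u) q⁻¹ := by
  have h := of_eventually (n := 0) (f := fun u => hh q c u)
    (F := fun w => (q * c * w - q⁻¹) / (c * w - 1)) (by
      refine ContinuousAt.div (by fun_prop) (by fun_prop) (by simp)) (by
      filter_upwards [self_mem_nhdsWithin] with w hw
      rw [pow_zero, one_mul, hh, ← mul_div_mul_right _ _ hw]
      congr 1
      · rw [sub_mul, inv_mul_cancel_right₀ hw]
      · rw [sub_mul, inv_mul_cancel₀ hw])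
  simpa using h

theorem gg_left (q c : ℂ) : Lead 0 (fun u => gg q u c) (q - q⁻¹) := by
  have h := of_eventually (n := 0) (f := fun u => gg q u c)
    (F := fun w => (q - q⁻¹) / (1 - c * w)) (by
      refine ContinuousAt.div (by fun_prop) (by fun_prop) (by simp)) (by
      filter_upwards [self_mem_nhdsWithin] with w hw
      rw [pow_zero, one_mul, gg, ← mul_div_mul_right _ _ hw, inv_mul_cancel_right₀ hw, sub_mul,
        inv_mul_cancel₀ hw])
  simpa using h

theorem prod_map {X : Multiset ℂ} {F : ℂ → ℂ → ℂ} {κ : ℂ} (h : ∀ c, Lead 0 (F c) κ) :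
    Lead 0 (fun u => (X.map fun c => F c u).prod) (κ ^ Multiset.card X) := by
  induction X using Multiset.induction with
  | empty => simp [Lead]
  | cons c X ih =>
    simp only [Multiset.map_cons, Multiset.prod_cons, Multiset.card_cons, pow_succ']
    exact (h c).mul ih

/-- Only the diagonal term can grow like u^n: in the exchange terms gg(u,a) stays bounded and φ(u,
·) has degree less than n. -/
theorem opA {q κ : ℂ} {α : ℂ → ℂ} {φ : Multiset ℂ → ℂ} (hα : Lead n α κ)
    (hφ : ∀ Y, PolyOff n ∅ fun u => φ (u ::ₘ Y)) (X : Multiset ℂ) :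
    Lead n (fun u => TrigHyp.opA q α u φ X) (κ * q⁻¹ ^ Multiset.card X * φ X) := by
  have h1 : Lead n (fun u => α u * (X.map fun c => hh q c u).prod * φ X)
      (κ * q⁻¹ ^ Multiset.card X * φ X) :=
    (hα.mul (prod_map fun c => hh_right q c)).mul (const (φ X))
  have h2 : Lead n (fun u => (X.map fun a => gg q u a * α a *
      ((X.erase a).map fun c => hh q c a).prod * φ (u ::ₘ X.erase a)).sum) 0 := by
    refine sum_map fun a _ => ?_
    have := (((gg_left q a).mul (const (α a))).mul
      (const ((X.erase a).map fun c => hh q c a).prod)).mul' (of_polyOff (hφ (X.erase a)))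
    rwa [mul_zero] at this
  have h3 := h1.add h2
  rwa [add_zero] at h3

end Lead

theorem evM_cons_polyOff {n : ℕ} (m : PolySpace n) (X : Multiset ℂ) :
    PolyOff n ∅ fun u => evM n (u ::ₘ X) m := by
  refine (evAt_cons_polyOff (m (Multiset.card X + 1)) X).congr fun u _ => ?_
  rw [evM_eq, Multiset.card_cons]

theorem Modes.evM_gen_eq {n : ℕ} {K : (Multiset ℂ → ℂ) → ℂ → Multiset ℂ → ℂ} {k : ℕ → ℕ}
    (T : Modes n K k) (u : ℂ) (m : PolySpace n) (X : Multiset ℂ) :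
    evM n X (T.gen u m) = ∑ s ∈ Finset.range (n + 1), u ^ s * evM n X (T.op s m) := by
  simp only [gen, LinearMap.sum_apply, LinearMap.smul_apply, map_sum, map_smul, smul_eq_mul]

theorem Modes.gen_zero {n : ℕ} {K : (Multiset ℂ → ℂ) → ℂ → Multiset ℂ → ℂ} {k : ℕ → ℕ}
    (T : Modes n K k) : T.gen 0 = T.op 0 := by
  rw [gen, Finset.sum_range_succ', Finset.sum_eq_zero]
  · simp
  · intro s _
    simp

/-- At u = 0 all exchange terms vanish since gg(0,a) = 0, and hh(c,0) = q. -/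
theorem opA_zero_left {q : ℂ} (α : ℂ → ℂ) (φ : Multiset ℂ → ℂ) {X : Multiset ℂ} (h : (0 : ℂ) ∉ X) :
    opA q α 0 φ X = α 0 * q ^ Multiset.card X * φ X := by
  have e1 : (X.map fun c => hh q c 0).prod = q ^ Multiset.card X := by
    rw [Multiset.map_congr rfl (g := fun _ => q), Multiset.map_const', Multiset.prod_replicate]
    intro c hc
    have hc0 : c ≠ 0 := fun h0 => h (h0 ▸ hc)
    simp [hh, hc0]
  have e2 : ∀ a, gg q 0 a = 0 := fun a => by simp [gg]
  simp [opA, e1, e2]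

namespace OperatorData

variable {n : ℕ} {q : ℂ} {α d : ℂ → ℂ} (S : OperatorData n q α d)

theorem evM_A_zero (m : PolySpace n) {X : Multiset ℂ} (hX : X.Nodup) (h : (0 : ℂ) ∉ X) :
    evM n X (S.A.op 0 m) = α 0 * q ^ Multiset.card X * evM n X m := by
  rw [← Modes.gen_zero, S.evM_A 0 m hX h, opA_zero_left α _ h]

theorem evM_D_zero (m : PolySpace n) {X : Multiset ℂ} (hX : X.Nodup) (h : (0 : ℂ) ∉ X) :
    evM n X (S.D.op 0 m) = d 0 * q⁻¹ ^ Multiset.card X * evM n X m := by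
  rw [← Modes.gen_zero, S.evM_D 0 m hX h, opA_zero_left d _ h]

theorem evM_A_top {κ : ℂ} (hα : Lead n α κ) (m : PolySpace n) {X : Multiset ℂ} (hX : X.Nodup) :
    evM n X (S.A.op n m) = κ * q⁻¹ ^ Multiset.card X * evM n X m := by
  have h1 := Lead.sum_pow (n := n) fun s => evM n X (S.A.op s m)
  refine h1.unique ((Lead.opA (q := q) (φ := fun Y => evM n Y m) hα (evM_cons_polyOff m) X).congr_off X.toFinset
    fun u hu => ?_)
  rw [← Modes.evM_gen_eq, S.evM_A u m hX (by simpa using hu)]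

theorem evM_D_top {κ : ℂ} (hd : Lead n d κ) (m : PolySpace n) {X : Multiset ℂ} (hX : X.Nodup) :
    evM n X (S.D.op n m) = κ * q ^ Multiset.card X * evM n X m := by
  have h1 := Lead.sum_pow (n := n) fun s => evM n X (S.D.op s m)
  have h2 := Lead.opA (q := q⁻¹) (φ := fun Y => evM n Y m) hd (evM_cons_polyOff m) X
  rw [inv_inv] at h2
  refine h1.unique (h2.congr_off X.toFinset fun u hu => ?_)
  rw [← Modes.evM_gen_eq, S.evM_D u m hX (by simpa using hu)]

/-- Every term of `opB` contains a factor gg(u,a), which vanishes at u = 0. This is the relation for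
L₁₂^(+0). -/
theorem B_op_zero : S.B.op 0 = 0 := by
  refine LinearMap.ext fun m => polySpace_ext {0} fun X hX h => ?_
  have h0 : (0 : ℂ) ∉ X := fun h' => h 0 h' (by simp)
  have e : ∀ a, gg q 0 a = 0 := fun a => by simp [gg]
  rw [← Modes.gen_zero, S.evM_B 0 m hX h0]
  simp [opB, e]

/-- Inserting u gives a polynomial of degree less than n in u. This is the relation for L₂₁^(-0). -/
theorem C_op_top : S.C.op n = 0 := by
  refine LinearMap.ext fun m => polySpace_ext ∅ fun X hX _ => ?_
  have h1 := Lead.sum_pow (n := n) fun s => evM n X (S.C.op s m)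
  rw [LinearMap.zero_apply, map_zero]
  refine h1.unique ((Lead.of_polyOff (evM_cons_polyOff m X)).congr_off X.toFinset fun u hu => ?_)
  rw [← Modes.evM_gen_eq, S.evM_C u m hX (by simpa using hu)]

end OperatorData

theorem mul_eq_one_of_evM {n : ℕ} {G H : Module.End ℂ (PolySpace n)} {a b r : ℂ}
    (hG : ∀ m (X : Multiset ℂ), X.Nodup → (0 : ℂ) ∉ X →
      evM n X (G m) = a * r ^ Multiset.card X * evM n X m)
    (hH : ∀ m (X : Multiset ℂ), X.Nodup → (0 : ℂ) ∉ X →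
      evM n X (H m) = b * r⁻¹ ^ Multiset.card X * evM n X m) (hab : a * b = 1) (hr : r ≠ 0) :
    G * H = 1 := by
  refine LinearMap.ext fun m => polySpace_ext {0} fun X hX h => ?_
  have h0 : (0 : ℂ) ∉ X := fun h' => h 0 h' (by simp)
  rw [Module.End.mul_apply, hG _ X hX h0, hH _ X hX h0, Module.End.one_apply]
  have e : r ^ Multiset.card X * r⁻¹ ^ Multiset.card X = 1 := by
    rw [← mul_pow, mul_inv_cancel₀ hr, one_pow]
  linear_combination (r ^ Multiset.card X * r⁻¹ ^ Multiset.card X) * evM n X m * hab + evM n X m * e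

/-! ### The representation on the space of symmetric polynomials -/

theorem coeffL1_mul_coeffL2 (ε ε' : ℤˣ) (a b : ℤ) (x y : Fin 2 × Fin 2) :
    (coeffL1 ε a * coeffL2 ε' b) x y = coeffL ε a x.1 y.1 * coeffL ε' b x.2 y.2 := by
  simp [coeffL1, coeffL2, Matrix.mul_apply, Matrix.kroneckerMap_apply, Matrix.one_apply,
    Fintype.sum_prod_type]

theorem coeffL2_mul_coeffL1 (ε ε' : ℤˣ) (a b : ℤ) (x y : Fin 2 × Fin 2) :
    (coeffL2 ε' b * coeffL1 ε a) x y = coeffL ε' b x.2 y.2 * coeffL ε a x.1 y.1 := by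
  simp [coeffL1, coeffL2, Matrix.mul_apply, Matrix.kroneckerMap_apply, Matrix.one_apply,
    Fintype.sum_prod_type]

theorem rll_sub (R : Matrix (Fin 2 × Fin 2) (Fin 2 × Fin 2) ℂ) (ε ε' : ℤˣ) (a b : ℤ)
    (x y : Fin 2 × Fin 2) :
    (scalarMat R * (coeffL1 ε a * coeffL2 ε' b)) x y -
      (coeffL2 ε' b * coeffL1 ε a * scalarMat R) x y =
      rttEntry R (fun i j => coeffL ε a i j) (fun i j => coeffL ε' b i j) x y := by
  rw [rttEntry, Matrix.mul_apply, Matrix.mul_apply]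
  simp only [coeffL1_mul_coeffL2, coeffL2_mul_coeffL1, scalarMat, Matrix.map_apply,
    Algebra.smul_def]
  congr 1
  exact Finset.sum_congr rfl fun z _ => (Algebra.commutes _ _).symm

theorem map_rttEntry {V W : Type*} [Ring V] [Algebra ℂ V] [Ring W] [Algebra ℂ W] (f : V →ₐ[ℂ] W)
    (R : Matrix (Fin 2 × Fin 2) (Fin 2 × Fin 2) ℂ) (T T' : Fin 2 → Fin 2 → V)
    (x y : Fin 2 × Fin 2) : f (rttEntry R T T' x y) =
      rttEntry R (fun i j => f (T i j)) (fun i j => f (T' i j)) x y := by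
  simp only [rttEntry, map_sub, map_sum, map_smul, map_mul]

theorem rttEntry_smul {V : Type*} [Ring V] [Algebra ℂ V]
    (R : Matrix (Fin 2 × Fin 2) (Fin 2 × Fin 2) ℂ) (T T' : Fin 2 → Fin 2 → V) (c c' : ℂ)
    (x y : Fin 2 × Fin 2) :
    rttEntry R (c • T) (c' • T') x y = (c * c') • rttEntry R T T' x y := by
  simp only [rttEntry, Pi.smul_apply, smul_mul_smul_comm, smul_sub, Finset.smul_sum]
  congr 1
  · exact Finset.sum_congr rfl fun z _ => smul_comm _ _ _
  · exact Finset.sum_congr rfl fun z _ => by rw [smul_comm, mul_comm c']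

/-- The modes of the expansions at `0` (for `ε = 1`) and at infinity, rescaled, of a polynomial
of degree `n`. -/
def signed {V : Type*} [AddCommMonoid V] [Module ℂ V] (n : ℕ) (c : ℂ) (T : ℕ → V) (ε : ℤˣ)
    (s : ℕ) : V :=
  if ε = 1 then T s else if s ≤ n then c • T (n - s) else 0

theorem map_signed {V W : Type*} [AddCommMonoid V] [Module ℂ V] [AddCommMonoid W] [Module ℂ W]
    (f : V →ₗ[ℂ] W) (n : ℕ) (c : ℂ) (T : ℕ → V) (ε : ℤˣ) (s : ℕ) :
    f (signed n c T ε s) = signed n c (fun s => f (T s)) ε s := by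
  unfold signed
  split_ifs <;> simp

/-- For ε = -1 the coefficient at ξ^a is c times the mode of index n + a. Thus either sign amounts
to a rescaling and a shift of the same doubly infinite sequence. -/
theorem exists_signed_eq_extendModes {V : Type*} [AddCommMonoid V] [Module ℂ V] (n : ℕ) (c : ℂ)
    {T : ℕ → Fin 2 → Fin 2 → V} (hT : ∀ s, n < s → T s = 0) (ε : ℤˣ) :
    ∃ (c' : ℂ) (r : ℤ), ∀ a : ℤ,
      (fun i j => if 0 ≤ (ε : ℤ) * a then
        signed n c (fun s => T s i j) ε ((ε : ℤ) * a).toNat else 0) =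
      c' • extendModes T (a + r) := by
  rcases Int.units_eq_one_or ε with rfl | rfl
  · refine ⟨1, 0, fun a => ?_⟩
    ext i j
    simp [signed, extendModes]
  · refine ⟨c, n, fun a => ?_⟩
    ext i j
    simp only [signed, extendModes, Pi.smul_apply, Units.val_neg, Units.val_one, neg_one_mul,
      if_neg (show ¬((-1 : ℤˣ) = 1) by decide)]
    by_cases h1 : 0 ≤ -a
    · by_cases h2 : (-a).toNat ≤ n
      · rw [if_pos h1, if_pos h2, if_pos (by omega)]
        congr 3
        omega
      · rw [if_pos h1, if_neg h2, if_neg (by omega), smul_zero]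
    · rw [if_neg h1, if_pos (by omega), hT _ (by omega)]
      simp

/-- Normalization of the lowest and highest modes. -/
structure Normalized (n : ℕ) (α d : ℂ → ℂ) (c : ℂ) : Prop where
  zero : α 0 * d 0 = 1
  exists_lead : ∃ a b, Lead n α a ∧ Lead n d b ∧ α 0 * (c * a) = 1 ∧ d 0 * (c * b) = 1

namespace OperatorData

variable {n : ℕ} {q : ℂ} {α d : ℂ → ℂ} (S : OperatorData n q α d)

/-- The action of the free algebra. -/
def repFree (c : ℂ) : FreeAlgebra ℂ Gen →ₐ[ℂ] Module.End ℂ (PolySpace n) :=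
  FreeAlgebra.lift ℂ fun g => signed n c (fun s => S.mode s g.2.2.1 g.2.2.2) g.1 g.2.1

theorem repFree_genL (c : ℂ) (ε : ℤˣ) (s : ℕ) (i j : Fin 2) :
    S.repFree c (genL ε s i j) = signed n c (fun s => S.mode s i j) ε s :=
  FreeAlgebra.lift_ι_apply _ _

theorem repFree_coeffL (c : ℂ) (ε : ℤˣ) (a : ℤ) :
    (fun i j => S.repFree c (coeffL ε a i j)) = fun i j => if 0 ≤ (ε : ℤ) * a then
        signed n c (fun s => S.mode s i j) ε ((ε : ℤ) * a).toNat else 0 := by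
  ext i j : 2
  rw [coeffL, Matrix.of_apply, apply_ite (S.repFree c), repFree_genL, map_zero]

/-- The mode relation is bilinear and holds for all integers a and b, so it survives the rescalings
and shifts that turn the modes into those of L^ε and L^ε'. -/
theorem repFree_rll (c : ℂ) (ε ε' : ℤˣ) (a b : ℤ) (x y : Fin 2 × Fin 2) :
    S.repFree c ((scalarMat (RTop q) * (coeffL1 ε (a - 1) * coeffL2 ε' b) +
        scalarMat (RBot q) * (coeffL1 ε a * coeffL2 ε' (b - 1))) x y) =
      S.repFree c ((coeffL2 ε' b * coeffL1 ε (a - 1) * scalarMat (RTop q) +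
        coeffL2 ε' (b - 1) * coeffL1 ε a * scalarMat (RBot q)) x y) := by
  obtain ⟨c1, r1, h1⟩ := exists_signed_eq_extendModes n c (T := S.mode)
    (fun _ hs => S.mode_eq_zero hs) ε
  obtain ⟨c2, r2, h2⟩ := exists_signed_eq_extendModes n c (T := S.mode)
    (fun _ hs => S.mode_eq_zero hs) ε'
  rw [← sub_eq_zero, ← map_sub, Matrix.add_apply, Matrix.add_apply, add_sub_add_comm, rll_sub,
    rll_sub, map_add, map_rttEntry, map_rttEntry]
  simp only [repFree_coeffL]
  rw [h1, h1, h2, h2, rttEntry_smul, rttEntry_smul, ← smul_add]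
  have := S.rtt_mode (a + r1) (b + r2) x y
  rw [show a - 1 + r1 = a + r1 - 1 by ring, show b - 1 + r2 = b + r2 - 1 by ring, this, smul_zero]

theorem repFree_eq_one {c : ℂ} (h : Normalized n α d c) (ε : ℤˣ) :
    (S.repFree c (genL ε 0 0 0) * S.repFree c (genL ε 0 1 1) = 1 ∧
      S.repFree c (genL ε 0 1 1) * S.repFree c (genL ε 0 0 0) = 1) ∧
    ∀ i, S.repFree c (genL ε 0 i i) * S.repFree c (genL (-ε) 0 i i) = 1 := by
  obtain ⟨h0, a, b, ha, hb, h1, h2⟩ := h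
  have hq := S.q_ne_zero
  have hq' := inv_ne_zero hq
  have hne : ¬((-1 : ℤˣ) = 1) := by decide
  have eA : S.repFree c (genL 1 0 0 0) = S.A.op 0 := by
    rw [repFree_genL]
    simp [signed, mode]
  have eD : S.repFree c (genL 1 0 1 1) = S.D.op 0 := by
    rw [repFree_genL]
    simp [signed, mode]
  have eA' : S.repFree c (genL (-1) 0 0 0) = c • S.A.op n := by
    rw [repFree_genL]
    simp [signed, mode, hne]
  have eD' : S.repFree c (genL (-1) 0 1 1) = c • S.D.op n := by
    rw [repFree_genL]
    simp [signed, mode, hne]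
  have vA : ∀ m (X : Multiset ℂ), X.Nodup → (0 : ℂ) ∉ X →
      evM n X (S.A.op 0 m) = α 0 * q ^ Multiset.card X * evM n X m :=
    fun m X hX h => S.evM_A_zero m hX h
  have vD : ∀ m (X : Multiset ℂ), X.Nodup → (0 : ℂ) ∉ X →
      evM n X (S.D.op 0 m) = d 0 * q⁻¹ ^ Multiset.card X * evM n X m :=
    fun m X hX h => S.evM_D_zero m hX h
  have vA' : ∀ m (X : Multiset ℂ), X.Nodup → (0 : ℂ) ∉ X →
      evM n X ((c • S.A.op n) m) = c * a * q⁻¹ ^ Multiset.card X * evM n X m :=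
    fun m X hX h => by
      rw [LinearMap.smul_apply, map_smul, S.evM_A_top ha m hX, smul_eq_mul]
      ring
  have vD' : ∀ m (X : Multiset ℂ), X.Nodup → (0 : ℂ) ∉ X →
      evM n X ((c • S.D.op n) m) = c * b * q ^ Multiset.card X * evM n X m :=
    fun m X hX h => by
      rw [LinearMap.smul_apply, map_smul, S.evM_D_top hb m hX, smul_eq_mul]
      ring
  -- The two highest scalars are inverse to the two lowest ones, whose product is 1.
  have h3 : c * a * (c * b) = 1 := by
    linear_combination (c * a * (c * b)) * (-h0) + (d 0 * (c * b)) * h1 + h2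
  rcases Int.units_eq_one_or ε with rfl | rfl
  · rw [eA, eD]
    refine ⟨⟨mul_eq_one_of_evM vA vD h0 hq, mul_eq_one_of_evM vD (by simpa using vA)
      (by rw [mul_comm, h0]) hq'⟩, fun i => ?_⟩
    fin_cases i
    · simp only [Fin.zero_eta]
      rw [eA, eA']
      exact mul_eq_one_of_evM vA vA' h1 hq
    · simp only [Fin.mk_one]
      rw [eD, eD']
      exact mul_eq_one_of_evM vD (by simpa using vD') h2 hq'
  · rw [eA', eD', neg_neg]
    refine ⟨⟨mul_eq_one_of_evM vA' (by simpa using vD') h3 hq', mul_eq_one_of_evM vD' vA'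
      (by rw [mul_comm, h3]) hq⟩, fun i => ?_⟩
    fin_cases i
    · simp only [Fin.zero_eta]
      rw [eA, eA']
      exact mul_eq_one_of_evM vA' (by simpa using vA) (by rw [mul_comm, h1]) hq'
    · simp only [Fin.mk_one]
      rw [eD, eD']
      exact mul_eq_one_of_evM vD' vD (by rw [mul_comm, h2]) hq

theorem repFree_rel {c : ℂ} (h : Normalized n α d c) ⦃x y : FreeAlgebra ℂ Gen⦄
    (hxy : Rel q x y) : S.repFree c x = S.repFree c y := by
  have hne : ¬((-1 : ℤˣ) = 1) := by decide
  induction hxy with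
  | rll ε ε' _ a b x y => exact S.repFree_rll c ε ε' a b x y
  | upper =>
    rw [repFree_genL, map_zero]
    simp [signed, mode, S.B_op_zero]
  | lower =>
    rw [repFree_genL, map_zero]
    simp [signed, mode, S.C_op_top, hne]
  | inv12 ε =>
    rw [map_mul, map_one]
    exact (S.repFree_eq_one h ε).1.1
  | inv21 ε =>
    rw [map_mul, map_one]
    exact (S.repFree_eq_one h ε).1.2
  | inv ε i =>
    rw [map_mul, map_one]
    exact (S.repFree_eq_one h ε).2 i

/-- The representation of `U_q gl̂(2)` on the graded space of symmetric polynomials. -/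
def rep {c : ℂ} (h : Normalized n α d c) : Uq q →ₐ[ℂ] Module.End ℂ (PolySpace n) :=
  RingQuot.liftAlgHom ℂ ⟨S.repFree c, S.repFree_rel h⟩

theorem rep_uqL {c : ℂ} (h : Normalized n α d c) (ε : ℤˣ) (s : ℕ) (i j : Fin 2) :
    S.rep h (uqL q ε s i j) = signed n c (fun s => S.mode s i j) ε s := by
  rw [rep, uqL, RingQuot.liftAlgHom_mkAlgHom_apply, repFree_genL]

end OperatorData

/-! ### Points in general position -/

theorem Generic.apart {p : ℂ} {n l : ℕ} {z lam : Fin n → ℂ} {t : Fin l → ℂ}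
    (h : Generic p z lam t) : Apart p t := h.1

theorem alp_neg_ne_zero {p : ℂ} {n : ℕ} {z lam : Fin n → ℂ} {x : ℂ}
    (h : ∀ b, sn p (x - z b - lam b) ≠ 0) : alp p z (-lam) (qpow p (2 * x)) ≠ 0 := by
  rw [alp_neg_qpow]
  exact Finset.prod_ne_zero_iff.2 fun a _ => mul_ne_zero (mul_ne_zero (by simp)
    (qpow_ne_zero _ _)) (h a)

theorem Generic.alp_ne_zero {p : ℂ} {n l : ℕ} {z lam : Fin n → ℂ} {t : Fin l → ℂ}
    (h : Generic p z lam t) (a : Fin l) : alp p z (-lam) (pts p t a) ≠ 0 :=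
  alp_neg_ne_zero fun b => by simpa using h.2 a b 0

/-- The subgroup `ℤ + pℤ`. -/
def periods (p : ℂ) : AddSubgroup ℂ where
  carrier := Set.range fun a : ℤ × ℤ => (a.1 : ℂ) + p * a.2
  add_mem' := by
    rintro _ _ ⟨a, rfl⟩ ⟨b, rfl⟩
    exact ⟨a + b, by simp only [Prod.fst_add, Prod.snd_add]; push_cast; ring⟩
  zero_mem' := ⟨0, by simp⟩
  neg_mem' := by
    rintro _ ⟨a, rfl⟩
    exact ⟨-a, by simp only [Prod.fst_neg, Prod.snd_neg]; push_cast; ring⟩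

/-- The subgroup is countable and ℂ is not. -/
theorem infinite_quotient_periods (p : ℂ) : Infinite (ℂ ⧸ periods p) := by
  by_contra h
  have : Finite (ℂ ⧸ periods p) := not_infinite_iff_finite.1 h
  have : Countable (periods p) := (Set.countable_range _).to_subtype
  have : Countable ℂ :=
    (AddSubgroup.addGroupEquivQuotientProdAddSubgroup (s := periods p)).injective.countable
  exact not_countable_complex (Set.countable_univ)

theorem sn_ne_zero_of_mk_ne {p : ℂ} (hp : p ≠ 0) {x y : ℂ}
    (h : (QuotientAddGroup.mk x : ℂ ⧸ periods p) ≠ QuotientAddGroup.mk y) (j : ℤ) :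
    sn p (x - y + j) ≠ 0 := by
  rw [Ne, sn_eq_zero_iff hp]
  rintro ⟨m, hm⟩
  refine h (QuotientAddGroup.eq.2 ⟨(j, -m), ?_⟩)
  push_cast
  linear_combination hm

/-- Take one representative of each class modulo ℤ + pℤ, apart from the finitely many classes of z_b
+ λ_b. Distinct points of T come from distinct classes, so any choice of distinct coordinates lifts
to a generic t. This links equality at generic points with equality of polynomials. -/
theorem exists_generic_set {p : ℂ} (hp : p ≠ 0) {n : ℕ} (z lam : Fin n → ℂ) :
    ∃ T : Set ℂ, T.Infinite ∧ ∀ (l : ℕ) (x : Fin l → ℂ), Function.Injective x →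
      (∀ i, x i ∈ T) → ∃ t : Fin l → ℂ, Generic p z lam t ∧ pts p t = x := by
  have := infinite_quotient_periods p
  let F : Set (ℂ ⧸ periods p) := Set.range fun b => QuotientAddGroup.mk (z b + lam b)
  have hF : F.Finite := Set.finite_range _
  have hmk : ∀ c : ℂ ⧸ periods p, QuotientAddGroup.mk c.out = c := fun c =>
    QuotientAddGroup.out_eq' c
  refine ⟨(fun c : ℂ ⧸ periods p => qpow p (2 * c.out)) '' Fᶜ,
    hF.infinite_compl.image fun c _ c' _ hcc => ?_, fun l x hx hxT => ?_⟩
  · by_contra hne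
    refine sn_ne_zero_of_mk_ne hp (x := c.out) (y := c'.out) (by rwa [hmk, hmk]) 0 ?_
    rw [Int.cast_zero, add_zero]
    exact (sn_sub_eq_zero_iff _ _ _).2 hcc
  · choose c hc hcx using hxT
    refine ⟨fun i => (c i).out, ⟨fun a b hab j => ?_, fun a b j => ?_⟩, funext hcx⟩
    · refine sn_ne_zero_of_mk_ne hp ?_ j
      rw [hmk, hmk]
      intro h
      refine hab (hx ?_)
      rw [← hcx, ← hcx, h]
    · rw [sub_sub]
      refine sn_ne_zero_of_mk_ne hp ?_ j
      rw [hmk]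
      exact fun h => hc a ⟨b, h.symm⟩

/-! ### The trigonometric hypergeometric space and symmetric polynomials -/

theorem wtd_evAt (p : ℂ) {n : ℕ} (z lam : Fin n → ℂ) {l : ℕ} (P : symPoly n l)
    (t : Fin l → ℂ) :
    wtd (qpow p 1) (alp p z (-lam)) (fun Y => evAt n l Y P) (pts p t) =
      MvPolynomial.eval (fun i => qpow p (2 * t i)) (P : MvPolynomial (Fin l) ℂ) *
        ((((-2 * Complex.I) ^ n) ^ l)⁻¹ * weight p z lam l t) := by
  rw [wtd, evAt_ofFn, weight_eq, inv_mul_cancel_left₀ (by simp), prod_map_ofFn,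
    ← Finset.prod_inv_distrib]
  rfl

/-- The element of `𝔉^q_l(z, λ)` given by a symmetric polynomial. -/
def toSpace (p : ℂ) {n : ℕ} (z lam : Fin n → ℂ) (l : ℕ) : symPoly n l →ₗ[ℂ] space p z lam l where
  toFun P := ⟨fun t => wtd (qpow p 1) (alp p z (-lam)) (fun Y => evAt n l Y P) (pts p t), by
    obtain ⟨h1, h2⟩ := ((((-2 * Complex.I) ^ n) ^ l)⁻¹ • P).2
    refine ⟨_, h1, h2, funext fun t => ?_⟩
    rw [wtd_evAt, Submodule.coe_smul, MvPolynomial.smul_eval]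
    ring⟩
  map_add' P Q := by
    ext t
    simp [wtd, add_mul]
  map_smul' c P := by
    ext t
    simp [wtd, mul_assoc]

theorem toSpace_apply (p : ℂ) {n : ℕ} (z lam : Fin n → ℂ) {l : ℕ} (P : symPoly n l)
    (t : Fin l → ℂ) : (toSpace p z lam l P : (Fin l → ℂ) → ℂ) t =
      wtd (qpow p 1) (alp p z (-lam)) (fun Y => evAt n l Y P) (pts p t) := rfl

/-- The weight does not vanish at generic points, and these are numerous enough to detect a
polynomial. For surjectivity, the polynomial only has to absorb the constant in `weight_eq`. -/
theorem toSpace_bijective {p : ℂ} (hp : p ≠ 0) {n : ℕ} (z lam : Fin n → ℂ) (l : ℕ) :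
    Function.Bijective (toSpace p z lam l) := by
  constructor
  · rw [injective_iff_map_eq_zero]
    intro P hP
    obtain ⟨T, hT, hT'⟩ := exists_generic_set hp z lam
    refine Subtype.ext (mvPolynomial_eq_of_injective hT fun x hx hxT => ?_)
    obtain ⟨t, ht, rfl⟩ := hT' l x hx hxT
    have h := congrArg (fun f : space p z lam l => (f : (Fin l → ℂ) → ℂ) t) hP
    simp only [toSpace_apply, wtd] at h
    rw [evAt_ofFn] at h
    have h2 := (mul_eq_zero.1 h).resolve_right (mul_ne_zero (inv_ne_zero ?_) ht.apart.om_ne_zero)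
    · simpa using h2
    · rw [prod_map_ofFn]
      exact Finset.prod_ne_zero_iff.2 fun a _ => ht.alp_ne_zero a
  · rintro ⟨f, P, h1, h2, rfl⟩
    refine ⟨((-2 * Complex.I) ^ n) ^ l • (⟨P, h1, h2⟩ : symPoly n l), Subtype.ext (funext fun t => ?_)⟩
    rw [toSpace_apply, wtd_evAt, Submodule.coe_smul, MvPolynomial.smul_eval]
    have : (((-2 * Complex.I) ^ n) ^ l : ℂ) ≠ 0 := by simp
    field_simp

/-- Symmetric polynomials parametrize `𝔉^q(z, λ)`. -/
def spaceEquiv {p : ℂ} (hp : p ≠ 0) {n : ℕ} (z lam : Fin n → ℂ) :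
    PolySpace n ≃ₗ[ℂ] Space p z lam :=
  DFinsupp.mapRange.linearEquiv fun l => LinearEquiv.ofBijective _ (toSpace_bijective hp z lam l)

theorem spaceEquiv_ofPoly {p : ℂ} (hp : p ≠ 0) {n : ℕ} (z lam : Fin n → ℂ) {l : ℕ}
    (P : symPoly n l) :
    spaceEquiv hp z lam (ofPoly n l P) = incl p z lam l (toSpace p z lam l P) :=
  DFinsupp.mapRange_single (hf := fun i => map_zero (toSpace p z lam i))

/-- A zero means q^(±2u) = q^(±2v), and the right side is a fixed nonzero number while the left side
tends to 0. -/
theorem eventually_sn_ne_zero (p : ℂ) (ε : ℤˣ) (v : ℂ) :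
    ∀ᶠ u in Filter.comap (fun u => qpow p (2 * ((ε : ℤ) : ℂ) * u)) (𝓝 0), sn p (u - v) ≠ 0 := by
  have h : ∀ᶠ w : ℂ in 𝓝 0, w ≠ qpow p (2 * ((ε : ℤ) : ℂ) * v) :=
    eventually_ne_nhds (qpow_ne_zero _ _).symm
  refine (h.comap _).mono fun u hu h0 => hu ?_
  rw [sn_sub_eq_zero_iff] at h0
  rcases Int.units_eq_one_or ε with rfl | rfl
  · simpa using h0
  · simpa [qpow_neg] using h0

theorem eventually_away (p : ℂ) (ε : ℤˣ) {l : ℕ} (t : Fin l → ℂ) :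
    ∀ᶠ u in Filter.comap (fun u => qpow p (2 * ((ε : ℤ) : ℂ) * u)) (𝓝 0), Away p t u := by
  refine Filter.eventually_all.2 fun a => ?_
  filter_upwards [eventually_sn_ne_zero p ε (t a), eventually_sn_ne_zero p ε (t a + 1),
    eventually_sn_ne_zero p ε (t a - 1)] with u h1 h2 h3
  exact ⟨h1, by rwa [sub_sub], by rwa [sub_add]⟩

theorem eventually_alp_ne_zero (p : ℂ) {n : ℕ} (z lam : Fin n → ℂ) (ε : ℤˣ) :
    ∀ᶠ u in Filter.comap (fun u => qpow p (2 * ((ε : ℤ) : ℂ) * u)) (𝓝 0),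
      alp p z (-lam) (qpow p (2 * u)) ≠ 0 := by
  have h : ∀ᶠ u in Filter.comap (fun u => qpow p (2 * ((ε : ℤ) : ℂ) * u)) (𝓝 0),
      ∀ b, sn p (u - (z b + lam b)) ≠ 0 :=
    Filter.eventually_all.2 fun b => eventually_sn_ne_zero p ε _
  exact h.mono fun u hu => alp_neg_ne_zero fun b => by rw [sub_sub]; exact hu b

/-- The factor relating the modes at infinity with those at zero. -/
def twist (p : ℂ) {n : ℕ} (z : Fin n → ℂ) : ℂ := (-1) ^ n * qpow p (2 * ∑ a, z a)

/-- The prefactor cancels 1/d(ξ), so the series is a finite sum of modes. For ε = -1 the factor ξ^n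
in the prefactor reverses the order of the modes, and `twist` removes the remaining constant. -/
theorem expansion_of_modes {p : ℂ} {n : ℕ} {z lam : Fin n → ℂ}
    {K : (Multiset ℂ → ℂ) → ℂ → Multiset ℂ → ℂ} {k : ℕ → ℕ} (T : Modes n K k) {l : ℕ}
    (P : symPoly n l) {F : ℂ → (Fin (k l) → ℂ) → ℂ}
    (hF : ∀ t u, Generic p z lam t → Away p t u → alp p z (-lam) (qpow p (2 * u)) ≠ 0 →
      F u t = (alp p z (-lam) (qpow p (2 * u)))⁻¹ * wtd (qpow p 1) (alp p z (-lam))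
        (K (fun Y => evAt n l Y P) (qpow p (2 * u))) (pts p t)) (ε : ℤˣ) :
    Expansion p z lam ε F
      (fun s => toSpace p z lam (k l) (signed n (twist p z) (fun s => T.comp s l P) ε s)) := by
  intro t ht
  filter_upwards [eventually_away p ε t, eventually_alp_ne_zero p z lam ε] with u hu hdu
  have hX : (List.ofFn (pts p t) : Multiset ℂ).Nodup := nodup_ofFn.2 ht.apart.injective
  have huX : qpow p (2 * u) ∉ (List.ofFn (pts p t) : Multiset ℂ) := by
    rw [Multiset.mem_coe, List.mem_ofFn]
    rintro ⟨a, ha⟩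
    exact (hu a).1 ((sn_sub_eq_zero_iff _ _ _).2 ha.symm)
  have key : wtd (qpow p 1) (alp p z (-lam)) (K (fun Y => evAt n l Y P) (qpow p (2 * u)))
      (pts p t) = ∑ s ∈ Finset.range (n + 1), qpow p (2 * u) ^ s *
        (toSpace p z lam (k l) (T.comp s l P) : (Fin (k l) → ℂ) → ℂ) t := by
    rw [wtd, ← T.evAt_comp l P _ _ (by simp) hX huX, map_sum, Finset.sum_mul]
    refine Finset.sum_congr rfl fun s _ => ?_
    rw [map_smul, toSpace_apply, wtd, smul_eq_mul, mul_assoc]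
  rw [hF t u ht hu hdu, key]
  rcases Int.units_eq_one_or ε with rfl | rfl
  · have e : ∀ s : ℕ, prefactor p z lam 1 u *
        ((toSpace p z lam (k l) (signed n (twist p z) (fun s => T.comp s l P) 1 s) :
          (Fin (k l) → ℂ) → ℂ) t * qpow p (2 * (((1 : ℤˣ) : ℤ) : ℂ) * u) ^ s) =
        (alp p z (-lam) (qpow p (2 * u)))⁻¹ * (qpow p (2 * u) ^ s *
          (toSpace p z lam (k l) (T.comp s l P) : (Fin (k l) → ℂ) → ℂ) t) := fun s => by
      rw [prefactor_one, signed, if_pos rfl, Units.val_one, Int.cast_one, mul_one]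
      ring
    simp only [e]
    rw [Finset.mul_sum]
    refine hasSum_sum_of_ne_finset_zero fun s hs => ?_
    rw [T.comp_eq_zero s (by simpa using hs)]
    simp
  · have hne : ¬((-1 : ℤˣ) = 1) := by decide
    have hξ := qpow_ne_zero p (2 * u)
    have e : ∀ s : ℕ, s ≤ n → prefactor p z lam (-1) u *
        ((toSpace p z lam (k l) (signed n (twist p z) (fun s => T.comp s l P) (-1) s) :
          (Fin (k l) → ℂ) → ℂ) t * qpow p (2 * (((-1 : ℤˣ) : ℤ) : ℂ) * u) ^ s) =
        (alp p z (-lam) (qpow p (2 * u)))⁻¹ * (qpow p (2 * u) ^ (n - s) *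
          (toSpace p z lam (k l) (T.comp (n - s) l P) : (Fin (k l) → ℂ) → ℂ) t) := fun s hs => by
      rw [prefactor_neg_one, signed, if_neg hne, if_pos hs, map_smul, pow_sub₀ _ hξ hs,
        Units.val_neg, Units.val_one, Int.cast_neg, Int.cast_one, mul_neg_one, neg_mul, qpow_neg,
        neg_mul, qpow_neg, inv_pow, twist]
      have h1 : ((-1 : ℂ) ^ n) * (-1) ^ n = 1 := by rw [← mul_pow]; simp
      have h2 := qpow_ne_zero p (2 * ∑ a, z a)
      simp only [Submodule.coe_smul, Pi.smul_apply, smul_eq_mul]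
      field_simp
      linear_combination (toSpace p z lam (k l) (T.comp (n - s) l P) : (Fin (k l) → ℂ) → ℂ) t * h1
    rw [Finset.mul_sum, ← Finset.sum_range_reflect]
    have e2 : ∀ s ∈ Finset.range (n + 1), (alp p z (-lam) (qpow p (2 * u)))⁻¹ *
        (qpow p (2 * u) ^ (n + 1 - 1 - s) *
          (toSpace p z lam (k l) (T.comp (n + 1 - 1 - s) l P) : (Fin (k l) → ℂ) → ℂ) t) = _ :=
      fun s hs => (e s (by simpa [Nat.lt_succ_iff] using hs)).symm
    rw [Finset.sum_congr rfl e2]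
    refine hasSum_sum_of_ne_finset_zero fun s hs => ?_
    rw [signed, if_neg hne, if_neg (by simpa [Nat.lt_succ_iff] using hs), map_zero]
    simp

/-! ### The module structure on `𝔉^q(z, λ)` -/

theorem alp_polyOff (p : ℂ) {n : ℕ} (z lam : Fin n → ℂ) : PolyOff (n + 1) ∅ (alp p z lam) := by
  refine ⟨∏ a, (Polynomial.C (qpow p (-lam a)) -
    Polynomial.C (qpow p (lam a - 2 * z a)) * Polynomial.X), ?_, fun w _ => ?_⟩
  · rw [Polynomial.mem_degreeLT]
    refine (Polynomial.degree_prod_le _ _).trans_lt ?_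
    refine (Finset.sum_le_sum fun a _ => (show _ ≤ (1 : WithBot ℕ) from ?_)).trans_lt ?_
    · refine (Polynomial.degree_sub_le _ _).trans (max_le ?_ (Polynomial.degree_C_mul_X_le _))
      exact Polynomial.degree_C_le.trans zero_le_one
    · simp only [Finset.sum_const, Finset.card_univ, Fintype.card_fin, nsmul_eq_mul, mul_one]
      exact_mod_cast Nat.lt_succ_self n
  · simp [Polynomial.eval_prod, alp]

theorem alp_lead (p : ℂ) {n : ℕ} (z lam : Fin n → ℂ) :
    Lead n (alp p z lam) (∏ a, -qpow p (lam a - 2 * z a)) := by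
  have h := Lead.of_eventually (n := n) (f := alp p z lam)
    (F := fun w => ∏ a, (qpow p (-lam a) * w - qpow p (lam a - 2 * z a))) (by fun_prop) (by
      filter_upwards [self_mem_nhdsWithin] with w hw
      have e : w ^ n = ∏ _a : Fin n, w := by simp
      rw [alp, e, ← Finset.prod_mul_distrib]
      refine Finset.prod_congr rfl fun a _ => ?_
      have hw' : w ≠ 0 := hw
      field_simp)
  simpa using h

theorem alp_zero (p : ℂ) {n : ℕ} (z lam : Fin n → ℂ) :
    alp p z lam 0 = ∏ a, qpow p (-lam a) := by
  simp [alp]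

/-- Constant and leading coefficients of α are products of q^(-λ_a) and of -q^(λ_a - 2z_a). In their
product λ drops out, so the same `twist` serves α and d, and also the parameters λ'. -/
theorem normalized_alp (p : ℂ) {n : ℕ} (z lam : Fin n → ℂ) :
    Normalized n (alp p z lam) (alp p z (-lam)) (twist p z) := by
  have h : ∀ lam : Fin n → ℂ,
      alp p z lam 0 * (twist p z * ∏ a, -qpow p (lam a - 2 * z a)) = 1 := fun lam => by
    have e : twist p z = ∏ a, (-1 * qpow p (2 * z a)) := by
      rw [twist, Finset.mul_sum, qpow_sum, Finset.prod_mul_distrib]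
      simp
    rw [alp_zero, e, ← Finset.prod_mul_distrib, ← Finset.prod_mul_distrib]
    refine Finset.prod_eq_one fun a _ => ?_
    have h1 := qpow_ne_zero p (lam a)
    have h2 := qpow_ne_zero p (2 * z a)
    rw [qpow_neg, qpow_sub]
    field_simp
  refine ⟨?_, _, _, alp_lead p z lam, alp_lead p z (-lam), h lam, h (-lam)⟩
  rw [alp_zero, alp_zero, ← Finset.prod_mul_distrib]
  refine Finset.prod_eq_one fun a _ => ?_
  rw [← qpow_add, Pi.neg_apply, add_neg_cancel, qpow_zero]

/-- The operators on symmetric polynomials for the parameters `z, λ`. -/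
abbrev TrigData (p : ℂ) {n : ℕ} (z lam : Fin n → ℂ) : Type :=
  OperatorData n (qpow p 1) (alp p z lam) (alp p z (-lam))

theorem nonempty_trigData (p : ℂ) {n : ℕ} (z lam : Fin n → ℂ) : Nonempty (TrigData p z lam) :=
  nonempty_operatorData (qpow_ne_zero p 1) (alp_polyOff p z lam) (alp_polyOff p z (-lam))

/-- The representation of `U_q gl̂(2)` on `𝔉^q(z, λ)`. -/
def spaceRep {p : ℂ} (hp : p ≠ 0) {n : ℕ} {z lam : Fin n → ℂ} (S : TrigData p z lam) :
    Uq (qpow p 1) →ₐ[ℂ] Module.End ℂ (Space p z lam) :=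
  ((spaceEquiv hp z lam).conjAlgEquiv ℂ : Module.End ℂ (PolySpace n) →ₐ[ℂ] _).comp
    (S.rep (normalized_alp p z lam))

section

variable {p : ℂ} (hp : p ≠ 0) {n : ℕ} {z lam : Fin n → ℂ} (S : TrigData p z lam)

theorem spaceRep_apply (x : Uq (qpow p 1)) (m : PolySpace n) :
    spaceRep hp S x (spaceEquiv hp z lam m) =
      spaceEquiv hp z lam (S.rep (normalized_alp p z lam) x m) := by
  change spaceEquiv hp z lam (S.rep (normalized_alp p z lam) x
    ((spaceEquiv hp z lam).symm (spaceEquiv hp z lam m))) = _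
  rw [LinearEquiv.symm_apply_apply]

theorem spaceRep_uqL (ε : ℤˣ) (s : ℕ) (i j : Fin 2)
    {K : (Multiset ℂ → ℂ) → ℂ → Multiset ℂ → ℂ} {k : ℕ → ℕ} (T : Modes n K k)
    (hT : ∀ s, S.mode s i j = T.op s) {l : ℕ} (P : symPoly n l) :
    spaceRep hp S (uqL _ ε s i j) (incl p z lam l (toSpace p z lam l P)) =
      incl p z lam (k l) (toSpace p z lam (k l)
        (signed n (twist p z) (fun s => T.comp s l P) ε s)) := by
  rw [← spaceEquiv_ofPoly hp, spaceRep_apply, ← spaceEquiv_ofPoly hp, OperatorData.rep_uqL]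
  congr 1
  have h1 := map_signed (LinearMap.applyₗ (R := ℂ) (M₂ := PolySpace n) (ofPoly n l P)) n
    (twist p z) (fun s => S.mode s i j) ε s
  rw [map_signed]
  refine h1.trans ?_
  congr 1
  funext s
  rw [LinearMap.applyₗ_apply_apply, hT, T.op_ofPoly]

theorem spaceRep_isAction : IsAction p z lam (spaceRep hp S) where
  L11 ε l f := by
    obtain ⟨P, rfl⟩ := (toSpace_bijective hp z lam l).2 f
    refine ⟨_, fun s => spaceRep_uqL hp S ε s 0 0 S.A (fun s => rfl) P,
      expansion_of_modes S.A P (fun t u ht hu _ => ?_) ε⟩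
    exact act11_eq (φ := fun Y => evAt n l Y P) (fun s => toSpace_apply p z lam P s) ht.apart hu
      ht.alp_ne_zero
  L22 ε l f := by
    obtain ⟨P, rfl⟩ := (toSpace_bijective hp z lam l).2 f
    refine ⟨_, fun s => spaceRep_uqL hp S ε s 1 1 S.D (fun s => rfl) P,
      expansion_of_modes S.D P (fun t u ht hu hdu => ?_) ε⟩
    exact act22_eq (φ := fun Y => evAt n l Y P) (fun s => toSpace_apply p z lam P s) ht.apart hu
      ht.alp_ne_zero hdu
  L12 ε l f := by
    obtain ⟨P, rfl⟩ := (toSpace_bijective hp z lam l).2 f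
    refine ⟨_, fun s => spaceRep_uqL hp S ε s 0 1 S.B (fun s => rfl) P,
      expansion_of_modes S.B P (fun t u ht hu hdu => ?_) ε⟩
    exact act12_eq (φ := fun Y => evAt n l Y P) (fun s => toSpace_apply p z lam P s) ht.apart hu
      ht.alp_ne_zero hdu
  L21 ε l f := by
    obtain ⟨P, rfl⟩ := (toSpace_bijective hp z lam (l + 1)).2 f
    refine ⟨_, fun s => spaceRep_uqL hp S ε s 1 0 S.C (fun s => rfl) P,
      expansion_of_modes S.C P (fun t u ht hu hdu => ?_) ε⟩
    exact act21_eq (φ := fun Y => evAt n (l + 1) Y P) (fun s => toSpace_apply p z lam P s) hu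
  L21_zero ε s f := by
    obtain ⟨P, rfl⟩ := (toSpace_bijective hp z lam 0).2 f
    -- The modes formally map degree 0 to itself, but a multiset with a point inserted is never
    -- empty, so all values of the generating function vanish.
    have h : ∀ s, S.C.op s (ofPoly n 0 P) = 0 := fun s => by
      rcases lt_or_ge n s with hs | hs
      · rw [S.C.op_eq_zero hs, LinearMap.zero_apply]
      refine polySpace_ext ∅ fun X hX _ => ?_
      rw [map_zero]
      refine eq_zero_of_sum_pow_smul (N := n + 1) X.toFinset.finite_toSet.infinite_compl
        (c := fun s => evM n X (S.C.op s (ofPoly n 0 P))) (fun u hu => ?_) (by omega)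
      have h2 := S.evM_C u (ofPoly n 0 P) hX (by simpa using hu)
      rw [Modes.evM_gen_eq, evM_ofPoly, evAt_of_ne P (by simp)] at h2
      exact h2
    rw [← spaceEquiv_ofPoly hp, spaceRep_apply, OperatorData.rep_uqL]
    have h1 := map_signed (LinearMap.applyₗ (R := ℂ) (M₂ := PolySpace n) (ofPoly n 0 P)) n
      (twist p z) (fun s => S.mode s 1 0) ε s
    refine (congrArg _ (h1.trans ?_)).trans (map_zero _)
    have h2 : (fun s => LinearMap.applyₗ (R := ℂ) (M₂ := PolySpace n) (ofPoly n 0 P)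
        (S.mode s 1 0)) = fun _ => 0 := funext h
    rw [h2]
    simp [signed]

end

/-! ### Strings and intertwining operators -/

/-- A multiset `S` such that specialization of some of the variables at `S` turns the operators
with parameters `α, d` into those with parameters `α', d'`. -/
structure IsString (q : ℂ) (α d α' d' : ℂ → ℂ) (S : Multiset ℂ) : Prop where
  nodup : S.Nodup
  A_vanish : ∀ a ∈ S, α a * ((S.erase a).map fun c => hh q c a).prod = 0
  D_vanish : ∀ a ∈ S, d a * ((S.erase a).map fun c => hh q a c).prod = 0
  A_eq : ∀ u ∉ S, α u * (S.map fun c => hh q c u).prod = α' u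
  D_eq : ∀ u ∉ S, d u * (S.map fun c => hh q u c).prod = d' u

/-- Terms that exchange a string point contain a vanishing product over the rest of S. In the others
the product over S is independent of X and merges with α into α'. -/
theorem opA_string {q : ℂ} {α α' : ℂ → ℂ} {S : Multiset ℂ}
    (h0 : ∀ a ∈ S, α a * ((S.erase a).map fun c => hh q c a).prod = 0)
    (h1 : ∀ u ∉ S, α u * (S.map fun c => hh q c u).prod = α' u) {u : ℂ} (hu : u ∉ S)
    (φ : Multiset ℂ → ℂ) {X : Multiset ℂ} (hX : ∀ x ∈ X, x ∉ S) :
    opA q α u φ (S + X) = opA q α' u (fun Y => φ (S + Y)) X := by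
  unfold opA
  rw [Multiset.map_add, Multiset.map_add, Multiset.prod_add, Multiset.sum_add, ← mul_assoc (α u),
    h1 u hu]
  congr 1
  have e1 : ∀ a ∈ S, gg q u a * α a * (((S + X).erase a).map fun c => hh q c a).prod *
      φ (u ::ₘ (S + X).erase a) = 0 := fun a ha => by
    rw [Multiset.erase_add_left_pos _ ha, Multiset.map_add, Multiset.prod_add]
    linear_combination (gg q u a * (X.map fun c => hh q c a).prod *
      φ (u ::ₘ (S.erase a + X))) * h0 a ha
  rw [sum_map_congr e1, Multiset.sum_map_zero, zero_add]
  refine sum_map_congr fun a ha => ?_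
  beta_reduce
  rw [Multiset.erase_add_right_neg _ (hX a ha), Multiset.map_add, Multiset.prod_add,
    ← h1 a (hX a ha), Multiset.add_cons]
  ring

/-- In the double sum a first point in S is killed by `D_vanish`, and a second point in S by
`A_vanish`; in the single sum both are used. The factors over S that survive turn α and d into α'
and d'. -/
theorem IsString.opB_add {q : ℂ} {α d α' d' : ℂ → ℂ} {S : Multiset ℂ}
    (h : IsString q α d α' d' S) {u : ℂ} (hu : u ∉ S) (φ : Multiset ℂ → ℂ) {X : Multiset ℂ}
    (hX : ∀ x ∈ X, x ∉ S) :
    opB q α d u φ (S + X) = opB q α' d' u (fun Y => φ (S + Y)) X := by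
  unfold opB
  rw [Multiset.map_add, Multiset.map_add, Multiset.sum_add, Multiset.sum_add]
  congr 1
  · have e1 : ∀ a ∈ S, gg q u a * φ ((S + X).erase a) *
        (d u * α a * (((S + X).erase a).map fun c => hh q u c * hh q c a).prod -
          α u * d a * (((S + X).erase a).map fun c => hh q a c * hh q c u).prod) = 0 :=
      fun a ha => by
        rw [Multiset.erase_add_left_pos _ ha, Multiset.map_add, Multiset.map_add,
          Multiset.prod_add, Multiset.prod_add, Multiset.prod_map_mul (m := S.erase a),
          Multiset.prod_map_mul (m := S.erase a)]
        linear_combination (gg q u a * φ (S.erase a + X)) * (d u *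
          ((S.erase a).map fun c => hh q u c).prod *
          (X.map fun c => hh q u c * hh q c a).prod * h.A_vanish a ha -
          α u * ((S.erase a).map fun c => hh q c u).prod *
          (X.map fun c => hh q a c * hh q c u).prod * h.D_vanish a ha)
    rw [sum_map_congr e1, Multiset.sum_map_zero, zero_add]
    refine sum_map_congr fun a ha => ?_
    rw [Multiset.erase_add_right_neg _ (hX a ha), Multiset.map_add, Multiset.map_add,
      Multiset.prod_add, Multiset.prod_add, Multiset.prod_map_mul (m := S),
      Multiset.prod_map_mul (m := S), ← h.A_eq a (hX a ha), ← h.A_eq u hu,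
      ← h.D_eq a (hX a ha), ← h.D_eq u hu]
    ring
  · have e1 : ∀ a ∈ S, (((S + X).erase a).map fun b => gg q u a * gg q u b * d a * α b *
        hh q a b * ((((S + X).erase a).erase b).map fun c => hh q a c * hh q c b).prod *
        φ (u ::ₘ ((S + X).erase a).erase b)).sum = 0 := fun a ha => by
      have e2 : ∀ b ∈ (S + X).erase a, gg q u a * gg q u b * d a * α b *
          hh q a b * ((((S + X).erase a).erase b).map fun c => hh q a c * hh q c b).prod *
          φ (u ::ₘ ((S + X).erase a).erase b) = 0 := fun b hb => by
        -- The separate factor hh(a,b) completes the product over the remaining points to the one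
        -- over all of S \ a and X, which `D_vanish` annihilates wherever b lies.
        have e3 := prod_map_erase hb fun c => hh q a c
        rw [Multiset.erase_add_left_pos _ ha, Multiset.map_add, Multiset.prod_add] at e3
        rw [Multiset.prod_map_mul, Multiset.erase_add_left_pos _ ha]
        linear_combination (-gg q u a * gg q u b * d a * α b *
          (((S.erase a + X).erase b).map fun c => hh q c b).prod *
          φ (u ::ₘ (S.erase a + X).erase b)) * e3 + (gg q u a * gg q u b * α b *
          (((S.erase a + X).erase b).map fun c => hh q c b).prod *
          φ (u ::ₘ (S.erase a + X).erase b) * (X.map fun c => hh q a c).prod) * h.D_vanish a ha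
      rw [sum_map_congr e2, Multiset.sum_map_zero]
    rw [sum_map_congr e1, Multiset.sum_map_zero, zero_add]
    refine sum_map_congr fun a ha => ?_
    rw [Multiset.erase_add_right_neg _ (hX a ha), Multiset.map_add, Multiset.sum_add]
    have e2 : ∀ b ∈ S, gg q u a * gg q u b * d a * α b * hh q a b *
        (((S + X.erase a).erase b).map fun c => hh q a c * hh q c b).prod *
        φ (u ::ₘ (S + X.erase a).erase b) = 0 := fun b hb => by
      rw [Multiset.erase_add_left_pos _ hb, Multiset.map_add, Multiset.prod_add,
        Multiset.prod_map_mul (m := S.erase b)]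
      linear_combination (gg q u a * gg q u b * d a * hh q a b *
        ((S.erase b).map fun c => hh q a c).prod *
        ((X.erase a).map fun c => hh q a c * hh q c b).prod *
        φ (u ::ₘ (S.erase b + X.erase a))) * h.A_vanish b hb
    rw [sum_map_congr e2, Multiset.sum_map_zero, zero_add]
    refine sum_map_congr fun b hb => ?_
    have hb' := hX b (Multiset.mem_of_mem_erase hb)
    beta_reduce
    rw [Multiset.erase_add_right_neg _ hb', Multiset.map_add, Multiset.prod_add,
      Multiset.prod_map_mul (m := S), ← h.A_eq b hb', ← h.D_eq a (hX a ha), Multiset.add_cons]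
    ring

theorem IsString.nodup_add {q : ℂ} {α d α' d' : ℂ → ℂ} {S : Multiset ℂ}
    (h : IsString q α d α' d' S) {X : Multiset ℂ} (hX : X.Nodup) (hXS : ∀ x ∈ X, x ∉ S) :
    (S + X).Nodup :=
  Multiset.nodup_add.2 ⟨h.nodup, hX, Multiset.disjoint_left.2 fun {x} hx hx' => hXS x hx' hx⟩

theorem IsString.nodup_add_cons {q : ℂ} {α d α' d' : ℂ → ℂ} {S : Multiset ℂ}
    (h : IsString q α d α' d' S) {X : Multiset ℂ} (hX : X.Nodup) (hXS : ∀ x ∈ X, x ∉ S) {u : ℂ}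
    (hu : u ∉ S) (huX : u ∉ X) (a : ℂ) : (S + u ::ₘ X.erase a).Nodup := by
  refine h.nodup_add (Multiset.nodup_cons.2 ⟨fun h => huX (Multiset.mem_of_mem_erase h),
    hX.erase a⟩) fun x hx => ?_
  rcases Multiset.mem_cons.1 hx with rfl | hx
  · exact hu
  · exact hXS x (Multiset.mem_of_mem_erase hx)

theorem opB_congr (q : ℂ) (α d : ℂ → ℂ) {u : ℂ} {φ ψ : Multiset ℂ → ℂ} {X : Multiset ℂ}
    (h0 : ∀ a ∈ X, φ (X.erase a) = ψ (X.erase a))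
    (h1 : ∀ a ∈ X, ∀ b ∈ X.erase a,
      φ (u ::ₘ (X.erase a).erase b) = ψ (u ::ₘ (X.erase a).erase b)) :
    opB q α d u φ X = opB q α d u ψ X := by
  unfold opB
  rw [sum_map_congr fun a ha => by rw [h0 a ha],
    sum_map_congr fun a ha => sum_map_congr fun b hb => by rw [h1 a ha b hb]]

/-- The generating functions are polynomial in u, so an identity off a finite set of u passes to
every coefficient. -/
theorem Modes.intertwine {n : ℕ} {K K' : (Multiset ℂ → ℂ) → ℂ → Multiset ℂ → ℂ} {k : ℕ → ℕ}
    (T : Modes n K k) (T' : Modes n K' k) (J : Module.End ℂ (PolySpace n)) (E : Finset ℂ)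
    (h : ∀ u ∉ E, ∀ m, J (T.gen u m) = T'.gen u (J m)) (s : ℕ) (m : PolySpace n) :
    J (T.op s m) = T'.op s (J m) := by
  rcases lt_or_ge n s with hs | hs
  · simp [T.op_eq_zero hs, T'.op_eq_zero hs]
  refine polySpace_ext ∅ fun X _ _ => sub_eq_zero.1 ?_
  refine eq_zero_of_sum_pow_smul (N := n + 1) E.finite_toSet.infinite_compl
    (c := fun s => evM n X (J (T.op s m)) - evM n X (T'.op s (J m))) (fun u hu => ?_) (by omega)
  have h1 := congrArg (evM n X) (h u (by simpa using hu) m)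
  simp only [gen, LinearMap.sum_apply, LinearMap.smul_apply, map_sum, map_smul] at h1
  simp only [smul_sub, Finset.sum_sub_distrib, h1, sub_self]

namespace OperatorData

variable {n : ℕ} {q : ℂ} {α d α' d' : ℂ → ℂ} (S : OperatorData n q α d)
  (S' : OperatorData n q α' d')

/-- Specialization of some of the variables at the points of a list. -/
def spec (L : List ℂ) : Module.End ℂ (PolySpace n) := (L.map S.C.gen).prod

theorem evM_spec {L : List ℂ} (m : PolySpace n) : ∀ {X : Multiset ℂ}, ((L : Multiset ℂ) + X).Nodup →
    evM n X (S.spec L m) = evM n ((L : Multiset ℂ) + X) m := by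
  induction L with
  | nil => intro X _; simp [spec]
  | cons u L ih =>
    intro X hX
    rw [← Multiset.cons_coe, Multiset.cons_add, ← Multiset.add_cons] at hX ⊢
    have h2 := (Multiset.nodup_add.1 hX).2.1
    rw [Multiset.nodup_cons] at h2
    rw [← ih hX, ← S.evM_C u _ h2.2 h2.1]
    rfl

theorem spec_surjective (hC : ∀ u, Function.Surjective (S.C.gen u)) (L : List ℂ) :
    Function.Surjective (S.spec L) := by
  induction L with
  | nil => exact fun m => ⟨m, rfl⟩
  | cons u L ih =>
    intro m
    obtain ⟨m', rfl⟩ := hC u m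
    obtain ⟨m'', rfl⟩ := ih m'
    exact ⟨m'', rfl⟩

variable {S S'} {L : List ℂ}

/-- Compare values at X with u and X off the string: specialization evaluates at L + X, where
`opA_string` replaces the operator by the one with the new parameters. The cases D, B and C follow
the same pattern. -/
theorem spec_A (h : IsString q α d α' d' (L : Multiset ℂ)) (s : ℕ) (m : PolySpace n) :
    S.spec L (S.A.op s m) = S'.A.op s (S.spec L m) := by
  refine Modes.intertwine S.A S'.A _ L.toFinset (fun u hu m => ?_) s m
  have huL : u ∉ (L : Multiset ℂ) := by simpa using hu
  refine polySpace_ext (insert u L.toFinset) fun X hX hX' => ?_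
  have hXL : ∀ x ∈ X, x ∉ (L : Multiset ℂ) := fun x hx hxL => hX' x hx (by simpa using Or.inr hxL)
  have huX : u ∉ X := fun hu => hX' u hu (by simp)
  have hLX := h.nodup_add hX hXL
  rw [S.evM_spec _ hLX, S.evM_A u m hLX (by simpa using ⟨huL, huX⟩), S'.evM_A u _ hX huX,
    opA_string h.A_vanish h.A_eq huL _ hXL]
  refine opA_congr _ _ (S.evM_spec m hLX).symm fun a _ => (S.evM_spec m ?_).symm
  exact h.nodup_add_cons hX hXL huL huX a

theorem spec_D (h : IsString q α d α' d' (L : Multiset ℂ)) (s : ℕ) (m : PolySpace n) :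
    S.spec L (S.D.op s m) = S'.D.op s (S.spec L m) := by
  refine Modes.intertwine S.D S'.D _ L.toFinset (fun u hu m => ?_) s m
  have huL : u ∉ (L : Multiset ℂ) := by simpa using hu
  refine polySpace_ext (insert u L.toFinset) fun X hX hX' => ?_
  have hXL : ∀ x ∈ X, x ∉ (L : Multiset ℂ) := fun x hx hxL => hX' x hx (by simpa using Or.inr hxL)
  have huX : u ∉ X := fun hu => hX' u hu (by simp)
  have hLX := h.nodup_add hX hXL
  rw [S.evM_spec _ hLX, S.evM_D u m hLX (by simpa using ⟨huL, huX⟩), S'.evM_D u _ hX huX,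
    opA_string (q := q⁻¹) (by simpa only [hh_inv] using h.D_vanish)
      (by simpa only [hh_inv] using h.D_eq) huL _ hXL]
  refine opA_congr _ _ (S.evM_spec m hLX).symm fun a _ => (S.evM_spec m ?_).symm
  exact h.nodup_add_cons hX hXL huL huX a

theorem spec_B (h : IsString q α d α' d' (L : Multiset ℂ)) (s : ℕ) (m : PolySpace n) :
    S.spec L (S.B.op s m) = S'.B.op s (S.spec L m) := by
  refine Modes.intertwine S.B S'.B _ L.toFinset (fun u hu m => ?_) s m
  have huL : u ∉ (L : Multiset ℂ) := by simpa using hu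
  refine polySpace_ext (insert u L.toFinset) fun X hX hX' => ?_
  have hXL : ∀ x ∈ X, x ∉ (L : Multiset ℂ) := fun x hx hxL => hX' x hx (by simpa using Or.inr hxL)
  have huX : u ∉ X := fun hu => hX' u hu (by simp)
  have hLX := h.nodup_add hX hXL
  rw [S.evM_spec _ hLX, S.evM_B u m hLX (by simpa using ⟨huL, huX⟩), S'.evM_B u _ hX huX,
    h.opB_add huL _ hXL]
  refine opB_congr _ _ _ (fun a _ => (S.evM_spec m ?_).symm) fun a _ b _ => (S.evM_spec m ?_).symm
  · exact h.nodup_add (hX.erase a) fun x hx => hXL x (Multiset.mem_of_mem_erase hx)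
  · exact h.nodup_add_cons (hX.erase a) (fun x hx => hXL x (Multiset.mem_of_mem_erase hx)) huL
      (fun hu => huX (Multiset.mem_of_mem_erase hu)) b

theorem spec_C (h : IsString q α d α' d' (L : Multiset ℂ)) (s : ℕ) (m : PolySpace n) :
    S.spec L (S.C.op s m) = S'.C.op s (S.spec L m) := by
  refine Modes.intertwine S.C S'.C _ L.toFinset (fun u hu m => ?_) s m
  have huL : u ∉ (L : Multiset ℂ) := by simpa using hu
  refine polySpace_ext (insert u L.toFinset) fun X hX hX' => ?_
  have hXL : ∀ x ∈ X, x ∉ (L : Multiset ℂ) := fun x hx hxL => hX' x hx (by simpa using Or.inr hxL)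
  have huX : u ∉ X := fun hu => hX' u hu (by simp)
  have hLX := h.nodup_add hX hXL
  have hLX' := h.nodup_add_cons hX hXL huL huX u
  rw [Multiset.erase_of_notMem huX] at hLX'
  rw [S.evM_spec _ hLX, S.evM_C u m hLX (by simpa using ⟨huL, huX⟩), S'.evM_C u _ hX huX,
    S.evM_spec _ hLX', Multiset.add_cons]

theorem spec_mode (h : IsString q α d α' d' (L : Multiset ℂ)) (s : ℕ) (i j : Fin 2)
    (m : PolySpace n) : S.spec L (S.mode s i j m) = S'.mode s i j (S.spec L m) := by
  fin_cases i <;> fin_cases j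
  · exact spec_A h s m
  · exact spec_B h s m
  · exact spec_C h s m
  · exact spec_D h s m

theorem spec_rep (h : IsString q α d α' d' (L : Multiset ℂ)) {c : ℂ} (hc : Normalized n α d c)
    (hc' : Normalized n α' d' c) (x : Uq q) (m : PolySpace n) :
    S.spec L (S.rep hc x m) = S'.rep hc' x (S.spec L m) := by
  obtain ⟨x, rfl⟩ := RingQuot.mkAlgHom_surjective ℂ (Rel q) x
  rw [rep, rep, RingQuot.liftAlgHom_mkAlgHom_apply, RingQuot.liftAlgHom_mkAlgHom_apply]
  induction x generalizing m with
  | grade0 r => simp [Module.algebraMap_end_apply]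
  | grade1 g =>
    change S.spec L (S.repFree c (genL g.1 g.2.1 g.2.2.1 g.2.2.2) m) =
      S'.repFree c (genL g.1 g.2.1 g.2.2.1 g.2.2.2) (S.spec L m)
    rw [repFree_genL, repFree_genL]
    unfold signed
    split_ifs
    · exact spec_mode h _ _ _ m
    · rw [LinearMap.smul_apply, LinearMap.smul_apply, map_smul, spec_mode h]
    · simp
  | mul a b ha hb => rw [map_mul, map_mul, Module.End.mul_apply, Module.End.mul_apply, ha, hb]
  | add a b ha hb => rw [map_add, map_add, LinearMap.add_apply, LinearMap.add_apply, map_add, ha, hb]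

end OperatorData

/-! ### Surjectivity of specialization -/

theorem sum_map_powerset_eq {h : Multiset ℂ → ℂ} (Y : Multiset ℂ)
    (h0 : ∀ T ≤ Y, Multiset.card T < Multiset.card Y → h T = 0) :
    (Y.powerset.map h).sum = h Y := by
  induction Y using Multiset.induction generalizing h with
  | empty => simp
  | cons a Y ih =>
    rw [Multiset.powerset_cons, Multiset.map_add, Multiset.sum_add, Multiset.map_map,
      ih (h := h ∘ Multiset.cons a) fun T hT hc => h0 _ (Multiset.cons_le_cons a hT) (by simpa using hc)]
    rw [Multiset.map_congr rfl (g := fun _ => 0), Multiset.sum_map_zero, zero_add, Function.comp]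
    intro T hT
    have hT' := Multiset.mem_powerset.1 hT
    refine h0 T (hT'.trans (Multiset.le_cons_self Y a)) ?_
    have := Multiset.card_le_card hT'
    rw [Multiset.card_cons]
    omega

/-- Inclusion–exclusion: P(X) is the alternating sum over subsets T of X of Q evaluated at T padded
with copies of s. At s, X the subsets T and s, T cancel in pairs unless T = X, which contributes
Q(X). The term T = X in l + 1 variables is 0 because `evAt` vanishes for a wrong cardinality. -/
theorem exists_evAt_cons_eq {n l : ℕ} (hn : 0 < n) (s : ℂ) (Q : symPoly n l) :
    ∃ P : symPoly n (l + 1), ∀ X : Multiset ℂ, X.Nodup → s ∉ X → Multiset.card X = l →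
      evAt n (l + 1) (s ::ₘ X) P = evAt n l X Q := by
  let g : Multiset ℂ → ℂ := fun T =>
    (-1) ^ (l - Multiset.card T) * evAt n l (T + Multiset.replicate (l - Multiset.card T) s) Q
  obtain ⟨P, hP⟩ := exists_symPoly (n := n) (l := l + 1) ∅ (fun X => (X.powerset.map g).sum)
    fun X _ _ _ => by
      simp only [Multiset.powerset_cons, Multiset.map_add, Multiset.sum_add, Multiset.map_map,
        Function.comp_def]
      refine (PolyOff.const hn _).add (PolyOff.sum fun T _ => ?_)
      simp only [g, Multiset.card_cons, Multiset.cons_add]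
      exact ((evAt_cons_polyOff Q _).const_mul _).mono le_rfl (by simp)
  refine ⟨P, fun X hX hs hc => ?_⟩
  rw [hP _ (by simp [hc]) (Multiset.nodup_cons.2 ⟨hs, hX⟩) (by simp)]
  have e : ∀ T : Multiset ℂ, Multiset.card T < l → g T + g (s ::ₘ T) = 0 := fun T hT => by
    obtain ⟨r, hr⟩ : ∃ r, l - Multiset.card T = r + 1 := ⟨l - Multiset.card T - 1, by omega⟩
    have hr' : l - (Multiset.card T + 1) = r := by omega
    simp only [g, Multiset.card_cons, hr, hr', Multiset.replicate_succ, Multiset.add_cons,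
      Multiset.cons_add]
    ring
  rw [Multiset.powerset_cons, Multiset.map_add, Multiset.sum_add, Multiset.map_map,
    Function.comp_def, ← Multiset.sum_map_add, sum_map_powerset_eq X fun T hT hc' => e T (by omega)]
  have e1 : g X = evAt n l X Q := by simp [g, hc]
  have e2 : g (s ::ₘ X) = 0 := by
    simp only [g]
    rw [evAt_of_ne, mul_zero]
    simp [hc]
  rw [e1, e2, add_zero]

theorem OperatorData.C_gen_surjective {n : ℕ} {q : ℂ} {α d : ℂ → ℂ} (S : OperatorData n q α d)
    (hn : 0 < n) (s : ℂ) : Function.Surjective (S.C.gen s) := by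
  rw [← LinearMap.range_eq_top, eq_top_iff]
  intro m _
  induction m using DirectSum.induction_on with
  | zero => exact zero_mem _
  | of l Q =>
    obtain ⟨P, hP⟩ := exists_evAt_cons_eq hn s Q
    refine ⟨ofPoly n (l + 1) P, ?_⟩
    change _ = ofPoly n l Q
    refine polySpace_ext {s} fun X hX hX' => ?_
    have hs : s ∉ X := fun hs => hX' s hs (by simp)
    rw [S.evM_C s _ hX hs, evM_ofPoly, evM_ofPoly]
    by_cases hc : Multiset.card X = l
    · exact hP X hX hs hc
    · rw [evAt_of_ne _ hc, evAt_of_ne]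
      simpa using hc
  | add m m' h h' => exact add_mem (h trivial) (h' trivial)

/-! ### The string of a spin representation -/

theorem prod_range_div_of_ne_zero (f : ℕ → ℂ) {k : ℕ} (h : ∀ j, 0 < j → j ≤ k → f j ≠ 0) :
    ∏ j ∈ Finset.range (k + 1), f j / f (j + 1) = f 0 / f (k + 1) := by
  induction k with
  | zero => simp
  | succ k ih =>
    rw [Finset.prod_range_succ, ih fun j h0 h1 => h j h0 (by omega)]
    have := h (k + 1) (by omega) le_rfl
    field_simp

/-- The points `x, x - 1, …, x - k`. -/
def stringPt (x : ℂ) (k : ℕ) : Fin (k + 1) → ℂ := fun a => x - (a : ℕ)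

theorem stringPt_apart {p : ℂ} (hp : ∀ r : ℚ, p ≠ (r : ℂ)) (x : ℂ) (k : ℕ) {a b : Fin (k + 1)}
    (hab : a ≠ b) : sn p (stringPt x k a - stringPt x k b) ≠ 0 := by
  have : stringPt x k a - stringPt x k b = (((b : ℕ) : ℤ) - ((a : ℕ) : ℤ) : ℤ) := by
    simp only [stringPt]
    push_cast
    ring
  rw [this]
  refine sn_int_ne_zero hp fun h => hab (Fin.ext ?_)
  omega

theorem stringPt_injective {p : ℂ} (hp : ∀ r : ℚ, p ≠ (r : ℂ)) (x : ℂ) (k : ℕ) :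
    Function.Injective (pts p (stringPt x k)) := fun a b hab => by
  by_contra hne
  exact stringPt_apart hp x k hne ((sn_sub_eq_zero_iff p _ _).2 hab)

section

variable {n : ℕ} [NeZero n] {p : ℂ}

/-- Only the first factor of the product changes; stated by cross-multiplication to avoid dividing
by zeros. -/
theorem alp_update_ratio (z mu : Fin n → ℂ) (c x : ℂ) :
    alp p z (Function.update mu 0 c) (qpow p (2 * x)) * sn p (x - z 0 + mu 0) =
      alp p z mu (qpow p (2 * x)) * sn p (x - z 0 + c) := by
  rw [alp_qpow, alp_qpow, ← Finset.mul_prod_erase _ _ (Finset.mem_univ (0 : Fin n)),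
    ← Finset.mul_prod_erase _ _ (Finset.mem_univ (0 : Fin n)), Function.update_self]
  have e : ∏ a ∈ Finset.univ.erase (0 : Fin n), (-2 * Complex.I * qpow p (x - z a) *
      sn p (x - z a + Function.update mu 0 c a)) =
      ∏ a ∈ Finset.univ.erase (0 : Fin n), (-2 * Complex.I * qpow p (x - z a) *
        sn p (x - z a + mu a)) :=
    Finset.prod_congr rfl fun a ha => by
      rw [Function.update_of_ne (Finset.ne_of_mem_erase ha)]
  rw [e]
  ring

theorem alp_zero_update (z mu : Fin n → ℂ) (c : ℂ) :
    alp p z (Function.update mu 0 c) 0 * qpow p c = alp p z mu 0 * qpow p (mu 0) := by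
  rw [alp_zero, alp_zero, ← Finset.mul_prod_erase _ _ (Finset.mem_univ (0 : Fin n)),
    ← Finset.mul_prod_erase _ _ (Finset.mem_univ (0 : Fin n)), Function.update_self]
  have e : ∏ a ∈ Finset.univ.erase (0 : Fin n), qpow p (-Function.update mu 0 c a) =
      ∏ a ∈ Finset.univ.erase (0 : Fin n), qpow p (-mu a) :=
    Finset.prod_congr rfl fun a ha => by
      rw [Function.update_of_ne (Finset.ne_of_mem_erase ha)]
  have h1 := qpow_ne_zero p c
  have h2 := qpow_ne_zero p (mu 0)
  rw [e, qpow_neg, qpow_neg]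
  field_simp

theorem neg_lamPrime (lam : Fin n → ℂ) : -lamPrime lam = Function.update (-lam) 0 (lam 0 + 1) := by
  funext a
  by_cases h : a = 0
  · subst h
    simp [lamPrime]
    ring
  · simp [lamPrime, h]

/-- Consecutive points of the string differ by 1, so the products of sine quotients telescope. -/
theorem prod_hh_string (p x u : ℂ) (k : ℕ) (hu : ∀ j : ℕ, j ≤ k → sn p (u - (x - j)) ≠ 0) :
    ((List.ofFn (pts p (stringPt x k)) : Multiset ℂ).map fun c =>
      hh (qpow p 1) c (qpow p (2 * u))).prod = sn p (u - x - 1) / sn p (u - x + k) ∧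
    ((List.ofFn (pts p (stringPt x k)) : Multiset ℂ).map fun c =>
      hh (qpow p 1) (qpow p (2 * u)) c).prod = sn p (u - x + k + 1) / sn p (u - x) := by
  rw [prod_map_ofFn, prod_map_ofFn]
  have e1 : ∀ t, hh (qpow p 1) (qpow p (2 * t)) (qpow p (2 * u)) =
      sn p (u - t - 1) / sn p (u - t) := hh_qpow' p u
  have e2 : ∀ t, hh (qpow p 1) (qpow p (2 * u)) (qpow p (2 * t)) =
      sn p (u - t + 1) / sn p (u - t) := hh_qpow p u
  simp only [pts, stringPt, e1]
  simp only [e2]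
  rw [Fin.prod_univ_eq_prod_range (fun j : ℕ => sn p (u - (x - j) - 1) / sn p (u - (x - j))),
    Fin.prod_univ_eq_prod_range (fun j : ℕ => sn p (u - (x - j) + 1) / sn p (u - (x - j)))]
  constructor
  · have h := prod_range_div_of_ne_zero (fun j => sn p (u - x + j - 1)) (k := k) fun j h0 hj => by
      obtain ⟨i, rfl⟩ : ∃ i, j = i + 1 := ⟨j - 1, by omega⟩
      convert hu i (by omega) using 2
      push_cast
      ring
    convert h using 1
    · refine Finset.prod_congr rfl fun j _ => ?_
      push_cast
      congr 2 <;> ring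
    · push_cast
      congr 2 <;> ring
  · have h := prod_range_div_of_ne_zero (fun j => sn p (u - x + j)) (k := k) fun j h0 hj => by
      convert hu j hj using 2
      ring
    rw [← inv_inj, ← Finset.prod_inv_distrib, inv_div]
    simp only [inv_div]
    convert h using 1
    · refine Finset.prod_congr rfl fun j _ => ?_
      push_cast
      congr 2 <;> ring
    · push_cast
      congr 2 <;> ring

/-- A string point is annihilated by its neighbour, since hh vanishes at arguments one step apart.
The end without the required neighbour is covered by a zero: α vanishes at z₁ + λ₁ - k = z₁ - λ₁ and
d at z₁ + λ₁. The telescoped products exchange the first sine factors of α and d for those with -λ₁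
- 1. -/
theorem isString_stringPt (hp : ∀ r : ℚ, p ≠ (r : ℂ)) {z lam : Fin n → ℂ} {k : ℕ}
    (hk : 2 * lam 0 = (k : ℂ)) : IsString (qpow p 1) (alp p z lam) (alp p z (-lam))
    (alp p z (lamPrime lam)) (alp p z (-lamPrime lam))
    (List.ofFn (pts p (stringPt (z 0 + lam 0) k)) : Multiset ℂ) := by
  have hp0 : p ≠ 0 := by simpa using hp 0
  have hinj := stringPt_injective hp (z 0 + lam 0) k
  have h00 : sn p 0 = 0 := (sn_eq_zero_iff hp0 0).2 ⟨0, by simp⟩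
  have hmem : ∀ i, pts p (stringPt (z 0 + lam 0) k) i ∈
      (List.ofFn (pts p (stringPt (z 0 + lam 0) k)) : Multiset ℂ) := fun i =>
    Multiset.mem_coe.2 ((List.mem_ofFn' _ _).2 ⟨i, rfl⟩)
  have key : ∀ F : ℂ → ℂ → ℂ, ∀ i j, i ≠ j →
      F (pts p (stringPt (z 0 + lam 0) k) i) (pts p (stringPt (z 0 + lam 0) k) j) = 0 →
      (((List.ofFn (pts p (stringPt (z 0 + lam 0) k)) : Multiset ℂ).erase
        (pts p (stringPt (z 0 + lam 0) k) i)).map fun c =>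
          F (pts p (stringPt (z 0 + lam 0) k) i) c).prod = 0 := fun F i j hij hF => by
    refine Multiset.prod_eq_zero (Multiset.mem_map.2 ⟨_, ?_, hF⟩)
    exact (Multiset.mem_erase_of_ne (hinj.ne hij.symm)).2 (hmem j)
  have hex : ∀ a ∈ (List.ofFn (pts p (stringPt (z 0 + lam 0) k)) : Multiset ℂ),
      ∃ i, pts p (stringPt (z 0 + lam 0) k) i = a := fun a ha => by
    exact (List.mem_ofFn' _ _).1 (Multiset.mem_coe.1 ha)
  have hu' : ∀ u, qpow p (2 * u) ∉ (List.ofFn (pts p (stringPt (z 0 + lam 0) k)) : Multiset ℂ) →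
      ∀ j : ℕ, j ≤ k → sn p (u - (z 0 + lam 0 - j)) ≠ 0 := fun u hu j hj h0 => by
    rw [sn_sub_eq_zero_iff] at h0
    refine hu ?_
    rw [h0]
    exact hmem ⟨j, by omega⟩
  refine ⟨nodup_ofFn.2 hinj, fun a ha => ?_, fun a ha => ?_, fun u hu => ?_, fun u hu => ?_⟩
  · obtain ⟨i, rfl⟩ := hex a ha
    refine Fin.lastCases ?_ (fun i => ?_) i
    · rw [pts, alp_qpow, Finset.prod_eq_zero (Finset.mem_univ 0), zero_mul]
      rw [show stringPt (z 0 + lam 0) k (Fin.last k) - z 0 + lam 0 = 0 by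
        simp only [stringPt, Fin.val_last]
        linear_combination hk, h00, mul_zero]
    · rw [key (fun a c => hh (qpow p 1) c a) _ i.succ (Fin.castSucc_lt_succ).ne, mul_zero]
      simp only [pts]
      rw [hh_qpow, show stringPt (z 0 + lam 0) k i.succ - stringPt (z 0 + lam 0) k i.castSucc + 1 = 0
        by simp only [stringPt, Fin.val_succ, Fin.val_castSucc]; push_cast; ring, h00, zero_div]
  · obtain ⟨i, rfl⟩ := hex a ha
    refine Fin.cases ?_ (fun i => ?_) i
    · rw [pts, alp_neg_qpow, Finset.prod_eq_zero (Finset.mem_univ 0), zero_mul]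
      rw [show stringPt (z 0 + lam 0) k 0 - z 0 - lam 0 = 0 by
        simp [stringPt], h00, mul_zero]
    · rw [key (fun a c => hh (qpow p 1) a c) _ i.castSucc (Fin.castSucc_lt_succ).ne', mul_zero]
      simp only [pts]
      rw [hh_qpow, show stringPt (z 0 + lam 0) k i.succ - stringPt (z 0 + lam 0) k i.castSucc + 1 = 0
        by simp only [stringPt, Fin.val_succ, Fin.val_castSucc]; push_cast; ring, h00, zero_div]
  -- The value u = 0 is not of the form q^(2v) and is checked directly: each factor hh(c,0) equals
  -- q.
  · rcases eq_or_ne u 0 with rfl | hu0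
    · have e : ∀ i, hh (qpow p 1) (pts p (stringPt (z 0 + lam 0) k) i) 0 = qpow p 1 := fun i => by
        have := qpow_ne_zero p (2 * stringPt (z 0 + lam 0) k i)
        simp [hh, pts, this]
      rw [prod_map_ofFn, Finset.prod_congr rfl fun i _ => e i, Finset.prod_const, Finset.card_univ,
        Fintype.card_fin, ← qpow_nat_mul, lamPrime]
      refine mul_right_cancel₀ (qpow_ne_zero p (-lam 0 - 1)) ?_
      rw [alp_zero_update, mul_assoc, ← qpow_add]
      congr 2
      push_cast
      linear_combination -hk
    · obtain ⟨v, rfl⟩ := exists_qpow_two_mul hp0 hu0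
      have h1 := alp_update_ratio (p := p) z lam (-lam 0 - 1) v
      have h2 := hu' v hu k le_rfl
      rw [(prod_hh_string p _ v k (hu' v hu)).1, lamPrime]
      rw [show v - (z 0 + lam 0 - k) = v - z 0 + lam 0 by linear_combination -hk] at h2
      rw [show v - (z 0 + lam 0) + k = v - z 0 + lam 0 by linear_combination -hk, mul_div_assoc',
        div_eq_iff h2, h1]
      congr 2
      ring
  · rcases eq_or_ne u 0 with rfl | hu0
    · have e : ∀ i, hh (qpow p 1) 0 (pts p (stringPt (z 0 + lam 0) k) i) = qpow p (-1) := fun i => by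
        have := qpow_ne_zero p (2 * stringPt (z 0 + lam 0) k i)
        simp [hh, pts, this, qpow_neg]
      rw [prod_map_ofFn, Finset.prod_congr rfl fun i _ => e i, Finset.prod_const, Finset.card_univ,
        Fintype.card_fin, ← qpow_nat_mul, neg_lamPrime]
      refine mul_right_cancel₀ (qpow_ne_zero p (lam 0 + 1)) ?_
      rw [alp_zero_update, mul_assoc, ← qpow_add]
      congr 2
      simp only [Pi.neg_apply]
      push_cast
      linear_combination hk
    · obtain ⟨v, rfl⟩ := exists_qpow_two_mul hp0 hu0
      have h1 := alp_update_ratio (p := p) z (-lam) (lam 0 + 1) v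
      have h2 := hu' v hu 0 (by omega)
      rw [(prod_hh_string p _ v k (hu' v hu)).2, neg_lamPrime]
      rw [Nat.cast_zero, sub_zero] at h2
      rw [mul_div_assoc', div_eq_iff h2]
      rw [show v - (z 0 + lam 0) = v - z 0 + (-lam) 0 by simp; ring, h1]
      congr 2
      simp only [Pi.neg_apply]
      linear_combination -hk

end

/-! ### The evaluation map -/

@[fun_prop]
theorem continuous_sn (p : ℂ) : Continuous (sn p) := by
  unfold sn
  fun_prop

@[fun_prop]
theorem continuous_qpow (p : ℂ) : Continuous (qpow p) := by
  unfold qpow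
  fun_prop

theorem om_append (q : ℂ) {l m : ℕ} (x : Fin l → ℂ) (y : Fin m → ℂ) :
    om q (Fin.append x y) = om q x * om q y * ∏ a, ∏ b, (hh q (x a) (y b))⁻¹ := by
  have h1 : ∀ (a : Fin l) (b : Fin m), Fin.castAdd m a < Fin.natAdd l b := fun a b => by
    rw [Fin.lt_def, Fin.val_castAdd, Fin.val_natAdd]
    omega
  have h2 : ∀ (a : Fin l) (b : Fin m), ¬ Fin.natAdd l b < Fin.castAdd m a :=
    fun a b => (h1 a b).not_gt
  have h3 : ∀ a b : Fin l, Fin.castAdd m a < Fin.castAdd m b ↔ a < b := fun a b => Iff.rfl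
  have h4 : ∀ a b : Fin m, Fin.natAdd l a < Fin.natAdd l b ↔ a < b := fun a b => by
    rw [Fin.lt_def, Fin.lt_def, Fin.val_natAdd, Fin.val_natAdd]
    omega
  simp only [om, Fin.prod_univ_add, Fin.append_left, Fin.append_right, h1, h2, h3, h4, if_true,
    if_false, Finset.prod_const_one, Finset.prod_mul_distrib]
  ring

theorem coe_ofFn_append {l m : ℕ} (x : Fin l → ℂ) (y : Fin m → ℂ) :
    (List.ofFn (Fin.append x y) : Multiset ℂ) = (List.ofFn x : Multiset ℂ) + (List.ofFn y : Multiset ℂ) := by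
  rw [List.ofFn_fin_append, Multiset.coe_add]

theorem pts_append (p : ℂ) {l m : ℕ} (s : Fin l → ℂ) (t : Fin m → ℂ) :
    pts p (Fin.append s t) = Fin.append (pts p s) (pts p t) := by
  funext a
  refine Fin.addCases (fun a => ?_) (fun a => ?_) a <;> simp [pts]

theorem wtd_append_cons (q : ℂ) (d : ℂ → ℂ) (φ : Multiset ℂ → ℂ) {l m : ℕ} (v : ℂ)
    (x : Fin l → ℂ) (y : Fin m → ℂ) :
    wtd q d φ (Fin.append (Fin.cons v x : Fin (l + 1) → ℂ) y) =
      φ (v ::ₘ ((List.ofFn x : Multiset ℂ) + (List.ofFn y : Multiset ℂ))) *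
      ((d v)⁻¹ * (((List.ofFn x : Multiset ℂ).map d).prod)⁻¹ *
        (((List.ofFn y : Multiset ℂ).map d).prod)⁻¹ * ((∏ c, hh q v (x c))⁻¹ * om q x * om q y *
        ∏ a, ∏ b, (hh q ((Fin.cons v x : Fin (l + 1) → ℂ) a) (y b))⁻¹)) := by
  rw [wtd, om_append, om_cons, coe_ofFn_append, coe_ofFn_cons, Multiset.cons_add,
    Multiset.map_cons, Multiset.prod_cons, Multiset.map_add, Multiset.prod_add, mul_inv, mul_inv]
  ring

section

variable {n : ℕ} [NeZero n] {p : ℂ} {z lam : Fin n → ℂ} {k : ℕ}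

/-- The points `x - 1, …, x - k`. -/
def tailPt (x : ℂ) (k : ℕ) : Fin k → ℂ := fun a => x - ((a : ℕ) + 1)

theorem stringPt_eq_cons (x : ℂ) (k : ℕ) : stringPt x k = Fin.cons x (tailPt x k) := by
  funext a
  refine Fin.cases ?_ (fun a => ?_) a <;> simp [stringPt, tailPt]

theorem evalPoint_eq (z lam : Fin n → ℂ) (k m : ℕ) (t : Fin m → ℂ) (x : ℂ) :
    evalPoint z lam k m t x =
      Fin.append (Fin.cons x (tailPt (z 0 + lam 0) k) : Fin (k + 1) → ℂ) t := by
  rw [evalPoint]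
  congr 1
  change Function.update (stringPt (z 0 + lam 0) k) 0 x = _
  rw [stringPt_eq_cons, Fin.update_cons_zero]

/-- The factor `d(q^(2x))` without its zero at `x = z₁ + λ₁`. -/
def dReg (p : ℂ) (z lam : Fin n → ℂ) (x : ℂ) : ℂ :=
  (-2 * Complex.I * qpow p (x - z 0)) *
    ∏ a ∈ Finset.univ.erase (0 : Fin n), (-2 * Complex.I * qpow p (x - z a) * sn p (x - z a - lam a))

theorem alp_eq_dReg (p : ℂ) (z lam : Fin n → ℂ) (x : ℂ) :
    alp p z (-lam) (qpow p (2 * x)) = sn p (x - z 0 - lam 0) * dReg p z lam x := by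
  rw [alp_neg_qpow, ← Finset.mul_prod_erase _ _ (Finset.mem_univ (0 : Fin n)), dReg]
  ring

/-- The regular form of the function whose value at `z₁ + λ₁` is taken in the evaluation map. -/
def evalFun (p : ℂ) (z lam : Fin n → ℂ) (k : ℕ) (φ : Multiset ℂ → ℂ) {m : ℕ} (t : Fin m → ℂ)
    (x : ℂ) : ℂ :=
  φ (qpow p (2 * x) ::ₘ ((List.ofFn (pts p (tailPt (z 0 + lam 0) k)) : Multiset ℂ) +
    (List.ofFn (pts p t) : Multiset ℂ))) *
  ((dReg p z lam x)⁻¹ *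
    (((List.ofFn (pts p (tailPt (z 0 + lam 0) k)) : Multiset ℂ).map (alp p z (-lam))).prod)⁻¹ *
    ((∏ c, sn p (x - tailPt (z 0 + lam 0) k c)) / ∏ c, sn p (x - tailPt (z 0 + lam 0) k c + 1)) *
    om (qpow p 1) (pts p (tailPt (z 0 + lam 0) k))) *
  ((((List.ofFn (pts p t) : Multiset ℂ).map (alp p z (-lam))).prod)⁻¹ * om (qpow p 1) (pts p t) *
    (((∏ b, sn p (x - t b)) / ∏ b, sn p (x - t b - 1)) *
      ∏ c, ∏ b, (sn p (tailPt (z 0 + lam 0) k c - t b) / sn p (tailPt (z 0 + lam 0) k c - t b - 1))))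

/-- The sine in `tilde` cancels the zero of d at z₁ + λ₁. The double product in `tilde` turns each
cross factor sn(s-t) / sn(s-t+1) of the weight into sn(s-t) / sn(s-t-1). -/
theorem tilde_eq_evalFun {m : ℕ} {φ : Multiset ℂ → ℂ} {f : (Fin (k + 1 + m) → ℂ) → ℂ}
    (hf : ∀ s, f s = wtd (qpow p 1) (alp p z (-lam)) φ (pts p s)) (t : Fin m → ℂ) {x : ℂ}
    (h0 : sn p (x - z 0 - lam 0) ≠ 0) (h1 : ∀ b, sn p (x - t b + 1) ≠ 0)
    (h2 : ∀ c b, sn p (tailPt (z 0 + lam 0) k c - t b + 1) ≠ 0) :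
    tilde p z lam k m f (evalPoint z lam k m t x) = evalFun p z lam k φ t x := by
  have e : (∏ a, ∏ b, (hh (qpow p 1) ((Fin.cons (qpow p (2 * x)) (pts p (tailPt (z 0 + lam 0) k)) :
        Fin (k + 1) → ℂ) a) (pts p t b))⁻¹) * ∏ a : Fin (k + 1), ∏ b : Fin m,
        (sn p ((Fin.cons x (tailPt (z 0 + lam 0) k) : Fin (k + 1) → ℂ) a - t b + 1) /
        sn p ((Fin.cons x (tailPt (z 0 + lam 0) k) : Fin (k + 1) → ℂ) a - t b - 1)) =
      ((∏ b, sn p (x - t b)) / ∏ b, sn p (x - t b - 1)) *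
        ∏ c, ∏ b, (sn p (tailPt (z 0 + lam 0) k c - t b) /
          sn p (tailPt (z 0 + lam 0) k c - t b - 1)) := by
    rw [Fin.prod_univ_succ, Fin.prod_univ_succ, mul_mul_mul_comm, ← Finset.prod_mul_distrib,
      ← Finset.prod_div_distrib, ← Finset.prod_mul_distrib]
    congr 1
    · refine Finset.prod_congr rfl fun b _ => ?_
      have := h1 b
      rw [Fin.cons_zero, Fin.cons_zero, pts, hh_qpow, inv_div]
      field_simp
    · refine Finset.prod_congr rfl fun c _ => ?_
      rw [← Finset.prod_mul_distrib]
      refine Finset.prod_congr rfl fun b _ => ?_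
      have := h2 c b
      rw [Fin.cons_succ, Fin.cons_succ, pts, pts, hh_qpow, inv_div]
      field_simp
  have e2 : (∏ c, hh (qpow p 1) (qpow p (2 * x)) (pts p (tailPt (z 0 + lam 0) k) c))⁻¹ =
      (∏ c, sn p (x - tailPt (z 0 + lam 0) k c)) / ∏ c, sn p (x - tailPt (z 0 + lam 0) k c + 1) := by
    rw [← Finset.prod_inv_distrib, ← Finset.prod_div_distrib]
    exact Finset.prod_congr rfl fun c _ => by rw [pts, hh_qpow, inv_div]
  rw [tilde, evalPoint_eq]
  simp only [Fin.append_left, Fin.append_right]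
  rw [hf, pts_append, pts_cons, wtd_append_cons, e2, Fin.cons_zero, alp_eq_dReg, evalFun, ← e,
    mul_inv]
  field_simp

theorem continuousAt_evalFun {m : ℕ} {φ : Multiset ℂ → ℂ}
    (hφ : ∀ Y, PolyOff n ∅ fun u => φ (u ::ₘ Y)) (t : Fin m → ℂ) {x : ℂ}
    (h0 : dReg p z lam x ≠ 0) (h1 : ∀ c, sn p (x - tailPt (z 0 + lam 0) k c + 1) ≠ 0)
    (h2 : ∀ b, sn p (x - t b - 1) ≠ 0) :
    ContinuousAt (evalFun p z lam k φ t) x := by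
  obtain ⟨P, -, hP⟩ := hφ ((List.ofFn (pts p (tailPt (z 0 + lam 0) k)) : Multiset ℂ) +
    (List.ofFn (pts p t) : Multiset ℂ))
  have c1 : ContinuousAt (fun x => φ (qpow p (2 * x) ::ₘ
      ((List.ofFn (pts p (tailPt (z 0 + lam 0) k)) : Multiset ℂ) +
        (List.ofFn (pts p t) : Multiset ℂ)))) x := by
    have e : (fun x => φ (qpow p (2 * x) ::ₘ
      ((List.ofFn (pts p (tailPt (z 0 + lam 0) k)) : Multiset ℂ) +
        (List.ofFn (pts p t) : Multiset ℂ)))) = fun x => P.eval (qpow p (2 * x)) :=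
      funext fun x => hP _ (by simp)
    rw [e]
    exact (P.continuous.comp (by fun_prop)).continuousAt
  have c2 : ContinuousAt (dReg p z lam) x := by
    unfold dReg
    fun_prop
  have c3 : ContinuousAt (fun x => (∏ c, sn p (x - tailPt (z 0 + lam 0) k c)) /
      ∏ c, sn p (x - tailPt (z 0 + lam 0) k c + 1)) x :=
    ContinuousAt.div (by fun_prop) (by fun_prop) (Finset.prod_ne_zero_iff.2 fun c _ => h1 c)
  have c4 : ContinuousAt (fun x => (∏ b, sn p (x - t b)) / ∏ b, sn p (x - t b - 1)) x :=
    ContinuousAt.div (by fun_prop) (by fun_prop) (Finset.prod_ne_zero_iff.2 fun b _ => h2 b)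
  exact (c1.mul ((((c2.inv₀ h0).mul continuousAt_const).mul c3).mul continuousAt_const)).mul
    (continuousAt_const.mul (c4.mul continuousAt_const))

/-- The factor in the evaluation map that does not depend on the remaining variables. -/
def evalConst (p : ℂ) (z lam : Fin n → ℂ) (k : ℕ) : ℂ :=
  (dReg p z lam (z 0 + lam 0))⁻¹ *
    (((List.ofFn (pts p (tailPt (z 0 + lam 0) k)) : Multiset ℂ).map (alp p z (-lam))).prod)⁻¹ *
    ((∏ c, sn p (z 0 + lam 0 - tailPt (z 0 + lam 0) k c)) /
      ∏ c, sn p (z 0 + lam 0 - tailPt (z 0 + lam 0) k c + 1)) *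
    om (qpow p 1) (pts p (tailPt (z 0 + lam 0) k))

/-- For each t_b the cross factors along the string telescope to sn(z₁+λ₁-t_b) / sn(z₁+λ₁-t_b-k-1).
This is d/d' at t_b, so the weight for λ becomes the weight for λ'. -/
theorem evalFun_apply (hk : 2 * lam 0 = (k : ℂ)) (φ : Multiset ℂ → ℂ) {m : ℕ} {t : Fin m → ℂ}
    (ht : Generic p z lam t) :
    evalFun p z lam k φ t (z 0 + lam 0) = evalConst p z lam k *
      wtd (qpow p 1) (alp p z (-lamPrime lam))
        (fun Y => φ ((List.ofFn (pts p (stringPt (z 0 + lam 0) k)) : Multiset ℂ) + Y)) (pts p t) := by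
  have e : (((List.ofFn (pts p t) : Multiset ℂ).map (alp p z (-lam))).prod)⁻¹ *
      (((∏ b, sn p (z 0 + lam 0 - t b)) / ∏ b, sn p (z 0 + lam 0 - t b - 1)) *
      ∏ c, ∏ b, (sn p (tailPt (z 0 + lam 0) k c - t b) / sn p (tailPt (z 0 + lam 0) k c - t b - 1))) =
      (((List.ofFn (pts p t) : Multiset ℂ).map (alp p z (-lamPrime lam))).prod)⁻¹ := by
    rw [Finset.prod_comm, ← Finset.prod_div_distrib, ← Finset.prod_mul_distrib, prod_map_ofFn,
      prod_map_ofFn, ← Finset.prod_inv_distrib, ← Finset.prod_inv_distrib,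
      ← Finset.prod_mul_distrib]
    refine Finset.prod_congr rfl fun b _ => ?_
    have hne : ∀ j : ℤ, sn p (z 0 + lam 0 - t b - j) ≠ 0 := fun j => by
      rw [show z 0 + lam 0 - t b - j = -(t b - z 0 - lam 0 + j) by ring, sn_neg, neg_ne_zero]
      exact ht.2 b 0 j
    have h := prod_range_div_of_ne_zero (fun j : ℕ => sn p (z 0 + lam 0 - t b - j)) (k := k)
      fun j _ _ => hne j
    rw [Finset.prod_range_succ', ← Fin.prod_univ_eq_prod_range (fun j : ℕ =>
      sn p (z 0 + lam 0 - t b - (j + 1 : ℕ)) / sn p (z 0 + lam 0 - t b - (j + 1 + 1 : ℕ)))] at h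
    have e1 : (sn p (z 0 + lam 0 - t b) / sn p (z 0 + lam 0 - t b - 1)) *
        (∏ c, sn p (tailPt (z 0 + lam 0) k c - t b) / sn p (tailPt (z 0 + lam 0) k c - t b - 1)) =
        sn p (z 0 + lam 0 - t b) / sn p (z 0 + lam 0 - t b - (k + 1)) := by
      rw [mul_comm]
      convert h using 1
      · congr 1
        · refine Finset.prod_congr rfl fun c _ => ?_
          simp only [tailPt]
          push_cast
          congr 2 <;> ring
        · push_cast
          congr 2 <;> ring
      · push_cast
        congr 2
        ring
    rw [e1]
    have h1 := alp_update_ratio (p := p) z (-lam) (lam 0 + 1) (t b)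
    rw [← neg_lamPrime] at h1
    have h2 := hne 0
    have h3 := hne (k + 1)
    push_cast at h2 h3
    rw [sub_zero] at h2
    have h4 : sn p (t b - z 0 + (-lam) 0) = -sn p (z 0 + lam 0 - t b) := by
      rw [← sn_neg]
      congr 1
      simp only [Pi.neg_apply]
      ring
    have h5 : sn p (t b - z 0 + (lam 0 + 1)) = -sn p (z 0 + lam 0 - t b - (k + 1)) := by
      rw [← sn_neg]
      congr 1
      linear_combination hk
    have h6 := ht.alp_ne_zero b
    rw [h4, h5] at h1
    have h7 : alp p z (-lamPrime lam) (pts p t b) ≠ 0 := by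
      intro h0
      rw [pts] at h0 h6
      rw [h0, zero_mul] at h1
      exact mul_ne_zero h6 (neg_ne_zero.2 h3) h1.symm
    change alp p z (-lamPrime lam) (pts p t b) * _ = alp p z (-lam) (pts p t b) * _ at h1
    field_simp
    linear_combination -h1
  rw [evalFun, evalConst, wtd, ← e, stringPt_eq_cons, pts_cons, coe_ofFn_cons, Multiset.cons_add]
  ring

end

/-! ### The limit at the pole, nonvanishing of the constant, and properties of the evaluation map -/

theorem eventually_sn_sub_ne_zero {p : ℂ} (hp : p ≠ 0) (x₀ : ℂ) :
    ∀ᶠ x in 𝓝[≠] x₀, sn p (x - x₀) ≠ 0 := by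
  have h1 : ∀ᶠ x in 𝓝[≠] x₀, ‖x - x₀‖ < ‖p‖ := by
    refine nhdsWithin_le_nhds ((isOpen_lt (by fun_prop) continuous_const).mem_nhds ?_)
    simpa using hp
  filter_upwards [h1, self_mem_nhdsWithin] with x hx hne h0
  obtain ⟨m, hm⟩ := (sn_eq_zero_iff hp _).1 h0
  rw [hm, norm_mul, mul_lt_iff_lt_one_right (norm_pos_iff.2 hp), Complex.norm_intCast] at hx
  have hm0 : m = 0 := by
    rw [← Int.abs_lt_one_iff]
    exact_mod_cast hx
  rw [hm0, Int.cast_zero, mul_zero] at hm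
  exact hne (sub_eq_zero.1 hm)

theorem sn_pole_ne_zero {n : ℕ} [NeZero n] {p : ℂ} (hp : ∀ r : ℚ, p ≠ (r : ℂ)) {z lam : Fin n → ℂ} {k : ℕ}
    (hpole : ∀ a : Fin n, a ≠ 0 → ∀ j : ℕ, j ≤ k → ∀ m : ℤ,
      z a + lam a ≠ z 0 + lam 0 - (j : ℂ) + p * (m : ℂ))
    {a : Fin n} (ha : a ≠ 0) {j : ℕ} (hj : j ≤ k) :
    sn p (z 0 + lam 0 - j - z a - lam a) ≠ 0 := by
  have hp0 : p ≠ 0 := by simpa using hp 0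
  rw [Ne, sn_eq_zero_iff hp0]
  rintro ⟨m, hm⟩
  refine hpole a ha j hj (-m) ?_
  push_cast
  linear_combination -hm

theorem dReg_ne_zero {n : ℕ} [NeZero n] {p : ℂ} (hp : ∀ r : ℚ, p ≠ (r : ℂ)) {z lam : Fin n → ℂ} {k : ℕ}
    (hpole : ∀ a : Fin n, a ≠ 0 → ∀ j : ℕ, j ≤ k → ∀ m : ℤ,
      z a + lam a ≠ z 0 + lam 0 - (j : ℂ) + p * (m : ℂ)) : dReg p z lam (z 0 + lam 0) ≠ 0 := by
  refine mul_ne_zero (mul_ne_zero (by simp) (qpow_ne_zero _ _))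
    (Finset.prod_ne_zero_iff.2 fun a ha => mul_ne_zero (mul_ne_zero (by simp) (qpow_ne_zero _ _)) ?_)
  simpa using sn_pole_ne_zero hp hpole (Finset.ne_of_mem_erase ha) (Nat.zero_le k)

theorem sn_tailPt_ne_zero {p : ℂ} (hp : ∀ r : ℚ, p ≠ (r : ℂ)) {k : ℕ}
    (x : ℂ) (c : Fin k) (j : ℕ) : sn p (x - tailPt x k c + j) ≠ 0 := by
  have e : x - tailPt x k c + j = ((c + 1 + j : ℕ) : ℤ) := by
    simp only [tailPt]
    push_cast
    ring
  rw [e]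
  exact sn_int_ne_zero hp (by omega)

/-- Sines of differences along the string, and the factor of d with index 1, are nonzero because p
is not rational; the other factors of d are nonzero by the condition on the poles. This makes the
map surjective and not only an intertwiner. -/
theorem evalConst_ne_zero {n : ℕ} [NeZero n] {p : ℂ} (hp : ∀ r : ℚ, p ≠ (r : ℂ)) {z lam : Fin n → ℂ} {k : ℕ}
    (hpole : ∀ a : Fin n, a ≠ 0 → ∀ j : ℕ, j ≤ k → ∀ m : ℤ,
      z a + lam a ≠ z 0 + lam 0 - (j : ℂ) + p * (m : ℂ)) : evalConst p z lam k ≠ 0 := by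
  refine mul_ne_zero (mul_ne_zero (mul_ne_zero (inv_ne_zero (dReg_ne_zero hp hpole))
    (inv_ne_zero ?_)) (div_ne_zero ?_ ?_)) ?_
  · rw [prod_map_ofFn]
    refine Finset.prod_ne_zero_iff.2 fun c _ => alp_neg_ne_zero fun b => ?_
    have e : ∀ b, tailPt (z 0 + lam 0) k c - z b - lam b =
        z 0 + lam 0 - ((c + 1 : ℕ) : ℂ) - z b - lam b := fun b => by
      simp only [tailPt]
      push_cast
      ring
    by_cases hb : b = 0
    · have e' : tailPt (z 0 + lam 0) k c - z b - lam b = ((-(c + 1 : ℕ) : ℤ) : ℂ) := by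
        rw [e, hb]
        push_cast
        ring
      rw [e']
      exact sn_int_ne_zero hp (by omega)
    · rw [e]
      exact sn_pole_ne_zero hp hpole hb (by omega)
  · exact Finset.prod_ne_zero_iff.2 fun c _ => by simpa using sn_tailPt_ne_zero hp (z 0 + lam 0) c 0
  · exact Finset.prod_ne_zero_iff.2 fun c _ => by simpa using sn_tailPt_ne_zero hp (z 0 + lam 0) c 1
  · refine Finset.prod_ne_zero_iff.2 fun a _ => Finset.prod_ne_zero_iff.2 fun b _ => ?_
    split_ifs with hab
    · rw [pts, pts, hh_qpow]
      have e : tailPt (z 0 + lam 0) k a - tailPt (z 0 + lam 0) k b = ((b - a : ℤ) : ℂ) := by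
        simp only [tailPt]
        push_cast
        ring
      have hab' : (a : ℕ) < b := hab
      refine inv_ne_zero (div_ne_zero ?_ ?_)
      · rw [e, show ((b - a : ℤ) : ℂ) + 1 = ((b - a + 1 : ℤ) : ℂ) by push_cast; ring]
        exact sn_int_ne_zero hp (by omega)
      · rw [e]
        exact sn_int_ne_zero hp (by omega)
    · exact one_ne_zero

/-- Near the pole, but not at it, `tilde` coincides with the continuous function `evalFun`, so the
limit is the value of the latter. -/
theorem tendsto_tilde {n : ℕ} [NeZero n] {p : ℂ} (hp : ∀ r : ℚ, p ≠ (r : ℂ)) {z lam : Fin n → ℂ} {k : ℕ}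
    (hpole : ∀ a : Fin n, a ≠ 0 → ∀ j : ℕ, j ≤ k → ∀ m : ℤ,
      z a + lam a ≠ z 0 + lam 0 - (j : ℂ) + p * (m : ℂ))
    (hk : 2 * lam 0 = (k : ℂ)) {m : ℕ} {φ : Multiset ℂ → ℂ}
    (hφ : ∀ Y, PolyOff n ∅ fun u => φ (u ::ₘ Y)) {f : (Fin (k + 1 + m) → ℂ) → ℂ}
    (hf : ∀ s, f s = wtd (qpow p 1) (alp p z (-lam)) φ (pts p s)) {t : Fin m → ℂ}
    (ht : Generic p z lam t) :
    Filter.Tendsto (fun x => tilde p z lam k m f (evalPoint z lam k m t x))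
      (𝓝[≠] (z 0 + lam 0)) (𝓝 (evalConst p z lam k * wtd (qpow p 1) (alp p z (-lamPrime lam))
        (fun Y => φ ((List.ofFn (pts p (stringPt (z 0 + lam 0) k)) : Multiset ℂ) + Y)) (pts p t))) := by
  have hp0 : p ≠ 0 := by simpa using hp 0
  have hne : ∀ (b : Fin m) (j : ℤ), sn p (z 0 + lam 0 - t b - j) ≠ 0 := fun b j => by
    rw [show z 0 + lam 0 - t b - j = -(t b - z 0 - lam 0 + j) by ring, sn_neg, neg_ne_zero]
    exact ht.2 b 0 j
  rw [← evalFun_apply hk φ ht]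
  have hc := continuousAt_evalFun (k := k) hφ t (dReg_ne_zero hp hpole)
    (fun c => by simpa using sn_tailPt_ne_zero hp (z 0 + lam 0) c 1)
    (fun b => by simpa using hne b 1)
  refine (hc.tendsto.mono_left nhdsWithin_le_nhds).congr' ?_
  have h1 : ∀ᶠ x in 𝓝[≠] (z 0 + lam 0), ∀ b, sn p (x - t b + 1) ≠ 0 := by
    refine Filter.eventually_all.2 fun b => nhdsWithin_le_nhds ?_
    refine ContinuousAt.eventually_ne (by fun_prop) ?_
    simpa using hne b (-1)
  filter_upwards [eventually_sn_sub_ne_zero hp0 (z 0 + lam 0), h1] with x hx hx1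
  refine (tilde_eq_evalFun hf t (by rwa [← sub_sub] at hx) hx1 fun c b => ?_).symm
  have := hne b c
  convert this using 2
  simp only [tailPt]
  push_cast
  ring

/-- The evaluation map. -/
def evalMap {n : ℕ} [NeZero n] {p : ℂ} {z lam : Fin n → ℂ} (hp0 : p ≠ 0) (S : TrigData p z lam) (k : ℕ) :
    Space p z lam →ₗ[ℂ] Space p z (lamPrime lam) :=
  (spaceEquiv hp0 z (lamPrime lam)).toLinearMap ∘ₗ
    (evalConst p z lam k • S.spec (List.ofFn (pts p (stringPt (z 0 + lam 0) k)))) ∘ₗ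
      (spaceEquiv hp0 z lam).symm.toLinearMap

theorem evalMap_apply {n : ℕ} [NeZero n] {p : ℂ} {z lam : Fin n → ℂ} {k : ℕ}
    (hp0 : p ≠ 0) (S : TrigData p z lam) (m : PolySpace n) :
    evalMap hp0 S k (spaceEquiv hp0 z lam m) = spaceEquiv hp0 z (lamPrime lam)
      (evalConst p z lam k • S.spec (List.ofFn (pts p (stringPt (z 0 + lam 0) k))) m) := by
  change spaceEquiv hp0 z (lamPrime lam) (evalConst p z lam k •
    S.spec (List.ofFn (pts p (stringPt (z 0 + lam 0) k)))
      ((spaceEquiv hp0 z lam).symm (spaceEquiv hp0 z lam m))) = _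
  rw [LinearEquiv.symm_apply_apply]

theorem evalMap_surjective {n : ℕ} [NeZero n] {p : ℂ} (hp : ∀ r : ℚ, p ≠ (r : ℂ)) {z lam : Fin n → ℂ} {k : ℕ}
    (hpole : ∀ a : Fin n, a ≠ 0 → ∀ j : ℕ, j ≤ k → ∀ m : ℤ,
      z a + lam a ≠ z 0 + lam 0 - (j : ℂ) + p * (m : ℂ))
    (S : TrigData p z lam) (hp0 : p ≠ 0) :
    Function.Surjective (evalMap hp0 S k) := by
  intro v
  obtain ⟨m, rfl⟩ := (spaceEquiv hp0 z (lamPrime lam)).surjective v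
  obtain ⟨m', hm'⟩ := S.spec_surjective (S.C_gen_surjective (NeZero.pos n))
    (List.ofFn (pts p (stringPt (z 0 + lam 0) k))) ((evalConst p z lam k)⁻¹ • m)
  refine ⟨spaceEquiv hp0 z lam m', ?_⟩
  rw [evalMap_apply, hm', smul_inv_smul₀ (evalConst_ne_zero hp hpole)]

theorem evalMap_rep {n : ℕ} [NeZero n] {p : ℂ} (hp : ∀ r : ℚ, p ≠ (r : ℂ)) {z lam : Fin n → ℂ} {k : ℕ}
    (hk : 2 * lam 0 = (k : ℂ)) (S : TrigData p z lam)
    (S' : TrigData p z (lamPrime lam)) (hp0 : p ≠ 0) (x : Uq (qpow p 1)) (v : Space p z lam) :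
    evalMap hp0 S k (spaceRep hp0 S x v) = spaceRep hp0 S' x (evalMap hp0 S k v) := by
  obtain ⟨m, rfl⟩ := (spaceEquiv hp0 z lam).surjective v
  rw [spaceRep_apply, evalMap_apply, evalMap_apply, spaceRep_apply, map_smul (S'.rep _ x),
    OperatorData.spec_rep (S' := S') (isString_stringPt hp hk) _ (normalized_alp p z (lamPrime lam))]

theorem evalMap_isEvaluation {n : ℕ} [NeZero n] {p : ℂ} (hp : ∀ r : ℚ, p ≠ (r : ℂ)) {z lam : Fin n → ℂ} {k : ℕ}
    (hpole : ∀ a : Fin n, a ≠ 0 → ∀ j : ℕ, j ≤ k → ∀ m : ℤ,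
      z a + lam a ≠ z 0 + lam 0 - (j : ℂ) + p * (m : ℂ))
    (hk : 2 * lam 0 = (k : ℂ)) (S : TrigData p z lam) (hp0 : p ≠ 0) :
    IsEvaluation p z lam k (evalMap hp0 S k) := by
  have hS := isString_stringPt hp (z := z) hk
  have key : ∀ (l : ℕ) (P : symPoly n l) (X : Multiset ℂ), X.Nodup →
      (∀ x ∈ X, x ∉ (List.ofFn (pts p (stringPt (z 0 + lam 0) k)) : Multiset ℂ)) →
      evM n X (S.spec (List.ofFn (pts p (stringPt (z 0 + lam 0) k))) (ofPoly n l P)) =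
        evAt n l ((List.ofFn (pts p (stringPt (z 0 + lam 0) k)) : Multiset ℂ) + X) P :=
    fun l P X hX hX' => by rw [S.evM_spec _ (hS.nodup_add hX hX'), evM_ofPoly]
  have hE : ∀ X : Multiset ℂ,
      (∀ x ∈ X, x ∉ (List.ofFn (pts p (stringPt (z 0 + lam 0) k))).toFinset) →
      ∀ x ∈ X, x ∉ (List.ofFn (pts p (stringPt (z 0 + lam 0) k)) : Multiset ℂ) :=
    fun X h x hx hx' => h x hx (List.mem_toFinset.2 hx')
  refine ⟨fun l hl f => ?_, fun m f => ?_⟩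
  · obtain ⟨P, rfl⟩ := (toSpace_bijective hp0 z lam l).2 f
    have h : S.spec (List.ofFn (pts p (stringPt (z 0 + lam 0) k))) (ofPoly n l P) = 0 := by
      refine polySpace_ext (List.ofFn (pts p (stringPt (z 0 + lam 0) k))).toFinset fun X hX hX' => ?_
      rw [key l P X hX (hE X hX'), map_zero, evAt_of_ne]
      rw [Multiset.card_add, Multiset.coe_card, List.length_ofFn]
      omega
    rw [← spaceEquiv_ofPoly hp0, evalMap_apply, h, smul_zero, map_zero]
  · obtain ⟨P, rfl⟩ := (toSpace_bijective hp0 z lam (k + 1 + m)).2 f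
    -- Specializing k + 1 of the k + 1 + m variables leaves only the component of degree m.
    let Q : symPoly n m := evalConst p z lam k •
      (S.spec (List.ofFn (pts p (stringPt (z 0 + lam 0) k))) (ofPoly n (k + 1 + m) P)) m
    have hQ : ∀ X : Multiset ℂ, Multiset.card X = m → X.Nodup →
        (∀ x ∈ X, x ∉ (List.ofFn (pts p (stringPt (z 0 + lam 0) k)) : Multiset ℂ)) →
        evAt n m X Q = evalConst p z lam k * evAt n (k + 1 + m)
          ((List.ofFn (pts p (stringPt (z 0 + lam 0) k)) : Multiset ℂ) + X) P :=
      fun X hc hX hX' => by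
        rw [← key _ P X hX hX', evM_eq, map_smul, smul_eq_mul]
        subst hc
        rfl
    refine ⟨toSpace p z (lamPrime lam) m Q, ?_, fun t ht => ?_⟩
    · rw [← spaceEquiv_ofPoly hp0, ← spaceEquiv_ofPoly hp0, evalMap_apply]
      congr 1
      refine polySpace_ext (List.ofFn (pts p (stringPt (z 0 + lam 0) k))).toFinset fun X hX hX' => ?_
      rw [map_smul, key _ P X hX (hE X hX'), evM_ofPoly, smul_eq_mul]
      by_cases hc : Multiset.card X = m
      · exact (hQ X hc hX (hE X hX')).symm
      · rw [evAt_of_ne Q hc, evAt_of_ne, mul_zero]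
        rw [Multiset.card_add, Multiset.coe_card, List.length_ofFn]
        omega
    · have h := tendsto_tilde hp hpole hk (evAt_cons_polyOff P)
        (fun s => toSpace_apply p z lam P s) ht
      have e : (toSpace p z (lamPrime lam) m Q : (Fin m → ℂ) → ℂ) t = evalConst p z lam k *
          wtd (qpow p 1) (alp p z (-lamPrime lam)) (fun Y => evAt n (k + 1 + m)
            ((List.ofFn (pts p (stringPt (z 0 + lam 0) k)) : Multiset ℂ) + Y) P) (pts p t) := by
        rw [toSpace_apply, wtd, wtd, hQ _ (by simp) (nodup_ofFn.2 ht.apart.injective), mul_assoc]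
        -- A generic t keeps its points off the string, since t_b - z₁ - λ₁ + j has nonzero sine.
        intro x hx hx'
        obtain ⟨b, rfl⟩ := (List.mem_ofFn' _ _).1 (Multiset.mem_coe.1 hx)
        obtain ⟨j, hj⟩ := (List.mem_ofFn' _ _).1 (Multiset.mem_coe.1 hx')
        have h0 := (sn_sub_eq_zero_iff p _ _).2 hj.symm
        refine ht.2 b 0 j ?_
        rw [← h0]
        congr 1
        simp only [stringPt]
        push_cast
        ring
      rw [e]
      exact h

end TrigHyp

end

theorem mainTheorem9 {n : ℕ} [NeZero n] (p : ℂ) (hp : ∀ r : ℚ, p ≠ (r : ℂ))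
    (z lam : Fin n → ℂ) (k : ℕ) (hk : 2 * lam 0 = (k : ℂ))
    (hpole : ∀ a : Fin n, a ≠ 0 → ∀ j : ℕ, j ≤ k → ∀ m : ℤ,
      z a + lam a ≠ z 0 + lam 0 - (j : ℂ) + p * (m : ℂ)) :
    ∃ (ρ : TrigHyp.Uq (TrigHyp.qpow p 1) →ₐ[ℂ] Module.End ℂ (TrigHyp.Space p z lam))
      (ρ' : TrigHyp.Uq (TrigHyp.qpow p 1) →ₐ[ℂ]
        Module.End ℂ (TrigHyp.Space p z (TrigHyp.lamPrime lam)))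
      (ι : TrigHyp.Space p z lam →ₗ[ℂ] TrigHyp.Space p z (TrigHyp.lamPrime lam)),
      TrigHyp.IsAction p z lam ρ ∧
      TrigHyp.IsAction p z (TrigHyp.lamPrime lam) ρ' ∧
      TrigHyp.IsEvaluation p z lam k ι ∧
      Function.Surjective ι ∧
      ∀ (x : TrigHyp.Uq (TrigHyp.qpow p 1)) (v : TrigHyp.Space p z lam),
        ι (ρ x v) = ρ' x (ι v) := by
  have hp0 : p ≠ 0 := by simpa using hp 0
  obtain ⟨S⟩ := TrigHyp.nonempty_trigData p z lam
  obtain ⟨S'⟩ := TrigHyp.nonempty_trigData p z (TrigHyp.lamPrime lam)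
  exact ⟨TrigHyp.spaceRep hp0 S, TrigHyp.spaceRep hp0 S', TrigHyp.evalMap hp0 S k,
    TrigHyp.spaceRep_isAction hp0 S, TrigHyp.spaceRep_isAction hp0 S',
    TrigHyp.evalMap_isEvaluation hp hpole hk S hp0, TrigHyp.evalMap_surjective hp hpole S hp0,
    TrigHyp.evalMap_rep hp hk S S' hp0⟩
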